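/- Let $H$ be the Hilbert transform on $\mathbb{R}$, i.e. the Fourier multiplier with symbol $-i\,\mathrm{sgn}\,\xi$, and let $\phi\in C(\mathbb{R};H^2(\mathbb{R}))$ be a real-valued solution of the Benjamin-Ono equation $$(\partial_t+H\partial_x^2)\phi=\tfrac12\partial_x(\phi^2),\qquad \phi(0)=\phi_0,$$ (the time derivative being taken in $L^2(\mathbb{R})$), whose initial data, $\phi_0\in H^2(\mathbb{R})$, also satisfies $x\phi_0\in L^2(\mathbb{R})$. Put $$m=\phi^2,\qquad p=\phi H\phi_x-\tfrac13\phi^3,\qquad e=\phi_x^2-\tfrac34\phi^2H\phi_x+\tfrac18\phi^4,$$ $$L\phi=(x-2tH\partial_x)\phi,\qquad \mathcal{L}\phi=x\phi-2t\Big(H\phi_x-\tfrac18\big(3\phi^2-(H\phi)^2\big)\Big).$$ Then: (a) $L\phi(t)\in L^2(\mathbb{R})$ for every $t\in\mathbb{R}$, and $t\mapsto L\phi(t)$ is continuous from $\mathbb{R}$ to $L^2(\mathbb{R})$. (b) At every time $t\in\mathbb{R}$ the functions $x^2m$, $xp$ and $e$ are integrable, and the quantity $$G(\phi)(t)=\int_{\mathbb{R}}x^2m-4xt\,p+4t^2e\;dx$$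 is conserved: $G(\phi)(t)=G(\phi)(0)$ for all $t\in\mathbb{R}$. (c) For every $t\in\mathbb{R}$ one has $\mathcal{L}\phi(t)\in L^2(\mathbb{R})$ and $G(\phi)(t)=\|\mathcal{L}\phi(t)\|_{L^2}^2$. -/

import Mathlib

open MeasureTheory FourierTransform
open scoped SchwartzMap LineDeriv ENNReal

noncomputable section

namespace BenjaminOno

/-- Real-valued square integrable functions on the line. -/
abbrev L2 : Type := Lp ℝ 2 (volume : Measure ℝ)

/-- Complex-valued square integrable functions on the line. -/
abbrev L2C : Type := Lp ℂ 2 (volume : Measure ℝ)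

/-- A real-valued `L²` function, viewed as a complex-valued one. -/
def toComplex (f : L2) : L2C := Complex.ofRealCLM.compLp f

/-- A real-valued `L²` function, viewed as a (complex) tempered distribution. -/
def toDistribution (f : L2) : 𝓢'(ℝ, ℂ) := Lp.toTemperedDistribution (toComplex f)

/-- Multiplying an `L²` function by the symbol `-i sgn ξ` gives an `L²` function. -/
theorem memLp_hilbertSymbol_mul (g : L2C) :
    MemLp (fun ξ : ℝ => -Complex.I * (Real.sign ξ : ℂ) * g ξ) 2 volume := by
  have hs : Measurable Real.sign := by
    unfold Real.sign
    exact Measurable.ite measurableSet_Iio measurable_const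
      (Measurable.ite measurableSet_Ioi measurable_const measurable_const)
  refine (Lp.memLp g).of_le ?_ (Filter.Eventually.of_forall fun ξ => ?_)
  · exact ((measurable_const.mul (Complex.measurable_ofReal.comp hs)).aestronglyMeasurable).mul
      (Lp.aestronglyMeasurable g)
  · rcases Real.sign_apply_eq ξ with h | h | h <;> simp [h]

/-- The Hilbert transform on complex-valued `L²`: the Fourier multiplier with symbol
`-i sgn ξ`. -/
def hilbertC (f : L2C) : L2C := 𝓕⁻ ((memLp_hilbertSymbol_mul (𝓕 f)).toLp _)

/-- The Hilbert transform on real-valued `L²`. Since the symbol `-i sgn ξ` is odd and purely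
imaginary, the multiplier maps real functions to real functions, so that taking the real part
only changes the type of the values. -/
def hilbert (f : L2) : L2 := Complex.reCLM.compLp (hilbertC (toComplex f))

/-- `g ∈ L²` is the derivative of `f ∈ L²` in the sense of distributions. -/
def HasWeakDeriv (f g : L2) : Prop :=
  ∂_{(1 : ℝ)} (toDistribution f) = toDistribution g

open Classical in
/-- The distributional derivative of `f ∈ L²`, when it is an `L²` function
(and `0` otherwise). -/
def weakDeriv (f : L2) : L2 := if h : ∃ g, HasWeakDeriv f g then h.choose else 0

/-- `φ ∈ C(ℝ; H^s)`: the Bessel potentials of order `s` of the functions `φ t` are `L²` functions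
which depend continuously on `t` in `L²`. -/
def ContinuousInSobolev (s : ℝ) (φ : ℝ → L2) : Prop :=
  ∃ F : ℝ → L2C, Continuous F ∧
    ∀ t, TemperedDistribution.besselPotential ℝ ℂ s (toDistribution (φ t)) =
      Lp.toTemperedDistribution (F t)

/-- `φ ∈ C(ℝ; H²)` is a global real-valued solution of the Benjamin-Ono equation
`φ_t + H φ_xx = ½ (φ²)_x`, the time derivative being taken in `L²`. -/
structure IsSolution (φ : ℝ → L2) : Prop where
  continuous_H2 : ContinuousInSobolev 2 φ
  equation : ∀ t, ∃ S N : L2, (∀ᵐ x, S x = (φ t x) ^ 2) ∧ HasWeakDeriv S N ∧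
    HasDerivAt φ ((1 / 2 : ℝ) • N - hilbert (weakDeriv (weakDeriv (φ t)))) t

/-- The mass density `m = φ²`. -/
def massDensity (f : L2) (x : ℝ) : ℝ := f x ^ 2

/-- The momentum density `p = φ Hφ_x - φ³ / 3`. -/
def momentumDensity (f : L2) (x : ℝ) : ℝ :=
  f x * hilbert (weakDeriv f) x - 1 / 3 * f x ^ 3

/-- The energy density `e = φ_x² - (3/4) φ² Hφ_x + φ⁴ / 8`. -/
def energyDensity (f : L2) (x : ℝ) : ℝ :=
  weakDeriv f x ^ 2 - 3 / 4 * f x ^ 2 * hilbert (weakDeriv f) x + 1 / 8 * f x ^ 4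

/-- `G = ∫ x² m - 4 x t p + 4 t² e dx`. -/
def G (t : ℝ) (f : L2) : ℝ :=
  ∫ x : ℝ, x ^ 2 * massDensity f x - 4 * x * t * momentumDensity f x
    + 4 * t ^ 2 * energyDensity f x

/-- `L φ = (x - 2 t H ∂_x) φ`. -/
def linearL (t : ℝ) (f : L2) (x : ℝ) : ℝ :=
  x * f x - 2 * t * hilbert (weakDeriv f) x

/-- `𝓛 φ = x φ - 2 t (Hφ_x - (1/8) (3 φ² - (Hφ)²))`. -/
def nonlinearL (t : ℝ) (f : L2) (x : ℝ) : ℝ :=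
  x * f x - 2 * t * (hilbert (weakDeriv f) x
    - 1 / 8 * (3 * f x ^ 2 - hilbert f x ^ 2))

end BenjaminOno

end

noncomputable section

namespace BenjaminOno

/-! ### The Fourier transform on `L²(ℝ; ℂ)` -/

/-! Write M = ∫ x²m, P = ∫ xp and E = ∫ e. Formally M' = 4P, P' = 2E and E' = 0, so that P(t) = P(0)
+ 2Et and M(t) = M(0) + 4P(0)t + 4Et². Substituting, M − 4tP + 4t²E = M(0) for all t.

Two things stand between this and a proof: `φ` is differentiable in time only as an `L²`-valued map,
and xφ(t) is not known to lie in `L²` for t ≠ 0. For the first, the increment of each functional is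
factored as ⟨φ(t) − φ(s), V(t)⟩ with V continuous, so that differentiability in `L²` suffices
(`hasDerivAt_of_factor`). For the second, x is replaced by the bounded weight w(x) =
sin(2πηx)/(2πη). On the Fourier side this weight is a centred difference of translations by η, so
the commutator [H, w] only sees frequencies |ξ| ≤ η. On a derivative f' it has norm at most twice
that of the part of f in this band (`HasWeakDeriv.norm_comm_le`), which is bounded uniformly in η
and tends to 0 with η. Hence ‖wφ(t)‖ is bounded uniformly in η on bounded time intervals, Fatou's
lemma puts xφ(t) in `L²`, and letting η → 0 in the integrated identities gives the two moment laws
(`IsFlow.inner_moment_eq`, `IsFlow.norm_moment_sq`).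

The algebra rests on one nonlinear fact: f + iHf has spectrum in [0, ∞), hence so has its square,
which means H(f² − (Hf)²) = 2f Hf (`IsHilbert.sq_sub_sq`). It yields ∫ Re(f + iHf)³ = 0, used for
the energy, and ∫ Re(f + iHf)⁴ = 0. Up to exact derivatives and the isometry of H, the difference
between ‖𝓛φ‖² and G is a combination of ∫ Re(φ + iHφ)⁴ and ∫ x Re(φ + iHφ)³. The latter also
vanishes: φ is integrable and φHφ has mean zero, which makes a commutator term disappear in the
limit (`tendsto_inner_comm`, `hasInt_moment_cube`).

Continuity of xφ in `L²` follows because the formula for M makes its norm continuous, while its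
restrictions to bounded sets are continuous (`continuous_moment`). -/

theorem integral_schwartz_smul_fourier (f : L2C) (k : 𝓢(ℝ, ℂ)) :
    ∫ ξ, k ξ * (𝓕 f : L2C) ξ = ∫ x, (𝓕 k) x * f x := by
  have h := congrArg (fun u : 𝓢'(ℝ, ℂ) => u k) (Lp.fourier_toTemperedDistribution_eq f)
  simpa [TemperedDistribution.fourier_apply, Lp.toTemperedDistribution_apply] using h.symm

/-- Locally integrable functions with the same integrals against Schwartz functions agree. -/
theorem ae_eq_of_integral_schwartz {F G : ℝ → ℂ} (hF : LocallyIntegrable F)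
    (hG : LocallyIntegrable G) (h : ∀ k : 𝓢(ℝ, ℂ), ∫ x, k x * F x = ∫ x, k x * G x) :
    F =ᵐ[volume] G := by
  refine ae_eq_of_integral_contDiff_smul_eq hF hG fun g g_smooth g_cpt => ?_
  have hg₁ : HasCompactSupport (Complex.ofRealCLM ∘ g) := g_cpt.comp_left rfl
  have hg₂ := (Complex.ofRealCLM.contDiff (n := (⊤ : ℕ∞))).comp g_smooth
  simpa using h (hg₁.toSchwartzMap hg₂)

theorem locallyIntegrable_L2C (f : L2C) : LocallyIntegrable (f : ℝ → ℂ) :=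
  (Lp.memLp f).locallyIntegrable one_le_two

theorem fourier_ae_eq_of_integral_schwartz {f : L2C} {G : ℝ → ℂ} (hG : LocallyIntegrable G)
    (h : ∀ k : 𝓢(ℝ, ℂ), ∫ ξ, k ξ * G ξ = ∫ x, (𝓕 k) x * f x) :
    ((𝓕 f : L2C) : ℝ → ℂ) =ᵐ[volume] G :=
  ae_eq_of_integral_schwartz (locallyIntegrable_L2C _) hG fun k => by
    rw [integral_schwartz_smul_fourier, h]

/-- The `L²` and `L¹` Fourier transforms agree on `L¹ ∩ L²`. -/
theorem fourier_ae_eq_of_integrable {f : L2C} (hf : Integrable (f : ℝ → ℂ)) :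
    ((𝓕 f : L2C) : ℝ → ℂ) =ᵐ[volume] 𝓕 (f : ℝ → ℂ) := by
  have hcont : Continuous (𝓕 (f : ℝ → ℂ)) :=
    VectorFourier.fourierIntegral_continuous Real.continuous_fourierChar (by fun_prop) hf
  refine fourier_ae_eq_of_integral_schwartz hcont.locallyIntegrable fun k => ?_
  have := VectorFourier.integral_fourierIntegral_smul_eq_flip (μ := volume) (ν := volume)
    (L := innerₗ ℝ) (e := Real.fourierChar) (f := k) (g := f) Real.continuous_fourierChar
    (by fun_prop) k.integrable hf
  rw [flip_innerₗ] at this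
  exact this.symm

theorem fourierInv_eq_of_integrable_fourier {f : L2C} (hf : Integrable ((𝓕 f : L2C) : ℝ → ℂ)) :
    (f : ℝ → ℂ) =ᵐ[volume] 𝓕⁻ ((𝓕 f : L2C) : ℝ → ℂ) := by
  have hcont : Continuous (𝓕⁻ ((𝓕 f : L2C) : ℝ → ℂ)) := by
    rw [Real.fourierInv_eq_fourier_comp_neg]
    exact VectorFourier.fourierIntegral_continuous Real.continuous_fourierChar (by fun_prop)
      hf.comp_neg
  refine ae_eq_of_integral_schwartz (locallyIntegrable_L2C _) hcont.locallyIntegrable fun k => ?_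
  have h1 : ∫ x, k x * f x = ∫ ξ, (𝓕⁻ k) ξ * (𝓕 f : L2C) ξ := by
    rw [integral_schwartz_smul_fourier, fourier_fourierInv_eq]
  rw [h1]
  have := VectorFourier.integral_fourierIntegral_smul_eq_flip (μ := volume) (ν := volume)
    (L := -innerₗ ℝ) (e := Real.fourierChar) (f := k) (g := ((𝓕 f : L2C) : ℝ → ℂ))
    Real.continuous_fourierChar (by simp only [LinearMap.neg_apply]; fun_prop) k.integrable hf
  have hflip : (-innerₗ ℝ : ℝ →ₗ[ℝ] ℝ →ₗ[ℝ] ℝ).flip = -innerₗ ℝ := by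
    ext; simp
  rw [hflip] at this
  rw [SchwartzMap.fourierInv_coe]
  exact this

/-- The unimodular function `x ↦ e^{2π i η x}`. -/
def character (η x : ℝ) : ℂ := Complex.exp (2 * Real.pi * η * x * Complex.I)

theorem norm_character (η x : ℝ) : ‖character η x‖ = 1 := by
  have : character η x = Complex.exp (((2 * Real.pi * η * x : ℝ) : ℂ) * Complex.I) := by
    simp [character]
  rw [this, Complex.norm_exp_ofReal_mul_I]

theorem continuous_character (η : ℝ) : Continuous (character η) := by
  unfold character; fun_prop

theorem memLp_character_mul (η : ℝ) {f : ℝ → ℂ} (hf : MemLp f 2 volume) :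
    MemLp (fun x => character η x * f x) 2 volume :=
  hf.of_le ((continuous_character η).aestronglyMeasurable.mul hf.1)
    (.of_forall fun x => by simp [norm_character])

/-- Multiplication by a character is translation on the Fourier side. -/
theorem fourier_character_mul (η : ℝ) (f g : L2C)
    (hg : (g : ℝ → ℂ) =ᵐ[volume] fun x => character η x * f x) :
    ((𝓕 g : L2C) : ℝ → ℂ) =ᵐ[volume] fun ξ => (𝓕 f : L2C) (ξ - η) := by
  have hmp := measurePreserving_sub_right (volume : Measure ℝ) η
  refine fourier_ae_eq_of_integral_schwartz
    (((Lp.memLp (𝓕 f)).comp_measurePreserving hmp).locallyIntegrable one_le_two) fun k => ?_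
  have h1 : ∫ ξ, k ξ * (𝓕 f : L2C) (ξ - η) =
      ∫ ξ, (k.compSubConstCLM ℂ (-η)) ξ * (𝓕 f : L2C) ξ := by
    rw [← integral_sub_right_eq_self (fun ξ => (k.compSubConstCLM ℂ (-η)) ξ * _) η]
    simp
  rw [h1, integral_schwartz_smul_fourier]
  refine integral_congr_ae ?_
  filter_upwards [hg] with x hx
  rw [hx, ← mul_assoc]
  congr 1
  rw [SchwartzMap.fourier_coe, SchwartzMap.fourier_coe, Real.fourier_real_eq_integral_exp_smul,
    Real.fourier_real_eq_integral_exp_smul, ← integral_sub_right_eq_self _ η,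
    ← integral_mul_const]
  refine integral_congr_ae (.of_forall fun y => ?_)
  simp only [SchwartzMap.compSubConstCLM_apply, smul_eq_mul, sub_neg_eq_add, sub_add_cancel,
    character]
  have he : Complex.exp (↑(-2 * Real.pi * (y - η) * x) * Complex.I) =
      Complex.exp (↑(-2 * Real.pi * y * x) * Complex.I) *
        Complex.exp (2 * Real.pi * η * x * Complex.I) := by
    rw [← Complex.exp_add]
    congr 1
    push_cast
    ring
  rw [he]
  ring

theorem toComplex_coe (f : L2) : (toComplex f : ℝ → ℂ) =ᵐ[volume] fun x => (f x : ℂ) :=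
  Complex.ofRealCLM.coeFn_compLp f

/-- Conjugation on the Fourier side. -/
theorem fourier_conj (f g : L2C) (hg : (g : ℝ → ℂ) =ᵐ[volume] fun x => (starRingEnd ℂ) (f x)) :
    ((𝓕 g : L2C) : ℝ → ℂ) =ᵐ[volume] fun ξ => (starRingEnd ℂ) ((𝓕 f : L2C) (-ξ)) := by
  have hmp := Measure.measurePreserving_neg (volume : Measure ℝ)
  have hconj : MemLp (fun ξ => (starRingEnd ℂ) ((𝓕 f : L2C) (-ξ))) 2 volume :=
    ((Lp.memLp (𝓕 f)).comp_measurePreserving hmp).star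
  refine fourier_ae_eq_of_integral_schwartz (hconj.locallyIntegrable one_le_two) fun k => ?_
  -- The test function conj k(−x) is chosen because its Fourier transform is the conjugate of that
  -- of k.
  let k' : 𝓢(ℝ, ℂ) := (k.postcompCLM (𝕜 := ℝ)
    (Complex.conjCLE : ℂ →L[ℝ] ℂ)).compCLMOfContinuousLinearEquiv ℝ (ContinuousLinearEquiv.neg ℝ)
  have hk' : ∀ x, k' x = (starRingEnd ℂ) (k (-x)) := fun x => rfl
  have hF : ∀ x, (starRingEnd ℂ) ((𝓕 k') x) = (𝓕 k) x := fun x => by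
    rw [SchwartzMap.fourier_coe, SchwartzMap.fourier_coe,
      Real.fourier_real_eq_integral_exp_smul, Real.fourier_real_eq_integral_exp_smul,
      ← integral_conj, ← integral_neg_eq_self]
    refine integral_congr_ae (.of_forall fun y => ?_)
    simp only [hk', smul_eq_mul, map_mul, neg_neg, Complex.conj_conj, ← Complex.exp_conj,
      Complex.conj_I, Complex.conj_ofReal]
    congr 2
    push_cast
    ring
  have h := congrArg (starRingEnd ℂ) (integral_schwartz_smul_fourier f k')
  rw [← integral_conj, ← integral_conj, ← integral_neg_eq_self] at h
  simp only [map_mul, hF, hk', neg_neg, Complex.conj_conj] at h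
  rw [h]
  refine integral_congr_ae ?_
  filter_upwards [hg] with x hx
  rw [hx]

theorem toComplex_injective {f g : L2} (h : toComplex f = toComplex g) : f = g := by
  refine Lp.ext ?_
  filter_upwards [toComplex_coe f, toComplex_coe g] with x h1 h2
  rw [h, h2] at h1
  exact_mod_cast h1.symm

theorem hasWeakDeriv_iff_fourier {f g : L2} : HasWeakDeriv f g ↔
    ((𝓕 (toComplex g) : L2C) : ℝ → ℂ) =ᵐ[volume]
      fun ξ => 2 * Real.pi * Complex.I * ξ * (𝓕 (toComplex f) : L2C) ξ := by
  set G : ℝ → ℂ := fun ξ => 2 * Real.pi * Complex.I * ξ * (𝓕 (toComplex f) : L2C) ξ with hG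
  have hGloc : LocallyIntegrable G := by
    rw [← locallyIntegrableOn_univ]
    refine LocallyIntegrableOn.continuousOn_mul ?_ ?_ isOpen_univ.isLocallyClosed
    · exact (locallyIntegrable_L2C _).locallyIntegrableOn _
    · fun_prop
  have hF : ∀ k : 𝓢(ℝ, ℂ), 𝓕 (∂_{(1 : ℝ)} (toDistribution f)) k = ∫ ξ, k ξ * G ξ := fun k => by
    have ht : (fun x : ℝ => ((inner ℝ x (1 : ℝ) : ℝ) : ℂ)).HasTemperateGrowth := by fun_prop
    rw [TemperedDistribution.fourier_lineDerivOp_eq, toDistribution,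
      Lp.fourier_toTemperedDistribution_eq]
    simp only [smul_apply, TemperedDistribution.smulLeftCLM_apply_apply,
      Lp.toTemperedDistribution_apply]
    rw [← integral_smul]
    refine integral_congr_ae (.of_forall fun y => ?_)
    simp only [SchwartzMap.smulLeftCLM_apply_apply ht, hG, smul_eq_mul]
    simp
    ring
  have hg : ∀ k : 𝓢(ℝ, ℂ), 𝓕 (toDistribution g) k = ∫ ξ, k ξ * (𝓕 (toComplex g) : L2C) ξ :=
    fun k => by
      rw [toDistribution, Lp.fourier_toTemperedDistribution_eq]
      simp
  constructor
  · intro h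
    refine ae_eq_of_integral_schwartz (locallyIntegrable_L2C _) hGloc fun k => ?_
    rw [← hg, ← hF, h]
  · intro h
    have h2 : 𝓕 (∂_{(1 : ℝ)} (toDistribution f)) = 𝓕 (toDistribution g) := by
      ext k
      rw [hF, hg]
      refine integral_congr_ae ?_
      filter_upwards [h] with ξ hξ
      rw [hξ]
    have h3 := congrArg (fun u : 𝓢'(ℝ, ℂ) => 𝓕⁻ u) h2
    simp only [fourierInv_fourier_eq] at h3
    exact h3

/-! ### The Fourier transform of real functions, weak derivatives and the Hilbert transform -/

/-- The Fourier transform of a real-valued `L²` function. -/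
def ft (f : L2) : ℝ → ℂ := (𝓕 (toComplex f) : L2C)

theorem memLp_ft (f : L2) : MemLp (ft f) 2 volume := Lp.memLp _

theorem ext_ft {f g : L2} (h : ft f =ᵐ[volume] ft g) : f = g := by
  have h1 : (𝓕 (toComplex f) : L2C) = 𝓕 (toComplex g) := Lp.ext h
  have h2 := congrArg (fun u : L2C => 𝓕⁻ u) h1
  simp only [fourierInv_fourier_eq] at h2
  exact toComplex_injective h2

theorem toComplex_add (f g : L2) : toComplex (f + g) = toComplex f + toComplex g :=
  (Complex.ofRealCLM.compLpL 2 (volume : Measure ℝ)).map_add f g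

theorem toComplex_smul (c : ℝ) (f : L2) : toComplex (c • f) = (c : ℂ) • toComplex f := by
  refine (ContinuousLinearMap.map_smul
    (Complex.ofRealCLM.compLpL 2 (volume : Measure ℝ)) c f).trans ?_
  refine Lp.ext ?_
  filter_upwards [Lp.coeFn_smul c (Complex.ofRealCLM.compLpL 2 (volume : Measure ℝ) f),
    Lp.coeFn_smul (c : ℂ) (toComplex f)] with x h1 h2
  rw [h1, h2]
  simp [toComplex, ContinuousLinearMap.compLpL]

theorem ft_add (f g : L2) : ft (f + g) =ᵐ[volume] fun ξ => ft f ξ + ft g ξ := by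
  unfold ft
  rw [toComplex_add, FourierTransform.fourier_add]
  exact Lp.coeFn_add _ _

theorem ft_smul (c : ℝ) (f : L2) : ft (c • f) =ᵐ[volume] fun ξ => c * ft f ξ := by
  unfold ft
  rw [toComplex_smul, FourierTransform.fourier_smul]
  exact Lp.coeFn_smul _ _

theorem ft_sub (f g : L2) : ft (f - g) =ᵐ[volume] fun ξ => ft f ξ - ft g ξ := by
  have h : f - g = f + (-1 : ℝ) • g := by simp [sub_eq_add_neg]
  rw [h]
  filter_upwards [ft_add f ((-1 : ℝ) • g), ft_smul (-1) g] with ξ h1 h2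
  rw [h1, h2]
  push_cast
  ring

theorem ft_neg (f : L2) : ft (-f) =ᵐ[volume] fun ξ => -ft f ξ := by
  have h : -f = (-1 : ℝ) • f := by simp
  rw [h]
  filter_upwards [ft_smul (-1) f] with ξ h2
  rw [h2]
  push_cast
  ring

/-- Parseval's identity. -/
theorem integral_mul_eq_ft (f g : L2) :
    ((∫ x, f x * g x : ℝ) : ℂ) = ∫ ξ, (starRingEnd ℂ) (ft f ξ) * ft g ξ := by
  have h := Lp.inner_fourier_eq (toComplex f) (toComplex g)
  rw [L2.inner_def, L2.inner_def] at h
  simp only [RCLike.inner_apply'] at h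
  unfold ft
  rw [h]
  refine integral_complex_ofReal.symm.trans ?_
  refine integral_congr_ae ?_
  filter_upwards [toComplex_coe f, toComplex_coe g] with x h1 h2
  simp [h1, h2]

theorem hasWeakDeriv_iff_ft {f g : L2} : HasWeakDeriv f g ↔
    ft g =ᵐ[volume] fun ξ => 2 * Real.pi * Complex.I * ξ * ft f ξ := hasWeakDeriv_iff_fourier

theorem HasWeakDeriv.unique {f g g' : L2} (h : HasWeakDeriv f g) (h' : HasWeakDeriv f g') :
    g = g' :=
  ext_ft ((hasWeakDeriv_iff_ft.1 h).trans (hasWeakDeriv_iff_ft.1 h').symm)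

theorem HasWeakDeriv.weakDeriv_eq {f g : L2} (h : HasWeakDeriv f g) : weakDeriv f = g := by
  have he : ∃ g, HasWeakDeriv f g := ⟨g, h⟩
  unfold weakDeriv
  rw [dif_pos he]
  exact he.choose_spec.unique h

theorem HasWeakDeriv.add {f g f' g' : L2} (hf : HasWeakDeriv f f') (hg : HasWeakDeriv g g') :
    HasWeakDeriv (f + g) (f' + g') := by
  rw [hasWeakDeriv_iff_ft] at *
  filter_upwards [hf, hg, ft_add f g, ft_add f' g'] with ξ h1 h2 h3 h4
  rw [h3, h4, h1, h2]
  ring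

theorem HasWeakDeriv.smul {f f' : L2} (c : ℝ) (hf : HasWeakDeriv f f') :
    HasWeakDeriv (c • f) (c • f') := by
  rw [hasWeakDeriv_iff_ft] at *
  filter_upwards [hf, ft_smul c f, ft_smul c f'] with ξ h1 h3 h4
  rw [h3, h4, h1]
  ring

/-- Integration by parts. -/
theorem HasWeakDeriv.integral_mul {f f' g g' : L2} (hf : HasWeakDeriv f f')
    (hg : HasWeakDeriv g g') : ∫ x, f x * g' x = -∫ x, f' x * g x := by
  rw [hasWeakDeriv_iff_ft] at *
  have h : ((∫ x, f x * g' x : ℝ) : ℂ) = ((-∫ x, f' x * g x : ℝ) : ℂ) := by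
    rw [Complex.ofReal_neg, integral_mul_eq_ft, integral_mul_eq_ft, ← integral_neg]
    refine integral_congr_ae ?_
    filter_upwards [hf, hg] with ξ h1 h2
    rw [h1, h2]
    simp only [map_mul, Complex.conj_I, Complex.conj_ofReal, Complex.conj_ofNat]
    ring
  exact_mod_cast h

theorem ae_ne_zero : ∀ᵐ ξ : ℝ, ξ ≠ 0 := by
  simp [ae_iff]

theorem fourier_hilbertC (f : L2C) : ((𝓕 (hilbertC f) : L2C) : ℝ → ℂ) =ᵐ[volume]
    fun ξ => -Complex.I * (Real.sign ξ : ℂ) * (𝓕 f : L2C) ξ := by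
  unfold hilbertC
  rw [fourier_fourierInv_eq]
  exact MemLp.coeFn_toLp _

/-- A square integrable function with Hermitian Fourier transform is real-valued. -/
theorem toComplex_re_of_hermitian {u : L2C}
    (h : ∀ᵐ ξ : ℝ, (𝓕 u : L2C) (-ξ) = (starRingEnd ℂ) ((𝓕 u : L2C) ξ)) :
    toComplex (Complex.reCLM.compLp u) = u := by
  set v : L2C := (Lp.memLp u).star.toLp _ with hv
  have hv' : (v : ℝ → ℂ) =ᵐ[volume] fun x => (starRingEnd ℂ) (u x) := MemLp.coeFn_toLp _
  have hvu : v = u := by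
    have h1 : (𝓕 v : L2C) = 𝓕 u := by
      refine Lp.ext ?_
      filter_upwards [fourier_conj u v hv', h] with ξ h1 h2
      rw [h1, h2, Complex.conj_conj]
    have h2 := congrArg (fun u : L2C => 𝓕⁻ u) h1
    simpa only [fourierInv_fourier_eq] using h2
  refine Lp.ext ?_
  have hre : (Complex.reCLM.compLp u : ℝ → ℝ) =ᵐ[volume] fun x => (u x).re :=
    Complex.reCLM.coeFn_compLp u
  rw [hvu] at hv'
  filter_upwards [toComplex_coe (Complex.reCLM.compLp u), hre, hv'] with x h1 h2 h3
  rw [h1, h2]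
  exact (Complex.conj_eq_iff_re.1 h3.symm)

theorem ft_neg_arg (f : L2) : ∀ᵐ ξ : ℝ, ft f (-ξ) = (starRingEnd ℂ) (ft f ξ) := by
  have hr := fourier_conj (toComplex f) (toComplex f) (by
    filter_upwards [toComplex_coe f] with x hx
    simp [hx])
  filter_upwards [hr] with ξ hξ
  unfold ft
  rw [hξ, Complex.conj_conj]

/-- Hermitian symmetry makes the inverse transform real-valued, so passing to its real part loses
nothing. -/
theorem exists_ft_eq {G : ℝ → ℂ} (hG : MemLp G 2 volume)
    (h : ∀ᵐ ξ : ℝ, G (-ξ) = (starRingEnd ℂ) (G ξ)) : ∃ g : L2, ft g =ᵐ[volume] G := by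
  have hmp := (Measure.measurePreserving_neg (volume : Measure ℝ)).quasiMeasurePreserving
  have hF : (𝓕 (𝓕⁻ (hG.toLp G) : L2C) : L2C) = hG.toLp G := fourier_fourierInv_eq _
  refine ⟨Complex.reCLM.compLp (𝓕⁻ (hG.toLp G) : L2C), ?_⟩
  unfold ft
  rw [toComplex_re_of_hermitian, hF]
  · exact hG.coeFn_toLp
  · rw [hF]
    filter_upwards [hG.coeFn_toLp, hmp.ae hG.coeFn_toLp, h] with ξ h1 h2 h3
    rw [h1, h2, h3]

theorem toComplex_hilbert (f : L2) : toComplex (hilbert f) = hilbertC (toComplex f) := by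
  have hmp := (Measure.measurePreserving_neg (volume : Measure ℝ)).quasiMeasurePreserving
  refine toComplex_re_of_hermitian ?_
  filter_upwards [fourier_hilbertC (toComplex f), hmp.ae (fourier_hilbertC (toComplex f)),
    ft_neg_arg f] with ξ h2 h3 h4
  unfold ft at h4
  rw [h2, h3, h4, Real.sign_neg]
  simp

theorem ft_hilbert (f : L2) :
    ft (hilbert f) =ᵐ[volume] fun ξ => -Complex.I * (Real.sign ξ : ℂ) * ft f ξ := by
  unfold ft
  rw [toComplex_hilbert]
  exact fourier_hilbertC _

theorem sign_mul_self_of_ne_zero {ξ : ℝ} (h : ξ ≠ 0) :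
    (Real.sign ξ : ℂ) * (Real.sign ξ : ℂ) = 1 := by
  rcases Real.sign_apply_eq_of_ne_zero ξ h with h | h <;> simp [h]

theorem hilbert_hilbert (f : L2) : hilbert (hilbert f) = -f := by
  refine ext_ft ?_
  filter_upwards [ft_hilbert f, ft_hilbert (hilbert f), ft_neg f, ae_ne_zero] with ξ h1 h2 h3 h4
  rw [h2, h1, h3]
  linear_combination (ft f ξ * (Real.sign ξ : ℂ) * (Real.sign ξ : ℂ)) * Complex.I_mul_I -
    ft f ξ * sign_mul_self_of_ne_zero h4

theorem hilbert_add (f g : L2) : hilbert (f + g) = hilbert f + hilbert g := by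
  refine ext_ft ?_
  filter_upwards [ft_hilbert f, ft_hilbert g, ft_hilbert (f + g), ft_add f g,
    ft_add (hilbert f) (hilbert g)] with ξ h1 h2 h3 h4 h5
  rw [h3, h4, h5, h1, h2]
  ring

theorem hilbert_smul (c : ℝ) (f : L2) : hilbert (c • f) = c • hilbert f := by
  refine ext_ft ?_
  filter_upwards [ft_hilbert f, ft_hilbert (c • f), ft_smul c f,
    ft_smul c (hilbert f)] with ξ h1 h2 h3 h4
  rw [h2, h4, h3, h1]
  ring

theorem HasWeakDeriv.hilbert {f g : L2} (h : HasWeakDeriv f g) :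
    HasWeakDeriv (hilbert f) (hilbert g) := by
  rw [hasWeakDeriv_iff_ft] at *
  filter_upwards [h, ft_hilbert f, ft_hilbert g] with ξ h1 h2 h3
  rw [h3, h2, h1]
  ring

theorem integral_hilbert_mul_hilbert (f g : L2) :
    ∫ x, hilbert f x * hilbert g x = ∫ x, f x * g x := by
  have h : ((∫ x, hilbert f x * hilbert g x : ℝ) : ℂ) = ((∫ x, f x * g x : ℝ) : ℂ) := by
    rw [integral_mul_eq_ft, integral_mul_eq_ft]
    refine integral_congr_ae ?_
    filter_upwards [ft_hilbert f, ft_hilbert g, ae_ne_zero] with ξ h1 h2 h3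
    rw [h1, h2]
    simp only [map_mul, map_neg, Complex.conj_I, Complex.conj_ofReal]
    linear_combination (-(starRingEnd ℂ) (ft f ξ) * ft g ξ * (Real.sign ξ : ℂ) *
      (Real.sign ξ : ℂ)) * Complex.I_mul_I +
      (starRingEnd ℂ) (ft f ξ) * ft g ξ * sign_mul_self_of_ne_zero h3
  exact_mod_cast h

theorem integral_hilbert_mul (f g : L2) :
    ∫ x, hilbert f x * g x = -∫ x, f x * hilbert g x := by
  rw [← integral_hilbert_mul_hilbert, hilbert_hilbert, ← integral_neg]
  refine integral_congr_ae ?_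
  filter_upwards [Lp.coeFn_neg f] with x hx
  rw [hx]
  simp

theorem norm_sq_eq_integral (f : L2) : ‖f‖ ^ 2 = ∫ x, f x * f x := by
  rw [← real_inner_self_eq_norm_sq, L2.inner_def]
  simp [sq]

theorem inner_eq_integral (f g : L2) : inner ℝ f g = ∫ x, f x * g x := by
  rw [L2.inner_def]
  simp [mul_comm]

/-- The Hilbert transform as a linear isometry. -/
def hilbertLI : L2 →ₗᵢ[ℝ] L2 where
  toFun := hilbert
  map_add' := hilbert_add
  map_smul' := hilbert_smul
  norm_map' f := by
    have h : ‖hilbert f‖ ^ 2 = ‖f‖ ^ 2 := by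
      rw [norm_sq_eq_integral, norm_sq_eq_integral, integral_hilbert_mul_hilbert]
    exact (pow_left_inj₀ (norm_nonneg _) (norm_nonneg _) two_ne_zero).1 h

theorem norm_hilbert (f : L2) : ‖hilbert f‖ = ‖f‖ := hilbertLI.norm_map f

theorem continuous_hilbert : Continuous hilbert := hilbertLI.continuous

/-! ### Cauchy-Schwarz and the Sobolev bound -/

theorem MemLp.integral_mul_eq_inner {α : Type*} {m : MeasurableSpace α} {μ : Measure α}
    {f g : α → ℝ} (hf : MemLp f 2 μ) (hg : MemLp g 2 μ) :
    ∫ x, f x * g x ∂μ = inner ℝ (hf.toLp f) (hg.toLp g) := by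
  rw [L2.inner_def]
  refine integral_congr_ae ?_
  filter_upwards [hf.coeFn_toLp, hg.coeFn_toLp] with x h1 h2
  simp [h1, h2, mul_comm]

theorem norm_toLp_sq {α : Type*} {m : MeasurableSpace α} {μ : Measure α}
    {f : α → ℝ} (hf : MemLp f 2 μ) : ‖hf.toLp f‖ ^ 2 = ∫ x, f x ^ 2 ∂μ := by
  rw [← real_inner_self_eq_norm_sq, ← MemLp.integral_mul_eq_inner hf hf]
  simp only [sq]

theorem abs_integral_mul_le {α : Type*} {m : MeasurableSpace α} {μ : Measure α}
    {f g : α → ℝ} (hf : MemLp f 2 μ) (hg : MemLp g 2 μ) :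
    |∫ x, f x * g x ∂μ| ≤ √(∫ x, f x ^ 2 ∂μ) * √(∫ x, g x ^ 2 ∂μ) := by
  rw [MemLp.integral_mul_eq_inner hf hg, ← norm_toLp_sq hf, ← norm_toLp_sq hg,
    Real.sqrt_sq (norm_nonneg _), Real.sqrt_sq (norm_nonneg _)]
  exact abs_real_inner_le_norm _ _

theorem integral_norm_ft_sq (f : L2) : ∫ ξ, ‖ft f ξ‖ ^ 2 = ‖f‖ ^ 2 := by
  have h := integral_mul_eq_ft f f
  rw [← norm_sq_eq_integral] at h
  have h2 : ((∫ ξ, ‖ft f ξ‖ ^ 2 : ℝ) : ℂ) = ((‖f‖ ^ 2 : ℝ) : ℂ) := by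
    rw [h]
    refine integral_complex_ofReal.symm.trans (integral_congr_ae (.of_forall fun ξ => ?_))
    simp only [Complex.conj_mul']
    push_cast
    rfl
  exact_mod_cast h2

theorem integrable_norm_ft_sq (f : L2) : Integrable fun ξ => ‖ft f ξ‖ ^ 2 :=
  (memLp_ft f).integrable_norm_pow two_ne_zero

/-- Cauchy–Schwarz for the factors (1 + ξ²)^(-1/2) and (1 + ξ²)^(1/2) |ft f|. The first has `L²`
norm √π ≤ 2, the source of the constant; the second is controlled by f and f' because multiplication
by ξ costs only (2π)⁻¹ ≤ 1. -/
theorem HasWeakDeriv.integral_norm_ft_le {f f' : L2} (h : HasWeakDeriv f f') :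
    Integrable (ft f) ∧ ∫ ξ, ‖ft f ξ‖ ≤ 2 * (‖f‖ + ‖f'‖) := by
  rw [hasWeakDeriv_iff_ft] at h
  set a : ℝ → ℝ := fun ξ => (√(1 + ξ ^ 2))⁻¹ with ha
  set b : ℝ → ℝ := fun ξ => √(1 + ξ ^ 2) * ‖ft f ξ‖ with hb
  have hpos : ∀ ξ : ℝ, 0 < 1 + ξ ^ 2 := fun ξ => by positivity
  have hab : ∀ ξ, a ξ * b ξ = ‖ft f ξ‖ := fun ξ => by
    have := (Real.sqrt_pos.2 (hpos ξ)).ne'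
    simp only [ha, hb]
    field_simp
  have hasq : ∀ ξ, a ξ ^ 2 = (1 + ξ ^ 2)⁻¹ := fun ξ => by
    simp only [ha, inv_pow, Real.sq_sqrt (hpos ξ).le]
  have hbsq : ∀ ξ, b ξ ^ 2 = ‖ft f ξ‖ ^ 2 + ξ ^ 2 * ‖ft f ξ‖ ^ 2 := fun ξ => by
    simp only [hb, mul_pow, Real.sq_sqrt (hpos ξ).le]
    ring
  have hsq' : ∀ᵐ ξ : ℝ, ξ ^ 2 * ‖ft f ξ‖ ^ 2 = (2 * Real.pi)⁻¹ ^ 2 * ‖ft f' ξ‖ ^ 2 := by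
    filter_upwards [h] with ξ hξ
    rw [hξ]
    simp only [norm_mul, Complex.norm_I, Complex.norm_real, Real.norm_eq_abs, mul_pow, sq_abs,
      Complex.norm_ofNat]
    have := Real.pi_pos.ne'
    field_simp
  have hint : Integrable fun ξ : ℝ => ξ ^ 2 * ‖ft f ξ‖ ^ 2 :=
    ((integrable_norm_ft_sq f').const_mul _).congr (hsq'.mono fun ξ hξ => hξ.symm)
  have hmeas : AEStronglyMeasurable (fun ξ => ‖ft f ξ‖) volume := (memLp_ft f).1.norm
  have ham : MemLp a 2 volume := by
    rw [memLp_two_iff_integrable_sq (by fun_prop)]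
    simp only [hasq]
    exact integrable_inv_one_add_sq
  have hbm : MemLp b 2 volume := by
    have hbmeas : AEStronglyMeasurable b volume :=
      (by fun_prop : Measurable fun ξ : ℝ => √(1 + ξ ^ 2)).aestronglyMeasurable.mul hmeas
    rw [memLp_two_iff_integrable_sq hbmeas]
    simp only [hbsq]
    exact (integrable_norm_ft_sq f).add hint
  have hB : ∫ ξ, b ξ ^ 2 ≤ (‖f‖ + ‖f'‖) ^ 2 := by
    simp only [hbsq]
    rw [integral_add (integrable_norm_ft_sq f) hint, integral_congr_ae hsq', integral_const_mul,
      integral_norm_ft_sq, integral_norm_ft_sq]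
    have h1 : (2 * Real.pi)⁻¹ ^ 2 ≤ 1 := by
      refine pow_le_one₀ (by positivity) (inv_le_one_of_one_le₀ ?_)
      linarith [Real.pi_gt_three]
    nlinarith [norm_nonneg f, norm_nonneg f', sq_nonneg ‖f'‖, mul_nonneg (norm_nonneg f)
      (norm_nonneg f'), mul_le_mul_of_nonneg_right h1 (sq_nonneg ‖f'‖)]
  have hI : Integrable (fun ξ => ‖ft f ξ‖) := by
    have := MemLp.integrable_mul ham hbm
    exact this.congr (.of_forall fun ξ => hab ξ)
  refine ⟨(integrable_norm_iff (memLp_ft f).1).1 hI, ?_⟩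
  have hcs := abs_integral_mul_le ham hbm
  simp only [hab, hasq, integral_univ_inv_one_add_sq] at hcs
  refine (le_abs_self _).trans (hcs.trans ?_)
  have h1 : √Real.pi ≤ 2 := by
    rw [Real.sqrt_le_left (by norm_num)]
    linarith [Real.pi_le_four]
  have h2 : √(∫ ξ, b ξ ^ 2) ≤ ‖f‖ + ‖f'‖ := by
    rw [Real.sqrt_le_left (by positivity)]
    exact hB
  exact mul_le_mul h1 h2 (Real.sqrt_nonneg _) (by norm_num)

/-- The Sobolev embedding `H¹ ⊂ L^∞`. -/
theorem HasWeakDeriv.ae_abs_le {f f' : L2} (h : HasWeakDeriv f f') :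
    ∀ᵐ x, |f x| ≤ 2 * (‖f‖ + ‖f'‖) := by
  obtain ⟨h1, h2⟩ := h.integral_norm_ft_le
  filter_upwards [toComplex_coe f, fourierInv_eq_of_integrable_fourier (f := toComplex f) h1]
    with x hx hx'
  have : ‖(toComplex f : ℝ → ℂ) x‖ = |f x| := by rw [hx]; simp
  rw [← this, hx']
  refine (VectorFourier.norm_fourierIntegral_le_integral_norm _ _ _ _ _).trans h2

/-! ### Weak derivatives of functions, and products -/

theorem hasWeakDeriv_iff_integral_complex {f g : L2} : HasWeakDeriv f g ↔
    ∀ k : 𝓢(ℝ, ℂ), ∫ x, deriv k x * (f x : ℂ) = -∫ x, k x * (g x : ℂ) := by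
  have h1 : ∀ k : 𝓢(ℝ, ℂ), (∂_{(1 : ℝ)} (toDistribution f)) k = -∫ x, deriv k x * (f x : ℂ) := by
    intro k
    rw [TemperedDistribution.lineDerivOp_apply_apply, map_neg, toDistribution,
      Lp.toTemperedDistribution_apply]
    congr 1
    refine integral_congr_ae ?_
    filter_upwards [toComplex_coe f] with x hx
    rw [hx, SchwartzMap.lineDerivOp_apply_eq_fderiv, fderiv_apply_one_eq_deriv, smul_eq_mul]
  have h2 : ∀ k : 𝓢(ℝ, ℂ), toDistribution g k = ∫ x, k x * (g x : ℂ) := by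
    intro k
    rw [toDistribution, Lp.toTemperedDistribution_apply]
    refine integral_congr_ae ?_
    filter_upwards [toComplex_coe g] with x hx
    rw [hx, smul_eq_mul]
  constructor
  · intro h k
    rw [← h2, ← neg_eq_iff_eq_neg, ← h1, h]
  · intro h
    show ∂_{(1 : ℝ)} (toDistribution f) = toDistribution g
    ext k
    rw [h1, h2, h, neg_neg]

theorem integrable_schwartz_mul (k : 𝓢(ℝ, ℝ)) {f : ℝ → ℝ} (hf : MemLp f 2 volume) :
    Integrable fun x => k x * f x := MemLp.integrable_mul (k.memLp 2) hf

/-- Real test functions suffice, since the real and imaginary parts of a complex Schwartz function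
are themselves Schwartz. -/
theorem hasWeakDeriv_iff_integral {f g : L2} : HasWeakDeriv f g ↔
    ∀ k : 𝓢(ℝ, ℝ), ∫ x, deriv k x * f x = -∫ x, k x * g x := by
  rw [hasWeakDeriv_iff_integral_complex]
  constructor
  · intro h k
    have h1 := h (k.postcompCLM (𝕜 := ℝ) Complex.ofRealCLM)
    have hd : ∀ x, deriv (k.postcompCLM (𝕜 := ℝ) Complex.ofRealCLM) x = ((deriv k x : ℝ) : ℂ) :=
      fun x => (HasDerivAt.ofReal_comp (k.hasDerivAt x)).deriv
    simp only [hd, SchwartzMap.postcompCLM_apply, Complex.ofRealCLM_apply, ← Complex.ofReal_mul,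
      integral_complex_ofReal, ← Complex.ofReal_neg] at h1
    exact_mod_cast h1
  · intro h k
    have hre := h (k.postcompCLM (𝕜 := ℝ) Complex.reCLM)
    have him := h (k.postcompCLM (𝕜 := ℝ) Complex.imCLM)
    have hdre : ∀ x, deriv (k.postcompCLM (𝕜 := ℝ) Complex.reCLM) x = (deriv k x).re :=
      fun x => (Complex.reCLM.hasFDerivAt.comp_hasDerivAt x (k.hasDerivAt x)).deriv
    have hdim : ∀ x, deriv (k.postcompCLM (𝕜 := ℝ) Complex.imCLM) x = (deriv k x).im :=
      fun x => (Complex.imCLM.hasFDerivAt.comp_hasDerivAt x (k.hasDerivAt x)).deriv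
    simp only [hdre, hdim, SchwartzMap.postcompCLM_apply, Complex.reCLM_apply,
      Complex.imCLM_apply] at hre him
    have hint : ∀ (l : 𝓢(ℝ, ℂ)) (u : L2), Integrable fun x => l x * (u x : ℂ) := fun l u =>
      MemLp.integrable_mul (l.memLp 2) (Lp.memLp u).ofReal
    have hi1 := hint (SchwartzMap.derivCLM ℂ ℂ k) f
    have hi2 := hint k g
    simp only [SchwartzMap.derivCLM_apply] at hi1
    apply Complex.ext
    · rw [Complex.neg_re, ← RCLike.re_eq_complex_re, ← integral_re hi1, ← integral_re hi2]
      simpa using hre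
    · rw [Complex.neg_im, ← RCLike.im_eq_complex_im, ← integral_im hi1, ← integral_im hi2]
      simpa using him

/-- The square integrable function `f'` is the weak derivative of the square integrable
function `f`. -/
def IsDeriv (f f' : ℝ → ℝ) : Prop :=
  ∃ F F' : L2, F =ᵐ[volume] f ∧ F' =ᵐ[volume] f' ∧ HasWeakDeriv F F'

theorem HasWeakDeriv.isDeriv {f f' : L2} (h : HasWeakDeriv f f') : IsDeriv f f' :=
  ⟨f, f', .rfl, .rfl, h⟩

variable {f f' g g' : ℝ → ℝ}

theorem IsDeriv.memLp (h : IsDeriv f f') : MemLp f 2 volume := by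
  obtain ⟨F, F', h1, h2, h3⟩ := h
  exact (memLp_congr_ae h1).1 (Lp.memLp F)

theorem IsDeriv.memLp' (h : IsDeriv f f') : MemLp f' 2 volume := by
  obtain ⟨F, F', h1, h2, h3⟩ := h
  exact (memLp_congr_ae h2).1 (Lp.memLp F')

theorem IsDeriv.memLp_top (h : IsDeriv f f') : MemLp f ∞ volume := by
  obtain ⟨F, F', h1, h2, h3⟩ := h
  exact (memLp_congr_ae h1).1
    (memLp_top_of_bound (Lp.aestronglyMeasurable F) _ (h3.ae_abs_le))

theorem isDeriv_iff_integral : IsDeriv f f' ↔ MemLp f 2 volume ∧ MemLp f' 2 volume ∧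
    ∀ k : 𝓢(ℝ, ℝ), ∫ x, deriv k x * f x = -∫ x, k x * f' x := by
  constructor
  · intro h
    refine ⟨h.memLp, h.memLp', fun k => ?_⟩
    obtain ⟨F, F', h1, h2, h3⟩ := h
    have e1 : ∫ x, deriv k x * F x = ∫ x, deriv k x * f x :=
      integral_congr_ae (h1.mono fun x hx => by simp only [hx])
    have e2 : ∫ x, k x * F' x = ∫ x, k x * f' x :=
      integral_congr_ae (h2.mono fun x hx => by simp only [hx])
    rw [← e1, ← e2, hasWeakDeriv_iff_integral.1 h3 k]
  · rintro ⟨h1, h2, h3⟩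
    refine ⟨h1.toLp f, h2.toLp f', h1.coeFn_toLp, h2.coeFn_toLp,
      hasWeakDeriv_iff_integral.2 fun k => ?_⟩
    have e1 : ∫ x, deriv k x * (h1.toLp f) x = ∫ x, deriv k x * f x :=
      integral_congr_ae (h1.coeFn_toLp.mono fun x hx => by simp only [hx])
    have e2 : ∫ x, k x * (h2.toLp f') x = ∫ x, k x * f' x :=
      integral_congr_ae (h2.coeFn_toLp.mono fun x hx => by simp only [hx])
    rw [e1, e2, h3]

theorem IsDeriv.congr (h : IsDeriv f f') (hf : f =ᵐ[volume] g) (hf' : f' =ᵐ[volume] g') :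
    IsDeriv g g' := by
  obtain ⟨F, F', h1, h2, h3⟩ := h
  exact ⟨F, F', h1.trans hf, h2.trans hf', h3⟩

theorem IsDeriv.integral_mul (hf : IsDeriv f f') (hg : IsDeriv g g') :
    ∫ x, f x * g' x = -∫ x, f' x * g x := by
  obtain ⟨F, F', h1, h2, h3⟩ := hf
  obtain ⟨G, G', k1, k2, k3⟩ := hg
  have e1 : ∫ x, F x * G' x = ∫ x, f x * g' x := integral_congr_ae (h1.mul k2)
  have e2 : ∫ x, F' x * G x = ∫ x, f' x * g x := integral_congr_ae (h2.mul k1)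
  rw [← e1, ← e2, h3.integral_mul k3]

theorem IsDeriv.add (hf : IsDeriv f f') (hg : IsDeriv g g') :
    IsDeriv (fun x => f x + g x) (fun x => f' x + g' x) := by
  obtain ⟨F, F', h1, h2, h3⟩ := hf
  obtain ⟨G, G', k1, k2, k3⟩ := hg
  exact ⟨F + G, F' + G', (Lp.coeFn_add F G).trans (h1.add k1),
    (Lp.coeFn_add F' G').trans (h2.add k2), h3.add k3⟩

theorem IsDeriv.const_mul (c : ℝ) (hf : IsDeriv f f') :
    IsDeriv (fun x => c * f x) (fun x => c * f' x) := by
  obtain ⟨F, F', h1, h2, h3⟩ := hf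
  refine ⟨c • F, c • F', ?_, ?_, h3.smul c⟩
  · filter_upwards [Lp.coeFn_smul c F, h1] with x e1 e2
    simp [e1, e2]
  · filter_upwards [Lp.coeFn_smul c F', h2] with x e1 e2
    simp [e1, e2]

/-- The product rule for a smooth bounded factor. -/
theorem IsDeriv.smooth_mul {w w' : ℝ → ℝ} (hw : w.HasTemperateGrowth)
    (hw' : ∀ x, HasDerivAt w (w' x) x) (hb : MemLp w ∞ volume) (hb' : MemLp w' ∞ volume)
    (hf : IsDeriv f f') : IsDeriv (fun x => w x * f x) (fun x => w' x * f x + w x * f' x) := by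
  refine isDeriv_iff_integral.2 ⟨hf.memLp.mul hb, (hf.memLp.mul hb').add (hf.memLp'.mul hb),
    fun k => ?_⟩
  have h1 := (isDeriv_iff_integral.1 hf).2.2 (SchwartzMap.smulLeftCLM ℝ w k)
  have hd : ∀ x, deriv (SchwartzMap.smulLeftCLM ℝ w k) x = w' x * k x + w x * deriv k x :=
    fun x => by
      rw [SchwartzMap.smulLeftCLM_apply hw]
      exact ((hw' x).mul (k.hasDerivAt x)).deriv
  simp only [hd, SchwartzMap.smulLeftCLM_apply_apply hw, smul_eq_mul] at h1
  have i1 : Integrable fun x => deriv k x * (w x * f x) :=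
    integrable_schwartz_mul (SchwartzMap.derivCLM ℝ ℝ k) (hf.memLp.mul hb)
  have i2 : Integrable fun x => k x * (w' x * f x) :=
    integrable_schwartz_mul k (hf.memLp.mul hb')
  have i3 : Integrable fun x => k x * (w x * f' x) :=
    integrable_schwartz_mul k (hf.memLp'.mul hb)
  have e1 : ∫ x, (w' x * k x + w x * deriv k x) * f x =
      (∫ x, k x * (w' x * f x)) + ∫ x, deriv k x * (w x * f x) := by
    rw [← integral_add i2 i1]
    congr 1; ext x; ring
  have e2 : ∫ x, k x * (w' x * f x + w x * f' x) =
      (∫ x, k x * (w' x * f x)) + ∫ x, w x * k x * f' x := by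
    rw [← integral_add i2 (i3.congr (.of_forall fun x => by ring))]
    congr 1; ext x; ring
  rw [e2]
  linarith

/-- The product rule. -/
theorem IsDeriv.mul (hf : IsDeriv f f') (hg : IsDeriv g g') :
    IsDeriv (fun x => f x * g x) (fun x => f' x * g x + f x * g' x) := by
  refine isDeriv_iff_integral.2 ⟨hg.memLp.mul hf.memLp_top,
    (hg.memLp_top.mul hf.memLp').add (hg.memLp'.mul hf.memLp_top), fun k => ?_⟩
  have hk' : MemLp (deriv k) ∞ volume := (SchwartzMap.derivCLM ℝ ℝ k).memLp ∞ volume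
  -- The test function is absorbed into g, so that the claim becomes integration by parts between f
  -- and kg.
  have hk := hg.smooth_mul (w := k) (w' := deriv k) k.hasTemperateGrowth k.hasDerivAt
    (k.memLp ∞) hk'
  have h1 := hf.integral_mul hk
  have i1 : Integrable fun x => deriv k x * (f x * g x) :=
    integrable_schwartz_mul (SchwartzMap.derivCLM ℝ ℝ k) (hg.memLp.mul hf.memLp_top)
  have i2 : Integrable fun x => k x * (f' x * g x) :=
    integrable_schwartz_mul k (hg.memLp_top.mul hf.memLp')
  have i3 : Integrable fun x => k x * (f x * g' x) :=
    integrable_schwartz_mul k (hg.memLp'.mul hf.memLp_top)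
  have e1 : ∫ x, f x * (deriv k x * g x + k x * g' x) =
      (∫ x, deriv k x * (f x * g x)) + ∫ x, k x * (f x * g' x) := by
    rw [← integral_add i1 i3]
    congr 1; ext x; ring
  have e2 : ∫ x, k x * (f' x * g x + f x * g' x) =
      (∫ x, f' x * (k x * g x)) + ∫ x, k x * (f x * g' x) := by
    rw [← integral_add (i2.congr (.of_forall fun x => by ring)) i3]
    congr 1; ext x; ring
  rw [e2]
  linarith

/-! ### Hardy functions and the Hilbert transform of products -/

/-- The product of two square integrable functions with Fourier transforms supported in
`[0, ∞)` has its Fourier transform supported there too. -/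
theorem fourier_mul_eq_zero_of_neg {u v z : L2C} (hz : (z : ℝ → ℂ) =ᵐ[volume] fun x => u x * v x)
    (hu : ∀ᵐ ξ : ℝ, ξ < 0 → (𝓕 u : L2C) ξ = 0) (hv : ∀ᵐ ξ : ℝ, ξ < 0 → (𝓕 v : L2C) ξ = 0)
    (hi : Integrable ((𝓕 u : L2C) : ℝ → ℂ)) : ∀ᵐ ξ : ℝ, ξ < 0 → (𝓕 z : L2C) ξ = 0 := by
  -- Duality: k is the negative-frequency part of the transform of z and K its inverse transform.
  -- Then ⟨K, z⟩ = ‖k‖², so it is enough to show ⟨K, uv⟩ = 0.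
  have hkm : MemLp ((Set.Iio (0 : ℝ)).indicator (𝓕 z : L2C)) 2 volume :=
    (Lp.memLp (𝓕 z)).indicator measurableSet_Iio
  set k : L2C := hkm.toLp _ with hk
  have hk' : (k : ℝ → ℂ) =ᵐ[volume] (Set.Iio (0 : ℝ)).indicator (𝓕 z : L2C) := hkm.coeFn_toLp
  set K : L2C := 𝓕⁻ k with hK
  have hFK : (𝓕 K : L2C) = k := fourier_fourierInv_eq k
  set g : ℝ → ℂ := fun x => (starRingEnd ℂ) (K x) * v x with hg
  have hgi : Integrable g := MemLp.integrable_mul (Lp.memLp K).star (Lp.memLp v)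
  -- Up to a null set of η: where η < 0 the transform of u vanishes; where η ≥ 0 the character moves
  -- the spectrum of v to the right, so e^{2πiηx} v is orthogonal to K.
  have hg0 : ∀ᵐ η : ℝ, (𝓕 u : L2C) η * (𝓕⁻ g) η = 0 := by
    filter_upwards [hu] with η hη
    rcases lt_or_ge η 0 with h | h
    · rw [hη h, zero_mul]
    · have hcm := memLp_character_mul η (Lp.memLp v)
      have hc := fourier_character_mul η v (hcm.toLp _) hcm.coeFn_toLp
      have h1 := Lp.inner_fourier_eq K (hcm.toLp _)
      rw [hFK, L2.inner_def, L2.inner_def] at h1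
      have h2 : (∫ ξ, inner ℂ (k ξ) ((𝓕 (hcm.toLp _) : L2C) ξ)) = 0 := by
        have hmp := (measurePreserving_sub_right (volume : Measure ℝ) η).quasiMeasurePreserving
        refine integral_eq_zero_of_ae ?_
        filter_upwards [hc, hk', hmp.ae hv] with ξ e1 e2 e3
        rw [e1, e2]
        by_cases hξ : ξ < 0
        · simp [e3 (by linarith)]
        · simp [hξ]
      rw [h2] at h1
      have h3 : (𝓕⁻ g) η = ∫ x, inner ℂ (K x) ((hcm.toLp _ : L2C) x) := by
        rw [Real.fourierInv_eq']
        refine integral_congr_ae ?_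
        filter_upwards [hcm.coeFn_toLp] with x hx
        rw [hx, RCLike.inner_apply' (K x)]
        simp only [hg, smul_eq_mul, character]
        rw [mul_left_comm]
        congr 3
        simp only [RCLike.inner_apply', conj_trivial]
        push_cast
        ring
      rw [h3, ← h1, mul_zero]
  have hu' := fourierInv_eq_of_integrable_fourier hi
  -- As the transform of u is integrable, u is a superposition of characters, and Fubini reduces ⟨K,
  -- uv⟩ to the pairings just shown to vanish.
  have hflip := VectorFourier.integral_fourierIntegral_smul_eq_flip (μ := volume) (ν := volume)
    (L := -innerₗ ℝ) (e := Real.fourierChar) (f := ((𝓕 u : L2C) : ℝ → ℂ)) (g := g)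
    Real.continuous_fourierChar (by simp only [LinearMap.neg_apply]; fun_prop) hi hgi
  have hflip' : (-innerₗ ℝ : ℝ →ₗ[ℝ] ℝ →ₗ[ℝ] ℝ).flip = -innerₗ ℝ := by
    ext; simp
  rw [hflip'] at hflip
  have hzero : ∫ x, (𝓕⁻ ((𝓕 u : L2C) : ℝ → ℂ)) x * g x = 0 :=
    hflip.trans (integral_eq_zero_of_ae hg0)
  have hin : inner ℂ K z = 0 := by
    rw [L2.inner_def, ← hzero]
    refine integral_congr_ae ?_
    filter_upwards [hz, hu'] with x e1 e2
    rw [e1, RCLike.inner_apply', ← e2]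
    simp only [hg]
    ring
  rw [← Lp.inner_fourier_eq, hFK] at hin
  have hkz : inner ℂ k k = 0 := by
    rw [← hin, L2.inner_def, L2.inner_def]
    refine integral_congr_ae ?_
    filter_upwards [hk'] with ξ e1
    rw [e1]
    by_cases hξ : ξ < 0
    · simp [hξ]
    · simp [hξ]
  have hk0 : k = 0 := inner_self_eq_zero.1 hkz
  have hk00 : (k : ℝ → ℂ) =ᵐ[volume] 0 := by
    rw [hk0]
    exact Lp.coeFn_zero _ _ _
  filter_upwards [hk', hk00] with ξ e1 e2 hξ
  rw [e2, Set.indicator_of_mem (show ξ ∈ Set.Iio 0 from hξ)] at e1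
  exact e1.symm

/-- `g` is the Hilbert transform of the square integrable function `f`. -/
def IsHilbert (f g : ℝ → ℝ) : Prop := ∃ F : L2, F =ᵐ[volume] f ∧ hilbert F =ᵐ[volume] g

theorem isHilbert_hilbert (f : L2) : IsHilbert f (hilbert f) := ⟨f, .rfl, .rfl⟩

variable {f f' g g' : ℝ → ℝ}

theorem IsHilbert.memLp (h : IsHilbert f g) : MemLp f 2 volume := by
  obtain ⟨F, h1, h2⟩ := h
  exact (memLp_congr_ae h1).1 (Lp.memLp F)

theorem IsHilbert.memLp' (h : IsHilbert f g) : MemLp g 2 volume := by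
  obtain ⟨F, h1, h2⟩ := h
  exact (memLp_congr_ae h2).1 (Lp.memLp _)

theorem IsHilbert.congr (h : IsHilbert f g) (hf : f =ᵐ[volume] f') (hg : g =ᵐ[volume] g') :
    IsHilbert f' g' := by
  obtain ⟨F, h1, h2⟩ := h
  exact ⟨F, h1.trans hf, h2.trans hg⟩

theorem exists_isHilbert (h : MemLp f 2 volume) : ∃ g, IsHilbert f g :=
  ⟨_, h.toLp f, h.coeFn_toLp, .rfl⟩

theorem IsHilbert.integral_mul_mul (h : IsHilbert f g) (h' : IsHilbert f' g') :
    ∫ x, g x * g' x = ∫ x, f x * f' x := by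
  obtain ⟨F, h1, h2⟩ := h
  obtain ⟨F', k1, k2⟩ := h'
  have e1 : ∫ x, F x * F' x = ∫ x, f x * f' x := integral_congr_ae (h1.mul k1)
  have e2 : ∫ x, hilbert F x * hilbert F' x = ∫ x, g x * g' x := integral_congr_ae (h2.mul k2)
  rw [← e1, ← e2, integral_hilbert_mul_hilbert]

theorem IsHilbert.integral_mul (h : IsHilbert f g) (h' : IsHilbert f' g') :
    ∫ x, g x * f' x = -∫ x, f x * g' x := by
  obtain ⟨F, h1, h2⟩ := h
  obtain ⟨F', k1, k2⟩ := h'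
  have e1 : ∫ x, F x * hilbert F' x = ∫ x, f x * g' x := integral_congr_ae (h1.mul k2)
  have e2 : ∫ x, hilbert F x * F' x = ∫ x, g x * f' x := integral_congr_ae (h2.mul k1)
  rw [← e1, ← e2, integral_hilbert_mul]

theorem IsHilbert.deriv (h : IsHilbert f g) (hf : IsDeriv f f') (h' : IsHilbert f' g') :
    IsDeriv g g' := by
  obtain ⟨F, h1, h2⟩ := h
  obtain ⟨F1, F1', k1, k2, k3⟩ := hf
  obtain ⟨F', l1, l2⟩ := h'
  have e1 : F = F1 := Lp.ext (h1.trans k1.symm)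
  have e2 : F1' = F' := Lp.ext (k2.trans l1.symm)
  subst e1 e2
  exact ⟨_, _, h2, l2, k3.hilbert⟩

theorem IsHilbert.add (h : IsHilbert f g) (h' : IsHilbert f' g') :
    IsHilbert (fun x => f x + f' x) (fun x => g x + g' x) := by
  obtain ⟨F, h1, h2⟩ := h
  obtain ⟨F', k1, k2⟩ := h'
  refine ⟨F + F', (Lp.coeFn_add F F').trans (h1.add k1), ?_⟩
  rw [hilbert_add]
  exact (Lp.coeFn_add _ _).trans (h2.add k2)

theorem IsHilbert.const_mul (c : ℝ) (h : IsHilbert f g) :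
    IsHilbert (fun x => c * f x) (fun x => c * g x) := by
  obtain ⟨F, h1, h2⟩ := h
  refine ⟨c • F, ?_, ?_⟩
  · filter_upwards [Lp.coeFn_smul c F, h1] with x e1 e2
    simp [e1, e2]
  · rw [hilbert_smul]
    filter_upwards [Lp.coeFn_smul c (hilbert F), h2] with x e1 e2
    simp [e1, e2]

/-- The identity `H(f² - (Hf)²) = 2 f Hf`. -/
theorem IsHilbert.sq_sub_sq (h : IsHilbert f g) (hf : IsDeriv f f') :
    IsHilbert (fun x => f x ^ 2 - g x ^ 2) (fun x => 2 * (f x * g x)) := by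
  obtain ⟨gp, hgp⟩ := exists_isHilbert hf.memLp'
  have hg := h.deriv hf hgp
  obtain ⟨F, F', k1, k2, k3⟩ := hf
  obtain ⟨F1, h1, h2⟩ := h
  have e1 : F1 = F := Lp.ext (h1.trans k1.symm)
  subst e1
  have hfm : MemLp f ∞ volume := (memLp_congr_ae k1).1
    (memLp_top_of_bound (Lp.aestronglyMeasurable _) _ (k3.ae_abs_le))
  have hf2 : MemLp f 2 volume := (memLp_congr_ae k1).1 (Lp.memLp _)
  have ham : MemLp (fun x => f x ^ 2 - g x ^ 2) 2 volume := by
    simp only [sq]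
    exact (hf2.mul hfm).sub (hg.memLp.mul hg.memLp_top)
  have hbm : MemLp (fun x => 2 * (f x * g x)) 2 volume := (hg.memLp.mul hfm).const_mul 2
  set a : L2 := ham.toLp _
  set b : L2 := hbm.toLp _
  refine ⟨a, ham.coeFn_toLp, ?_⟩
  suffices hab : hilbert a = b by
    rw [hab]
    exact hbm.coeFn_toLp
  -- The function u = f + iHf has transform (1 + sgn ξ) times that of f, supported in [0, ∞). Its
  -- square is z = (f² − g²) + 2ifg.
  set u : L2C := toComplex F1 + Complex.I • toComplex (hilbert F1) with hu
  have hu' : (u : ℝ → ℂ) =ᵐ[volume] fun x => (f x : ℂ) + Complex.I * (g x : ℂ) := by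
    filter_upwards [Lp.coeFn_add (toComplex F1) (Complex.I • toComplex (hilbert F1)),
      Lp.coeFn_smul Complex.I (toComplex (hilbert F1)), toComplex_coe F1,
      toComplex_coe (hilbert F1), h1, h2] with x e1 e2 e3 e4 e5 e6
    rw [e1, Pi.add_apply, e2, Pi.smul_apply, e3, e4, e5, e6, smul_eq_mul]
  have hFu : ((𝓕 u : L2C) : ℝ → ℂ) =ᵐ[volume] fun ξ => (1 + (Real.sign ξ : ℂ)) * ft F1 ξ := by
    rw [hu, FourierTransform.fourier_add, FourierTransform.fourier_smul]
    filter_upwards [Lp.coeFn_add (𝓕 (toComplex F1)) (Complex.I • 𝓕 (toComplex (hilbert F1))),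
      Lp.coeFn_smul Complex.I (𝓕 (toComplex (hilbert F1))), ft_hilbert F1] with ξ e1 e2 e3
    rw [e1, Pi.add_apply, e2, Pi.smul_apply, smul_eq_mul]
    have e3' : (𝓕 (toComplex (hilbert F1)) : L2C) ξ =
      -Complex.I * (Real.sign ξ : ℂ) * ft F1 ξ := e3
    have e4 : (𝓕 (toComplex F1) : L2C) ξ = ft F1 ξ := rfl
    rw [e3', e4]
    linear_combination (-(Real.sign ξ : ℂ) * ft F1 ξ) * Complex.I_mul_I
  have hFu0 : ∀ᵐ ξ : ℝ, ξ < 0 → (𝓕 u : L2C) ξ = 0 := by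
    filter_upwards [hFu] with ξ e hξ
    rw [e, Real.sign_of_neg hξ]
    simp
  have hFui : Integrable ((𝓕 u : L2C) : ℝ → ℂ) := by
    have hi := k3.integral_norm_ft_le.1
    refine Integrable.mono (hi.norm.const_mul 2) (Lp.aestronglyMeasurable _) ?_
    filter_upwards [hFu] with ξ e
    rw [e, norm_mul]
    have : ‖1 + (Real.sign ξ : ℂ)‖ ≤ 2 := by
      rcases Real.sign_apply_eq ξ with h | h | h <;> rw [h] <;> norm_num
    simp only [norm_mul, norm_norm, Real.norm_ofNat]
    gcongr
  set z : L2C := toComplex a + Complex.I • toComplex b with hz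
  have hz' : (z : ℝ → ℂ) =ᵐ[volume] fun x => u x * u x := by
    filter_upwards [Lp.coeFn_add (toComplex a) (Complex.I • toComplex b),
      Lp.coeFn_smul Complex.I (toComplex b), toComplex_coe a, toComplex_coe b,
      ham.coeFn_toLp, hbm.coeFn_toLp, hu'] with x e1 e2 e3 e4 e5 e6 e7
    rw [e1, Pi.add_apply, e2, Pi.smul_apply, e3, e4, e5, e6, e7, smul_eq_mul]
    push_cast
    linear_combination (-(g x : ℂ) ^ 2) * Complex.I_mul_I
  have hz0 := fourier_mul_eq_zero_of_neg hz' hFu0 hFu0 hFui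
  have hFz : ((𝓕 z : L2C) : ℝ → ℂ) =ᵐ[volume] fun ξ => ft a ξ + Complex.I * ft b ξ := by
    rw [hz, FourierTransform.fourier_add, FourierTransform.fourier_smul]
    filter_upwards [Lp.coeFn_add (𝓕 (toComplex a)) (Complex.I • 𝓕 (toComplex b)),
      Lp.coeFn_smul Complex.I (𝓕 (toComplex b))] with ξ e1 e2
    rw [e1, Pi.add_apply, e2, Pi.smul_apply, smul_eq_mul]
    rfl
  -- On ξ < 0 the vanishing of the transform of z is exactly the multiplier relation between a and
  -- b; on ξ > 0 the relation follows by conjugation, a and b being real.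
  have hneg : ∀ᵐ ξ : ℝ, ξ < 0 → ft a ξ + Complex.I * ft b ξ = 0 := by
    filter_upwards [hz0, hFz] with ξ e1 e2 hξ
    rw [← e2, e1 hξ]
  have hmp := (Measure.measurePreserving_neg (volume : Measure ℝ)).quasiMeasurePreserving
  refine ext_ft ?_
  filter_upwards [ft_hilbert a, hneg, hmp.ae hneg, ft_neg_arg a, ft_neg_arg b, ae_ne_zero]
    with ξ e1 e2 e3 e4 e5 e6
  rw [e1]
  rcases lt_or_gt_of_ne e6 with hξ | hξ
  · rw [Real.sign_of_neg hξ]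
    push_cast
    linear_combination Complex.I * e2 hξ - ft b ξ * Complex.I_mul_I
  · have e7 := congrArg (starRingEnd ℂ) (e3 (by linarith))
    rw [e4, e5] at e7
    simp only [map_add, map_mul, Complex.conj_conj, Complex.conj_I, map_zero] at e7
    rw [Real.sign_of_pos hξ]
    push_cast
    linear_combination (-Complex.I) * e7 - ft b ξ * Complex.I_mul_I

/-! ### Multiplication operators -/

/-- Bounded real-valued functions on the line. -/
abbrev LInf : Type := Lp ℝ ∞ (volume : Measure ℝ)

/-- Multiplication of a square integrable function by a bounded one. -/
def mulL : LInf →L[ℝ] L2 →L[ℝ] L2 := (ContinuousLinearMap.mul ℝ ℝ).holderL volume ∞ 2 2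

theorem mulL_coe (m : LInf) (f : L2) : mulL m f =ᵐ[volume] fun x => m x * f x :=
  (ContinuousLinearMap.mul ℝ ℝ).coeFn_holder m f

theorem norm_mulL_le (m : LInf) (f : L2) : ‖mulL m f‖ ≤ ‖m‖ * ‖f‖ := by
  have := (ContinuousLinearMap.mul ℝ ℝ).norm_holder_apply_apply_le (r := 2) m f
  rw [ContinuousLinearMap.opNorm_mul, one_mul] at this
  exact this

/-- A bounded measurable function, as an element of `L^∞`. -/
def bddMul (m : ℝ → ℝ) (hm : Measurable m) (c : ℝ) (hc : ∀ x, |m x| ≤ c) : LInf :=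
  (memLp_top_of_bound hm.aestronglyMeasurable c (.of_forall hc)).toLp m

theorem bddMul_coe {m : ℝ → ℝ} (hm : Measurable m) {c : ℝ} (hc : ∀ x, |m x| ≤ c) :
    bddMul m hm c hc =ᵐ[volume] m := MemLp.coeFn_toLp _

theorem norm_le_of_ae_bound_top {m : LInf} {c : ℝ} (hc0 : 0 ≤ c) (h : ∀ᵐ x, |m x| ≤ c) :
    ‖m‖ ≤ c := by
  rw [Lp.norm_def]
  refine ENNReal.toReal_le_of_le_ofReal hc0 ?_
  rw [eLpNorm_exponent_top]
  exact eLpNormEssSup_le_of_ae_bound h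

theorem norm_bddMul_le {m : ℝ → ℝ} (hm : Measurable m) {c : ℝ} (hc : ∀ x, |m x| ≤ c) :
    ‖bddMul m hm c hc‖ ≤ c := by
  refine norm_le_of_ae_bound_top ((abs_nonneg _).trans (hc 0)) ?_
  filter_upwards [bddMul_coe hm hc] with x hx
  rw [hx]
  exact hc x

/-! ### The truncated weight `sin (2πηx) / (2πη)` -/

/-- The truncated weight `sin (2πηx) / (2πη)`. -/
def weight (η x : ℝ) : ℝ := Real.sin (2 * Real.pi * η * x) / (2 * Real.pi * η)

/-- The derivative of the truncated weight. -/
def weight' (η x : ℝ) : ℝ := Real.cos (2 * Real.pi * η * x)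

/-- The second derivative of the truncated weight. -/
def weight'' (η x : ℝ) : ℝ := -(2 * Real.pi * η * Real.sin (2 * Real.pi * η * x))

theorem abs_weight_le_abs {η : ℝ} (hη : 0 < η) (x : ℝ) : |weight η x| ≤ |x| := by
  have hp : 0 < 2 * Real.pi * η := by positivity
  rw [weight, abs_div, abs_of_pos hp, div_le_iff₀ hp]
  refine (Real.abs_sin_le_abs).trans ?_
  rw [abs_mul, abs_of_pos hp, mul_comm]

theorem abs_weight_le (η x : ℝ) : |weight η x| ≤ |2 * Real.pi * η|⁻¹ := by
  rw [weight, abs_div, ← one_div]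
  gcongr
  exact Real.abs_sin_le_one _

theorem abs_weight'_le (η x : ℝ) : |weight' η x| ≤ 1 := Real.abs_cos_le_one _

theorem abs_weight''_le (η x : ℝ) : |weight'' η x| ≤ |2 * Real.pi * η| := by
  rw [weight'', abs_neg, abs_mul]
  exact mul_le_of_le_one_right (abs_nonneg _) (Real.abs_sin_le_one _)

theorem measurable_weight (η : ℝ) : Measurable (weight η) := by unfold weight; fun_prop

theorem measurable_weight' (η : ℝ) : Measurable (weight' η) := by unfold weight'; fun_prop

theorem measurable_weight'' (η : ℝ) : Measurable (weight'' η) := by unfold weight''; fun_prop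

theorem hasDerivAt_weight {η : ℝ} (hη : 0 < η) (x : ℝ) :
    HasDerivAt (weight η) (weight' η x) x := by
  have hp : 2 * Real.pi * η ≠ 0 := by positivity
  have h := (((hasDerivAt_id x).const_mul (2 * Real.pi * η)).sin).div_const (2 * Real.pi * η)
  convert! h using 1
  simp only [weight', id]
  field_simp

theorem hasDerivAt_weight' (η x : ℝ) : HasDerivAt (weight' η) (weight'' η x) x := by
  have h := (((hasDerivAt_id x).const_mul (2 * Real.pi * η)).cos)
  convert! h using 1
  simp only [weight'', id]
  ring

theorem hasTemperateGrowth_sin : Real.sin.HasTemperateGrowth := by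
  refine ⟨Real.contDiff_sin, fun n => ⟨0, 1, fun x => ?_⟩⟩
  rw [norm_iteratedFDeriv_eq_norm_iteratedDeriv]
  simpa using Real.abs_iteratedDeriv_sin_le_one n x

theorem hasTemperateGrowth_cos : Real.cos.HasTemperateGrowth := by
  refine ⟨Real.contDiff_cos, fun n => ⟨0, 1, fun x => ?_⟩⟩
  rw [norm_iteratedFDeriv_eq_norm_iteratedDeriv]
  simpa using Real.abs_iteratedDeriv_cos_le_one n x

theorem hasTemperateGrowth_weight (η : ℝ) : (weight η).HasTemperateGrowth := by
  have h1 : (fun x : ℝ => 2 * Real.pi * η * x).HasTemperateGrowth := by fun_prop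
  have h2 := hasTemperateGrowth_sin.comp h1
  unfold weight
  simp only [div_eq_mul_inv]
  exact h2.mul (.const _)

theorem hasTemperateGrowth_weight' (η : ℝ) : (weight' η).HasTemperateGrowth := by
  have h1 : (fun x : ℝ => 2 * Real.pi * η * x).HasTemperateGrowth := by fun_prop
  exact hasTemperateGrowth_cos.comp h1

theorem memLp_top_weight (η : ℝ) : MemLp (weight η) ∞ volume :=
  memLp_top_of_bound (measurable_weight η).aestronglyMeasurable _
    (.of_forall fun x => abs_weight_le η x)

theorem memLp_top_weight' (η : ℝ) : MemLp (weight' η) ∞ volume :=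
  memLp_top_of_bound (measurable_weight' η).aestronglyMeasurable _
    (.of_forall fun x => abs_weight'_le η x)

theorem memLp_top_weight'' (η : ℝ) : MemLp (weight'' η) ∞ volume :=
  memLp_top_of_bound (measurable_weight'' η).aestronglyMeasurable _
    (.of_forall fun x => abs_weight''_le η x)

theorem IsDeriv.weight_mul {f f' : ℝ → ℝ} (h : IsDeriv f f') {η : ℝ} (hη : 0 < η) :
    IsDeriv (fun x => weight η x * f x) (fun x => weight' η x * f x + weight η x * f' x) :=
  h.smooth_mul (hasTemperateGrowth_weight η) (hasDerivAt_weight hη) (memLp_top_weight η)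
    (memLp_top_weight' η)

theorem IsDeriv.weight'_mul {f f' : ℝ → ℝ} (h : IsDeriv f f') (η : ℝ) :
    IsDeriv (fun x => weight' η x * f x) (fun x => weight'' η x * f x + weight' η x * f' x) :=
  h.smooth_mul (hasTemperateGrowth_weight' η) (hasDerivAt_weight' η) (memLp_top_weight' η)
    (memLp_top_weight'' η)

/-! ### The commutator of the Hilbert transform and the truncated weight -/

/-- The low frequency part of the Fourier transform. -/
def bandPart (f : L2) (r ξ : ℝ) : ℝ := (Set.Icc (-r) r).indicator (fun ξ => ‖ft f ξ‖) ξ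

theorem memLp_bandPart (f : L2) (r : ℝ) : MemLp (bandPart f r) 2 volume :=
  (memLp_ft f).norm.indicator measurableSet_Icc

theorem bandPart_nonneg (f : L2) (r ξ : ℝ) : 0 ≤ bandPart f r ξ :=
  Set.indicator_nonneg (fun _ _ => norm_nonneg _) _

/-- The `L²` norm of the low frequency part. -/
def bandNorm (f : L2) (r : ℝ) : ℝ := √(∫ ξ, bandPart f r ξ ^ 2)

theorem bandNorm_nonneg (f : L2) (r : ℝ) : 0 ≤ bandNorm f r := Real.sqrt_nonneg _

theorem bandPart_sq (f : L2) (r ξ : ℝ) :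
    bandPart f r ξ ^ 2 = (Set.Icc (-r) r).indicator (fun ξ => ‖ft f ξ‖ ^ 2) ξ := by
  unfold bandPart
  by_cases h : ξ ∈ Set.Icc (-r) r <;> simp [h]

theorem bandNorm_le_norm (f : L2) (r : ℝ) : bandNorm f r ≤ ‖f‖ := by
  refine Real.sqrt_le_iff.2 ⟨norm_nonneg _, ?_⟩
  rw [← integral_norm_ft_sq]
  refine integral_mono (memLp_bandPart f r).integrable_sq (integrable_norm_ft_sq f) fun ξ => ?_
  rw [bandPart_sq]
  exact Set.indicator_le_self' (fun _ _ => by positivity) _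

theorem HasWeakDeriv.bandNorm_le {f f' : L2} (h : HasWeakDeriv f f') {r : ℝ} (hr : 0 ≤ r) :
    bandNorm f' r ≤ 2 * Real.pi * r * bandNorm f r := by
  have hp : 0 ≤ 2 * Real.pi * r := by positivity
  refine Real.sqrt_le_iff.2 ⟨mul_nonneg hp (bandNorm_nonneg _ _), ?_⟩
  rw [mul_pow, bandNorm, Real.sq_sqrt (integral_nonneg fun _ => sq_nonneg _), ← integral_const_mul]
  refine integral_mono_ae (memLp_bandPart f' r).integrable_sq
    ((memLp_bandPart f r).integrable_sq.const_mul _) ?_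
  filter_upwards [hasWeakDeriv_iff_ft.1 h] with ξ hξ
  rw [bandPart_sq, bandPart_sq]
  by_cases hm : ξ ∈ Set.Icc (-r) r
  · rw [Set.indicator_of_mem hm, Set.indicator_of_mem hm, hξ]
    simp only [norm_mul, Complex.norm_I, Complex.norm_real, Real.norm_eq_abs, mul_pow, sq_abs,
      Complex.norm_ofNat]
    have : ξ ^ 2 ≤ r ^ 2 := sq_le_sq' hm.1 hm.2
    have h2 : 0 ≤ 2 ^ 2 * Real.pi ^ 2 * ‖ft f ξ‖ ^ 2 := by positivity
    nlinarith [mul_le_mul_of_nonneg_left this h2]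
  · simp [hm]

/-- The bands shrink to the single frequency 0, which is a null set. -/
theorem tendsto_bandNorm (f : L2) : Filter.Tendsto (bandNorm f) (nhdsWithin 0 (Set.Ioi 0))
    (nhds 0) := by
  have h : Filter.Tendsto (fun r => ∫ ξ, bandPart f r ξ ^ 2) (nhdsWithin 0 (Set.Ioi 0))
      (nhds (∫ _ : ℝ, (0 : ℝ))) := by
    refine tendsto_integral_filter_of_dominated_convergence (fun ξ => ‖ft f ξ‖ ^ 2)
      (.of_forall fun r => (memLp_bandPart f r).integrable_sq.1)
      (.of_forall fun r => .of_forall fun ξ => ?_) (integrable_norm_ft_sq f) ?_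
    · rw [bandPart_sq, Real.norm_of_nonneg (Set.indicator_nonneg (fun _ _ => by positivity) _)]
      exact Set.indicator_le_self' (fun _ _ => by positivity) _
    · filter_upwards [ae_ne_zero] with ξ hξ
      refine tendsto_const_nhds.congr' ?_
      have hlt : ∀ᶠ r : ℝ in nhdsWithin 0 (Set.Ioi 0), r < |ξ| :=
        nhdsWithin_le_nhds (eventually_lt_nhds (abs_pos.2 hξ))
      filter_upwards [hlt] with r hr
      have : ξ ∉ Set.Icc (-r) r := fun hm => absurd (abs_le.2 hm) (not_le.2 hr)
      rw [bandPart_sq, Set.indicator_of_notMem this]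
  have := (Real.continuous_sqrt.tendsto _).comp h
  rw [integral_zero, Real.sqrt_zero] at this
  exact this

/-- Multiplication by the truncated weight. -/
def weightMul (η : ℝ) : LInf :=
  bddMul (weight η) (measurable_weight η) _ (abs_weight_le η)

/-- Multiplication by the derivative of the truncated weight. -/
def weightMul' (η : ℝ) : LInf :=
  bddMul (weight' η) (measurable_weight' η) _ (abs_weight'_le η)

/-- Multiplication by the second derivative of the truncated weight. -/
def weightMul'' (η : ℝ) : LInf :=
  bddMul (weight'' η) (measurable_weight'' η) _ (abs_weight''_le η)

theorem weightMul_coe (η : ℝ) (f : L2) :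
    mulL (weightMul η) f =ᵐ[volume] fun x => weight η x * f x := by
  filter_upwards [mulL_coe (weightMul η) f, bddMul_coe (measurable_weight η) (abs_weight_le η)]
    with x h1 h2
  rw [h1, weightMul, h2]

theorem weightMul'_coe (η : ℝ) (f : L2) :
    mulL (weightMul' η) f =ᵐ[volume] fun x => weight' η x * f x := by
  filter_upwards [mulL_coe (weightMul' η) f, bddMul_coe (measurable_weight' η) (abs_weight'_le η)]
    with x h1 h2
  rw [h1, weightMul', h2]

/-- This is why the truncation is a sine: w is (e^{2πiηx} − e^{−2πiηx})/(4πiη), so multiplication by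
it is an exact difference quotient in frequency. -/
theorem ft_weightMul {η : ℝ} (hη : 0 < η) (f : L2) :
    ft (mulL (weightMul η) f) =ᵐ[volume]
      fun ξ => (4 * Real.pi * η * Complex.I)⁻¹ * (ft f (ξ - η) - ft f (ξ + η)) := by
  have hp : (4 * Real.pi * η * Complex.I : ℂ) ≠ 0 := by
    have := Real.pi_pos.ne'
    simp [this, hη.ne']
  have m1 := memLp_character_mul η (Lp.memLp (toComplex f))
  have m2 := memLp_character_mul (-η) (Lp.memLp (toComplex f))
  have e1 := fourier_character_mul η (toComplex f) (m1.toLp _) m1.coeFn_toLp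
  have e2 := fourier_character_mul (-η) (toComplex f) (m2.toLp _) m2.coeFn_toLp
  set c : ℂ := (4 * Real.pi * η * Complex.I)⁻¹ with hc
  have heq : toComplex (mulL (weightMul η) f) = c • (m1.toLp _ + (-1 : ℂ) • m2.toLp _) := by
    refine Lp.ext ?_
    filter_upwards [toComplex_coe (mulL (weightMul η) f), weightMul_coe η f, toComplex_coe f,
      m1.coeFn_toLp, m2.coeFn_toLp, Lp.coeFn_smul c (m1.toLp _ + (-1 : ℂ) • m2.toLp _),
      Lp.coeFn_add (m1.toLp _) ((-1 : ℂ) • m2.toLp _), Lp.coeFn_smul (-1 : ℂ) (m2.toLp _)]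
      with x h1 h2 h3 h4 h5 h6 h7 h8
    rw [h1, h2, h6, Pi.smul_apply, h7, Pi.add_apply, h8, Pi.smul_apply, h4, h5, h3]
    simp only [weight, character, smul_eq_mul]
    push_cast
    rw [Complex.sin]
    have hp2 : (2 * Real.pi * η : ℂ) ≠ 0 := by
      have := Real.pi_pos.ne'
      simp [this, hη.ne']
    have e : Complex.exp (-(2 * Real.pi * η * x) * Complex.I) =
      Complex.exp (2 * Real.pi * -η * x * Complex.I) := by congr 1; ring
    rw [e, hc]
    field_simp
    ring_nf
    simp only [Complex.I_sq]
    ring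
  unfold ft
  rw [heq, FourierTransform.fourier_smul, FourierTransform.fourier_add,
    FourierTransform.fourier_smul]
  filter_upwards [e1, e2, Lp.coeFn_smul c (𝓕 (m1.toLp _) + (-1 : ℂ) • 𝓕 (m2.toLp _)),
    Lp.coeFn_add (𝓕 (m1.toLp _)) ((-1 : ℂ) • 𝓕 (m2.toLp _)),
    Lp.coeFn_smul (-1 : ℂ) (𝓕 (m2.toLp _))] with ξ h1 h2 h3 h4 h5
  rw [h3, Pi.smul_apply, h4, Pi.add_apply, h5, Pi.smul_apply, h1, h2]
  simp only [smul_eq_mul, sub_neg_eq_add]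
  ring

/-- The symbols at ξ and ζ differ only if 0 separates the two points; being within η of each other,
both then lie in [−η, η]. The jump has modulus 2. The factor with the `if` discards the null set
where a sign is 0, leaving four sign patterns. -/
theorem norm_sign_sub_mul_le {η ξ ζ : ℝ} (h : |ξ - ζ| ≤ η) (a : L2) :
    ‖(-Complex.I * (Real.sign ξ : ℂ) - -Complex.I * (Real.sign ζ : ℂ)) * ft a ζ‖ *
      (if ξ = 0 ∨ ζ = 0 then 0 else 1)
      ≤ 2 * ((Set.Icc (-η) η).indicator 1 ξ * bandPart a η ζ) := by
  have hnn : 0 ≤ 2 * ((Set.Icc (-η) η).indicator (1 : ℝ → ℝ) ξ * bandPart a η ζ) :=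
    mul_nonneg zero_le_two (mul_nonneg (Set.indicator_nonneg (fun _ _ => zero_le_one) _)
      (bandPart_nonneg _ _ _))
  obtain ⟨h1, h2⟩ := abs_le.1 h
  split_ifs with h0
  · simpa using hnn
  · push Not at h0
    rw [mul_one]
    have key : ∀ {ξ ζ : ℝ} (s : ℂ), ‖s‖ = 2 → ξ ∈ Set.Icc (-η) η → ζ ∈ Set.Icc (-η) η →
        ‖s * ft a ζ‖ ≤ 2 * ((Set.Icc (-η) η).indicator (1 : ℝ → ℝ) ξ * bandPart a η ζ) := by
      intro ξ ζ s hs m1 m2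
      rw [norm_mul, hs, bandPart, Set.indicator_of_mem m1, Set.indicator_of_mem m2]
      simp
    rcases lt_or_gt_of_ne h0.1 with hξ | hξ <;> rcases lt_or_gt_of_ne h0.2 with hζ | hζ
    · rw [Real.sign_of_neg hξ, Real.sign_of_neg hζ]
      simpa using hnn
    · refine key _ ?_ ⟨by linarith, by linarith⟩ ⟨by linarith, by linarith⟩
      rw [Real.sign_of_neg hξ, Real.sign_of_pos hζ]
      push_cast
      rw [show -Complex.I * -1 - -Complex.I * 1 = 2 * Complex.I by ring]
      simp
    · refine key _ ?_ ⟨by linarith, by linarith⟩ ⟨by linarith, by linarith⟩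
      rw [Real.sign_of_pos hξ, Real.sign_of_neg hζ]
      push_cast
      rw [show -Complex.I * 1 - -Complex.I * -1 = -(2 * Complex.I) by ring]
      simp
    · rw [Real.sign_of_pos hξ, Real.sign_of_pos hζ]
      simpa using hnn

/-- The commutator of the Hilbert transform and the truncated weight. -/
def comm (η : ℝ) (f : L2) : L2 :=
  hilbert (mulL (weightMul η) f) - mulL (weightMul η) (hilbert f)

theorem integral_bandPart_mul_le (k f : L2) (η c : ℝ) :
    Integrable (fun ξ => bandPart k η ξ * bandPart f η (ξ + c)) ∧
    ∫ ξ, bandPart k η ξ * bandPart f η (ξ + c) ≤ bandNorm k η * bandNorm f η := by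
  have hmp := measurePreserving_add_right (volume : Measure ℝ) c
  have hm : MemLp (fun ξ => bandPart f η (ξ + c)) 2 volume :=
    (memLp_bandPart f η).comp_measurePreserving hmp
  refine ⟨MemLp.integrable_mul (memLp_bandPart k η) hm, ?_⟩
  refine (le_abs_self _).trans ((abs_integral_mul_le (memLp_bandPart k η) hm).trans ?_)
  rw [integral_add_right_eq_self (fun ξ => bandPart f η ξ ^ 2) c]
  exact le_rfl

/-- Each translate, by η or by −η, contributes a pairing of band parts with coefficient 2/(4πη), and
Cauchy–Schwarz bounds each pairing. The band restriction is kept on both arguments: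
`tendsto_inner_comm` needs smallness from k as well as from f. -/
theorem abs_inner_comm_le {η : ℝ} (hη : 0 < η) (k f : L2) :
    |∫ x, k x * comm η f x| ≤ (Real.pi * η)⁻¹ * (bandNorm k η * bandNorm f η) := by
  have hpi := Real.pi_pos
  obtain ⟨i1, b1⟩ := integral_bandPart_mul_le k f η (-η)
  obtain ⟨i2, b2⟩ := integral_bandPart_mul_le k f η η
  have hsub := (measurePreserving_sub_right (volume : Measure ℝ) η).quasiMeasurePreserving
  have hadd := (measurePreserving_add_right (volume : Measure ℝ) η).quasiMeasurePreserving
  have hpt : ∀ᵐ ξ : ℝ, ‖(starRingEnd ℂ) (ft k ξ) * ft (comm η f) ξ‖ ≤ (2 * Real.pi * η)⁻¹ *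
      (bandPart k η ξ * bandPart f η (ξ + -η) + bandPart k η ξ * bandPart f η (ξ + η)) := by
    filter_upwards [ft_sub (hilbert (mulL (weightMul η) f)) (mulL (weightMul η) (hilbert f)),
      ft_hilbert (mulL (weightMul η) f), ft_weightMul hη f, ft_weightMul hη (hilbert f),
      hsub.ae (ft_hilbert f), hadd.ae (ft_hilbert f), ae_ne_zero, hsub.ae ae_ne_zero,
      hadd.ae ae_ne_zero] with ξ e1 e2 e3 e4 e5 e6 n1 n2 n3
    have q1 := norm_sign_sub_mul_le (η := η) (ξ := ξ) (ζ := ξ - η)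
      (by rw [sub_sub_cancel, abs_of_pos hη]) f
    have q2 := norm_sign_sub_mul_le (η := η) (ξ := ξ) (ζ := ξ + η)
      (by rw [sub_add_cancel_left, abs_neg, abs_of_pos hη]) f
    rw [if_neg (by simp [n1, n2]), mul_one] at q1
    rw [if_neg (by simp [n1, n3]), mul_one] at q2
    have hc : ft (comm η f) ξ = (4 * Real.pi * η * Complex.I)⁻¹ *
        ((-Complex.I * (Real.sign ξ : ℂ) - -Complex.I * (Real.sign (ξ - η) : ℂ)) * ft f (ξ - η) -
        (-Complex.I * (Real.sign ξ : ℂ) - -Complex.I * (Real.sign (ξ + η) : ℂ)) *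
          ft f (ξ + η)) := by
      rw [comm, e1, e2, e3, e4, e5, e6]
      ring
    rw [norm_mul, RCLike.norm_conj, hc, norm_mul]
    have hn : ‖(4 * Real.pi * η * Complex.I : ℂ)⁻¹‖ = (4 * Real.pi * η)⁻¹ := by
      simp [abs_of_pos hη, abs_of_pos hpi]
    rw [hn]
    have hk : ‖ft k ξ‖ * (Set.Icc (-η) η).indicator (1 : ℝ → ℝ) ξ = bandPart k η ξ := by
      unfold bandPart
      by_cases h : ξ ∈ Set.Icc (-η) η <;> simp [h]
    calc _ ≤ ‖ft k ξ‖ * ((4 * Real.pi * η)⁻¹ *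
          (2 * ((Set.Icc (-η) η).indicator 1 ξ * bandPart f η (ξ - η)) +
           2 * ((Set.Icc (-η) η).indicator 1 ξ * bandPart f η (ξ + η)))) := by
          gcongr
          exact (norm_sub_le _ _).trans (add_le_add q1 q2)
      _ = (2 * Real.pi * η)⁻¹ * ((‖ft k ξ‖ * (Set.Icc (-η) η).indicator (1 : ℝ → ℝ) ξ) *
          bandPart f η (ξ - η) + (‖ft k ξ‖ * (Set.Icc (-η) η).indicator (1 : ℝ → ℝ) ξ) *
          bandPart f η (ξ + η)) := by
          field_simp
          ring
      _ = _ := by rw [hk, sub_eq_add_neg]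
  have h1 : |∫ x, k x * comm η f x| = ‖((∫ x, k x * comm η f x : ℝ) : ℂ)‖ := by
    rw [Complex.norm_real, Real.norm_eq_abs]
  rw [h1, integral_mul_eq_ft]
  refine (norm_integral_le_of_norm_le ((i1.add i2).const_mul _) hpt).trans ?_
  rw [integral_const_mul, integral_add' i1 i2]
  calc _ ≤ (2 * Real.pi * η)⁻¹ * (bandNorm k η * bandNorm f η + bandNorm k η * bandNorm f η) := by
        gcongr
    _ = _ := by field_simp; ring

/-- Duality with k equal to the commutator itself, whose band norm is at most its norm, followed by
cancelling one factor of that norm. -/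
theorem norm_comm_le {η : ℝ} (hη : 0 < η) (f : L2) :
    ‖comm η f‖ ≤ (Real.pi * η)⁻¹ * bandNorm f η := by
  have h := abs_inner_comm_le hη (comm η f) f
  rw [← norm_sq_eq_integral, abs_of_nonneg (sq_nonneg _)] at h
  have hp : 0 ≤ (Real.pi * η)⁻¹ := by positivity
  have h2 := mul_le_mul_of_nonneg_right (bandNorm_le_norm (comm η f) η) (bandNorm_nonneg f η)
  by_contra hcon
  push Not at hcon
  have h0 : 0 < ‖comm η f‖ :=
    lt_of_le_of_lt (mul_nonneg hp (bandNorm_nonneg _ _)) hcon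
  nlinarith [mul_le_mul_of_nonneg_left h2 hp]

/-- In the band |ξ| ≤ η a derivative costs at most 2πη, which compensates the factor 1/η of the
commutator. -/
theorem HasWeakDeriv.norm_comm_le {f f' : L2} (h : HasWeakDeriv f f') {η : ℝ} (hη : 0 < η) :
    ‖comm η f'‖ ≤ 2 * bandNorm f η := by
  have hpi := Real.pi_pos
  refine (BenjaminOno.norm_comm_le hη f').trans ?_
  calc _ ≤ (Real.pi * η)⁻¹ * (2 * Real.pi * η * bandNorm f η) := by
        gcongr
        exact h.bandNorm_le hη.le
    _ = _ := by field_simp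

/-! ### Integral identities -/

/-- `f` is integrable with integral `a`. -/
def HasInt (f : ℝ → ℝ) (a : ℝ) : Prop := Integrable f ∧ ∫ x, f x = a

section HasInt

variable {f g : ℝ → ℝ} {a b : ℝ}

theorem HasInt.add (hf : HasInt f a) (hg : HasInt g b) : HasInt (fun x => f x + g x) (a + b) :=
  ⟨hf.1.add hg.1, by rw [integral_add hf.1 hg.1, hf.2, hg.2]⟩

theorem HasInt.sub (hf : HasInt f a) (hg : HasInt g b) : HasInt (fun x => f x - g x) (a - b) :=
  ⟨hf.1.sub hg.1, by rw [integral_sub hf.1 hg.1, hf.2, hg.2]⟩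

theorem HasInt.const_mul (c : ℝ) (hf : HasInt f a) : HasInt (fun x => c * f x) (c * a) :=
  ⟨hf.1.const_mul c, by rw [integral_const_mul, hf.2]⟩

theorem HasInt.congr_ae (hf : HasInt f a) (h : f =ᵐ[volume] g) : HasInt g a :=
  ⟨hf.1.congr h, by rw [← integral_congr_ae h, hf.2]⟩

theorem HasInt.congr (hf : HasInt f a) (h : ∀ x, f x = g x) : HasInt g a :=
  hf.congr_ae (.of_forall h)

theorem HasInt.eq (hf : HasInt f a) (h : a = b) : HasInt f b := h ▸ hf

end HasInt

variable {f f' g g' : ℝ → ℝ}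

theorem hasInt_mul (hf : MemLp f 2 volume) (hg : MemLp g 2 volume) :
    HasInt (fun x => f x * g x) (∫ x, f x * g x) := ⟨MemLp.integrable_mul hf hg, rfl⟩

theorem IsDeriv.hasInt (hf : IsDeriv f f') (hg : IsDeriv g g') :
    HasInt (fun x => f' x * g x + f x * g' x) 0 := by
  have h1 := hasInt_mul hf.memLp' hg.memLp
  have h2 := hasInt_mul hf.memLp hg.memLp'
  have := h1.add h2
  rwa [hf.integral_mul hg, add_neg_cancel] at this

theorem IsHilbert.hasInt_mul_mul (h : IsHilbert f g) (h' : IsHilbert f' g') :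
    HasInt (fun x => g x * g' x - f x * f' x) 0 := by
  have := (hasInt_mul h.memLp' h'.memLp').sub (hasInt_mul h.memLp h'.memLp)
  rwa [h.integral_mul_mul h', sub_self] at this

theorem IsHilbert.hasInt_mul (h : IsHilbert f g) (h' : IsHilbert f' g') :
    HasInt (fun x => g x * f' x + f x * g' x) 0 := by
  have := (BenjaminOno.hasInt_mul h.memLp' h'.memLp).add
    (BenjaminOno.hasInt_mul h.memLp h'.memLp')
  rwa [h.integral_mul h', neg_add_cancel] at this

/-- `f ∈ H²` with its first two derivatives and their Hilbert transforms. -/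
structure Jet (f f1 f2 g g1 g2 : ℝ → ℝ) : Prop where
  d1 : IsDeriv f f1
  d2 : IsDeriv f1 f2
  h0 : IsHilbert f g
  h1 : IsHilbert f1 g1
  h2 : IsHilbert f2 g2

section Jet

variable {f f1 f2 g g1 g2 : ℝ → ℝ}

theorem Jet.e1 (J : Jet f f1 f2 g g1 g2) : IsDeriv g g1 := J.h0.deriv J.d1 J.h1

theorem Jet.e2 (J : Jet f f1 f2 g g1 g2) : IsDeriv g1 g2 := J.h1.deriv J.d2 J.h2

/-- The cubic cancellation behind the conservation of energy. -/
theorem IsHilbert.hasInt_cube {f f' g : ℝ → ℝ} (h : IsHilbert f g) (hf : IsDeriv f f') :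
    HasInt (fun x => f x ^ 3 - 3 * (f x * g x ^ 2)) 0 :=
  -- Pairing Hf with H(f² − g²) = 2fg gives ∫ 2fg² = ∫ f(f² − g²), by isometry.
  (((h.hasInt_mul_mul (h.sq_sub_sq hf)).const_mul (-1)).congr fun x => by ring).eq (by ring)

/-- The time derivative of φ is paired with the variational derivative of the energy. Exact
derivatives, skewness and isometry of H remove everything except a multiple of f1³ − 3 f1 g1², which
integrates to 0 by `IsHilbert.hasInt_cube` applied to f1. -/
theorem Jet.energy_identity (J : Jet f f1 f2 g g1 g2) {k : ℝ → ℝ}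
    (hk : IsHilbert (fun x => 2 * (f x * f1 x)) k) :
    HasInt (fun x => (f x * f1 x - g2 x) * (-(2 * f2 x) - 3 / 2 * (f x * g1 x) - 3 / 4 * k x
      + 1 / 2 * f x ^ 3)) 0 := by
  have Z1 := J.h2.hasInt_mul J.h2
  have Z2 := hk.hasInt_mul hk
  have Z3 := (J.d1.mul J.d1).hasInt ((J.d1.mul J.d1).mul J.d1)
  have Z4 := J.h2.hasInt_mul_mul hk
  have Z5 := ((J.d1.mul J.d1).mul J.d1).hasInt J.e2
  have Z6 := J.d1.hasInt (J.e2.mul J.e2)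
  have Z7 := J.d1.hasInt (J.d2.mul J.d2)
  have Z8 := J.h1.hasInt_cube J.d2
  refine ((((((((Z1.add (Z2.const_mul (-3 / 16))).add (Z3.const_mul (1 / 10))).add
    (Z4.const_mul (3 / 4))).add (Z5.const_mul (-1 / 2))).add (Z6.const_mul (3 / 4))).add
    (Z7.const_mul (-1 / 4))).add (Z8.const_mul (1 / 4))).congr fun x => ?_).eq ?_
  · ring
  · ring

/-- With u = wf, the dispersive term is compared with H u'', whose pairing with u vanishes. What
remains is u against H u'' − w H f2, which contains only derivatives of the weight and the
commutator. The nonlinear term is integrated by parts, using the derivative of u²f. No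
undifferentiated weight survives outside u and the commutator. -/
theorem Jet.mass_identity (J : Jet f f1 f2 g g1 g2) {η : ℝ} (hη : 0 < η) {p q r : ℝ → ℝ}
    (hp : IsHilbert (fun x => weight η x * f2 x) p)
    (hq : IsHilbert (fun x => weight' η x * f1 x) q)
    (hr : IsHilbert (fun x => weight'' η x * f x) r) :
    HasInt (fun x => (f x * f1 x - g2 x) * (weight η x * (weight η x * (2 * f x))) -
      (weight η x * f x) * (4 * q x + 2 * r x + 2 * (p x - weight η x * g2 x) -
        4 / 3 * (weight' η x * (f x * f x)))) 0 := by
  have u1 := J.d1.weight_mul hη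
  have u2 := (J.d1.weight'_mul η).add (J.d2.weight_mul hη)
  have hu2 : IsHilbert (fun x => weight'' η x * f x + weight' η x * f1 x +
      (weight' η x * f1 x + weight η x * f2 x)) (fun x => r x + q x + (q x + p x)) :=
    (hr.add hq).add (hq.add hp)
  obtain ⟨k1, hk1⟩ := exists_isHilbert u2.memLp
  -- Together with Z2 this says ∫ u H u'' = −∫ u' H u' = 0.
  have Z1 := u1.hasInt (hk1.deriv u2 hu2)
  have Z2 := hk1.hasInt_mul hk1
  have Z3 := u1.hasInt (u1.mul J.d1)
  refine (((Z1.const_mul (-2)).add (Z2.add (Z3.const_mul (2 / 3)))).congr fun x => ?_).eq ?_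
  · ring
  · ring

/-- The factor paired with the equation is the variational derivative of ∫ w p, in which q + p is
H∂(wf). Integrations by parts leave the weight only through its derivatives and through the
commutator on f1, so every term survives the limit η → 0. -/
theorem Jet.momentum_identity (J : Jet f f1 f2 g g1 g2) {η : ℝ} (hη : 0 < η) {p q : ℝ → ℝ}
    (hp : IsHilbert (fun x => weight η x * f1 x) p)
    (hq : IsHilbert (fun x => weight' η x * f x) q) :
    HasInt (fun x => (f x * f1 x - g2 x) *
        (weight η x * g1 x + (q x + p x) - weight η x * (f x * f x)) -
      (1 / 2 * (g1 x * (weight' η x * g1 x)) + 3 / 2 * (f1 x * (weight' η x * f1 x)) +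
        f1 x * (weight'' η x * f x) + (f x * f1 x) * (p x - weight η x * g1 x) +
        (f x * f1 x) * q x - g1 x * (weight' η x * (f x * f x)) +
        1 / 4 * ((f x * f x) * (weight' η x * (f x * f x))))) 0 := by
  have Za := (J.e2.weight_mul hη).hasInt J.e2
  have Zb := J.h2.hasInt_mul_mul (hq.add hp)
  have Zc := (J.d2.weight_mul hη).hasInt J.d2
  have Zd := (J.d1.weight'_mul η).hasInt J.d2
  have Ze := (J.d1.weight_mul hη).hasInt (J.d1.mul J.e2)
  have Zf := ((J.d1.weight_mul hη).mul J.d1).hasInt (J.d1.mul J.d1)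
  refine ((((((Za.const_mul (-1 / 2)).add (Zb.const_mul (-1))).add (Zc.const_mul (-1 / 2))).add
    (Zd.const_mul (-1))).add (Ze.add (Zf.const_mul (-1 / 4)))).congr fun x => ?_).eq ?_
  · ring
  · ring

/-- The limiting momentum flux differs from twice the energy density by ½(g1² − f1²) and ½(f²g)',
both of integral zero. -/
theorem Jet.momentum_limit_identity (J : Jet f f1 f2 g g1 g2) :
    HasInt (fun x => 1 / 2 * (g1 x * g1 x) + 3 / 2 * (f1 x * f1 x) + (f x * f1 x) * g x -
      g1 x * (f x * f x) + 1 / 4 * ((f x * f x) * (f x * f x)) -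
      2 * (f1 x ^ 2 - 3 / 4 * f x ^ 2 * g1 x + 1 / 8 * f x ^ 4)) 0 := by
  have Za := J.h1.hasInt_mul_mul J.h1
  have Zb := (J.d1.mul J.d1).hasInt J.e1
  refine (((Za.const_mul (1 / 2)).add (Zb.const_mul (1 / 2))).congr fun x => ?_).eq ?_
  · ring
  · ring

/-- The energy as a square. -/
theorem Jet.energy_sq_identity (J : Jet f f1 f2 g g1 g2) :
    HasInt (fun x => (g1 x - 1 / 8 * (3 * f x ^ 2 - g x ^ 2)) ^ 2 -
      (f1 x ^ 2 - 3 / 4 * f x ^ 2 * g1 x + 1 / 8 * f x ^ 4)) 0 := by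
  -- The difference is g1² − f1², plus (g³)'/12, plus 1/64 of Re(f + ig)⁴ = (f² − g²)² − (2fg)². The
  -- last has integral zero because 2fg = H(f² − g²).
  have Za := J.h1.hasInt_mul_mul J.h1
  have Zb := J.e1.hasInt (J.e1.mul J.e1)
  have ht := J.h0.sq_sub_sq J.d1
  have Zc := ht.hasInt_mul_mul ht
  refine ((Za.add ((Zb.const_mul (1 / 12)).add (Zc.const_mul (-1 / 64)))).congr fun x => ?_).eq ?_
  · ring
  · ring

end Jet

/-! ### Factorization of differences -/

section Difference

variable {f f1 f2 g g1 g2 a a1 a2 b b1 b2 : ℝ → ℝ}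

/-- The operator `H ∂` is symmetric. -/
theorem IsHilbert.hasInt_deriv_symm {u u1 k : ℝ → ℝ} (J : Jet f f1 f2 g g1 g2)
    (hu : IsDeriv u u1) (hk : IsHilbert u1 k) :
    HasInt (fun x => u x * g1 x - k x * f x) 0 := by
  have Za := hu.hasInt J.e1
  have Zb := hk.hasInt_mul J.h0
  refine ((Za.sub Zb).congr fun x => ?_).eq (sub_zero 0)
  ring

theorem Jet.sub (J : Jet f f1 f2 g g1 g2) (K : Jet a a1 a2 b b1 b2) :
    Jet (fun x => f x - a x) (fun x => f1 x - a1 x) (fun x => f2 x - a2 x)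
      (fun x => g x - b x) (fun x => g1 x - b1 x) (fun x => g2 x - b2 x) := by
  have hd : ∀ {u u' v v' : ℝ → ℝ}, IsDeriv u u' → IsDeriv v v' →
      IsDeriv (fun x => u x - v x) (fun x => u' x - v' x) := fun h h' =>
    (h.add (h'.const_mul (-1))).congr (.of_forall fun x => by ring) (.of_forall fun x => by ring)
  have hh : ∀ {u u' v v' : ℝ → ℝ}, IsHilbert u u' → IsHilbert v v' →
      IsHilbert (fun x => u x - v x) (fun x => u' x - v' x) := fun h h' =>
    (h.add (h'.const_mul (-1))).congr (.of_forall fun x => by ring) (.of_forall fun x => by ring)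
  exact ⟨hd J.d1 K.d1, hd J.d2 K.d2, hh J.h0 K.h0, hh J.h1 K.h1, hh J.h2 K.h2⟩

/-- In f²g1 − a²b1 = (f² − a²)g1 + a²(g1 − b1) the symmetry of H∂ moves the last derivative onto a².
The increment thus acquires the undifferentiated factor f − a. -/
theorem Jet.energy_sub (J : Jet f f1 f2 g g1 g2) (K : Jet a a1 a2 b b1 b2) {k : ℝ → ℝ}
    (hk : IsHilbert (fun x => 2 * (a x * a1 x)) k) :
    HasInt (fun x => (f1 x ^ 2 - 3 / 4 * f x ^ 2 * g1 x + 1 / 8 * f x ^ 4) -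
      (a1 x ^ 2 - 3 / 4 * a x ^ 2 * b1 x + 1 / 8 * a x ^ 4) -
      (f x - a x) * (-(f2 x + a2 x) - 3 / 4 * ((f x + a x) * g1 x + k x) +
        1 / 8 * ((f x + a x) * (f x * f x + a x * a x)))) 0 := by
  have Za := (J.sub K).d1.hasInt (J.d2.add K.d2)
  have hk' : IsHilbert (fun x => a1 x * a x + a x * a1 x) k :=
    hk.congr (.of_forall fun x => by ring) .rfl
  have Zb := IsHilbert.hasInt_deriv_symm (J.sub K) (K.d1.mul K.d1) hk'
  refine ((Za.add (Zb.const_mul (-3 / 4))).congr fun x => ?_).eq (by ring)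
  ring

/-- The same factorization with a weight: H∂ is moved off f − a and onto wa, whose image is q + p.
-/
theorem Jet.momentum_sub (J : Jet f f1 f2 g g1 g2) (K : Jet a a1 a2 b b1 b2) {η : ℝ} (hη : 0 < η)
    {p q : ℝ → ℝ} (hp : IsHilbert (fun x => weight η x * a1 x) p)
    (hq : IsHilbert (fun x => weight' η x * a x) q) :
    HasInt (fun x => weight η x * (f x * g1 x - 1 / 3 * f x ^ 3) -
      weight η x * (a x * b1 x - 1 / 3 * a x ^ 3) -
      (f x - a x) * (weight η x * g1 x + (q x + p x) -
        1 / 3 * (weight η x * (f x * f x + f x * a x + a x * a x)))) 0 := by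
  have Zb := IsHilbert.hasInt_deriv_symm (J.sub K) (K.d1.weight_mul hη) (hq.add hp)
  refine (Zb.congr fun x => ?_)
  ring

end Difference

/-! ### Solutions of the Benjamin-Ono equation -/

theorem norm_toComplex (f : L2) : ‖toComplex f‖ = ‖f‖ := by
  have : eLpNorm (toComplex f) 2 volume = eLpNorm f 2 volume := by
    refine eLpNorm_congr_norm_ae ?_
    filter_upwards [toComplex_coe f] with x hx
    rw [hx, Complex.norm_real]
  rw [Lp.norm_def, Lp.norm_def, this]

theorem norm_le_of_ft_le {f : L2} {U : L2C} {c : ℝ}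
    (h : ∀ᵐ ξ, ‖ft f ξ‖ ≤ c * ‖U ξ‖) : ‖f‖ ≤ c * ‖U‖ := by
  have h1 : ‖(𝓕 (toComplex f) : L2C)‖ ≤ c * ‖U‖ := Lp.norm_le_mul_norm_of_ae_le_mul h
  rwa [Lp.norm_fourier_eq, norm_toComplex] at h1

/-- The facts about a solution on which the conservation laws rest. -/
structure IsFlow (φ φ1 φ2 : ℝ → L2) : Prop where
  d1 : ∀ t, HasWeakDeriv (φ t) (φ1 t)
  d2 : ∀ t, HasWeakDeriv (φ1 t) (φ2 t)
  c0 : Continuous φ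
  c1 : Continuous φ1
  c2 : Continuous φ2
  equation : ∀ t, ∃ v : L2, HasDerivAt φ v t ∧
    v =ᵐ[volume] fun x => φ t x * φ1 t x - hilbert (φ2 t) x

/-- The Bessel symbol of order 2 is 1 + ξ² without 2π, whereas a derivative is 2πiξ; powers of 2π
therefore appear when derivatives are bounded by the Bessel potential. -/
theorem ft_eq_of_besselPotential {f : L2} {F : L2C}
    (h : TemperedDistribution.besselPotential ℝ ℂ 2 (toDistribution f) =
      Lp.toTemperedDistribution F) :
    ((𝓕 F : L2C) : ℝ → ℂ) =ᵐ[volume] fun ξ => (1 + ξ ^ 2 : ℂ) * ft f ξ := by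
  have ht : (fun x : ℝ => (((1 + ‖x‖ ^ 2) ^ ((2 : ℝ) / 2) : ℝ) : ℂ)).HasTemperateGrowth := by
    fun_prop
  have h1 := congrArg (fun u : 𝓢'(ℝ, ℂ) => 𝓕 u) h
  simp only [TemperedDistribution.fourier_besselPotential_eq_smulLeftCLM_fourier_apply,
    toDistribution, Lp.fourier_toTemperedDistribution_eq] at h1
  refine ae_eq_of_integral_schwartz (locallyIntegrable_L2C _) ?_ fun k => ?_
  · rw [← locallyIntegrableOn_univ]
    refine LocallyIntegrableOn.continuousOn_mul ?_ ?_ isOpen_univ.isLocallyClosed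
    · exact (locallyIntegrable_L2C _).locallyIntegrableOn _
    · fun_prop
  · have h2 := congrArg (fun u : 𝓢'(ℝ, ℂ) => u k) h1
    simp only [TemperedDistribution.smulLeftCLM_apply_apply,
      Lp.toTemperedDistribution_apply] at h2
    simp only [smul_eq_mul] at h2
    rw [← h2]
    refine integral_congr_ae (.of_forall fun ξ => ?_)
    simp only [SchwartzMap.smulLeftCLM_apply_apply ht, smul_eq_mul, ft]
    norm_num
    ring

theorem exists_hasWeakDeriv {f : L2} (h : MemLp (fun ξ : ℝ => (ξ : ℂ) * ft f ξ) 2 volume) :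
    ∃ g, HasWeakDeriv f g := by
  have hm : MemLp (fun ξ : ℝ => 2 * Real.pi * Complex.I * ξ * ft f ξ) 2 volume :=
    (h.const_mul (2 * Real.pi * Complex.I)).ae_eq (.of_forall fun ξ => by ring)
  obtain ⟨g, hg⟩ := exists_ft_eq hm (by
    filter_upwards [ft_neg_arg f] with ξ hξ
    rw [hξ]
    simp only [map_mul, Complex.conj_ofReal, Complex.conj_I, Complex.conj_ofNat]
    push_cast
    ring)
  exact ⟨g, hasWeakDeriv_iff_ft.2 hg⟩

theorem hasWeakDeriv_weakDeriv {f : L2} (h : ∃ g, HasWeakDeriv f g) :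
    HasWeakDeriv f (weakDeriv f) := by
  obtain ⟨g, hg⟩ := h
  rwa [hg.weakDeriv_eq]

theorem memLp_of_norm_le_L2C {G : ℝ → ℂ} (hG : AEStronglyMeasurable G volume) (U : L2C) {c : ℝ}
    (h : ∀ᵐ ξ, ‖G ξ‖ ≤ c * ‖U ξ‖) : MemLp G 2 volume :=
  (Lp.memLp U).of_le_mul hG h

theorem abs_le_one_add_sq (ξ : ℝ) : |ξ| ≤ 1 + ξ ^ 2 :=
  abs_le.2 ⟨by nlinarith [sq_nonneg (ξ + 1)], by nlinarith [sq_nonneg (ξ - 1)]⟩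

theorem norm_one_add_sq (ξ : ℝ) : ‖(1 + ξ ^ 2 : ℂ)‖ = 1 + ξ ^ 2 := by
  have : (1 + ξ ^ 2 : ℂ) = ((1 + ξ ^ 2 : ℝ) : ℂ) := by push_cast; ring
  rw [this, Complex.norm_real, Real.norm_of_nonneg (by positivity)]

theorem continuous_of_ft_le {u : ℝ → L2} {F : ℝ → L2C} (hF : Continuous F) (c : ℝ)
    (h : ∀ t s, ∀ᵐ ξ, ‖ft (u t) ξ - ft (u s) ξ‖ ≤
      c * ‖(𝓕 (F t) : L2C) ξ - (𝓕 (F s) : L2C) ξ‖) : Continuous u := by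
  rw [continuous_iff_continuousAt]
  intro s
  rw [ContinuousAt, tendsto_iff_norm_sub_tendsto_zero]
  have h1 : Filter.Tendsto (fun t => c * ‖(𝓕 (F t) : L2C) - 𝓕 (F s)‖) (nhds s) (nhds 0) := by
    have hc : Continuous fun t => c * ‖(𝓕 (F t) : L2C) - 𝓕 (F s)‖ := by
      have : Continuous fun t => (𝓕 (F t) : L2C) := (Lp.fourierTransformₗᵢ ℝ ℂ).continuous.comp hF
      fun_prop
    have := hc.tendsto s
    simpa using this
  refine squeeze_zero (fun _ => norm_nonneg _) (fun t => norm_le_of_ft_le ?_) h1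
  filter_upwards [h t s, ft_sub (u t) (u s), Lp.coeFn_sub (𝓕 (F t) : L2C) (𝓕 (F s))]
    with ξ e1 e2 e3
  rw [e2, e3]
  exact e1

theorem IsSolution.isFlow {φ : ℝ → L2} (h : IsSolution φ) :
    IsFlow φ (fun t => weakDeriv (φ t)) (fun t => weakDeriv (weakDeriv (φ t))) := by
  obtain ⟨F, hF, hFφ⟩ := h.continuous_H2
  have hft := fun t => ft_eq_of_besselPotential (hFφ t)
  have hpi := Real.pi_pos
  have d1 : ∀ t, HasWeakDeriv (φ t) (weakDeriv (φ t)) := fun t => by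
    refine hasWeakDeriv_weakDeriv (exists_hasWeakDeriv ?_)
    refine memLp_of_norm_le_L2C (Complex.continuous_ofReal.aestronglyMeasurable.mul (memLp_ft _).1)
      (𝓕 (F t)) (c := 1) ?_
    filter_upwards [hft t] with ξ e
    rw [e, norm_mul, norm_mul, norm_one_add_sq, one_mul, Complex.norm_real, Real.norm_eq_abs]
    gcongr
    exact abs_le_one_add_sq ξ
  have d2 : ∀ t, HasWeakDeriv (weakDeriv (φ t)) (weakDeriv (weakDeriv (φ t))) := fun t => by
    refine hasWeakDeriv_weakDeriv (exists_hasWeakDeriv ?_)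
    refine memLp_of_norm_le_L2C (Complex.continuous_ofReal.aestronglyMeasurable.mul (memLp_ft _).1)
      (𝓕 (F t)) (c := 2 * Real.pi) ?_
    filter_upwards [hft t, hasWeakDeriv_iff_ft.1 (d1 t)] with ξ e e1
    rw [e, e1]
    simp only [norm_mul, norm_one_add_sq, Complex.norm_real, Real.norm_eq_abs, Complex.norm_I,
      Complex.norm_ofNat, abs_of_pos hpi]
    have : |ξ| * |ξ| ≤ 1 + ξ ^ 2 := by rw [abs_mul_abs_self]; linarith [sq ξ]
    have h2 : 0 ≤ 2 * Real.pi * ‖ft (φ t) ξ‖ := by positivity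
    nlinarith [mul_le_mul_of_nonneg_left this h2]
  have c0 : Continuous φ := continuous_of_ft_le hF 1 fun t s => by
    filter_upwards [hft t, hft s] with ξ e e'
    rw [e, e', ← mul_sub, norm_mul, norm_one_add_sq, one_mul]
    exact le_mul_of_one_le_left (norm_nonneg _) (by nlinarith [sq_nonneg ξ])
  have c1 : Continuous fun t => weakDeriv (φ t) :=
    continuous_of_ft_le hF (2 * Real.pi) fun t s => by
      filter_upwards [hft t, hft s, hasWeakDeriv_iff_ft.1 (d1 t),
        hasWeakDeriv_iff_ft.1 (d1 s)] with ξ e e' e1 e1'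
      rw [e, e', e1, e1', ← mul_sub, ← mul_sub]
      simp only [norm_mul, norm_one_add_sq, Complex.norm_real, Real.norm_eq_abs, Complex.norm_I,
        Complex.norm_ofNat, abs_of_pos hpi]
      have h2 : 0 ≤ 2 * Real.pi * ‖ft (φ t) ξ - ft (φ s) ξ‖ := by positivity
      nlinarith [mul_le_mul_of_nonneg_left (abs_le_one_add_sq ξ) h2]
  have c2 : Continuous fun t => weakDeriv (weakDeriv (φ t)) :=
    continuous_of_ft_le hF ((2 * Real.pi) ^ 2) fun t s => by
      filter_upwards [hft t, hft s, hasWeakDeriv_iff_ft.1 (d1 t),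
        hasWeakDeriv_iff_ft.1 (d1 s), hasWeakDeriv_iff_ft.1 (d2 t),
        hasWeakDeriv_iff_ft.1 (d2 s)] with ξ e e' e1 e1' e2 e2'
      rw [e, e', e2, e2', e1, e1', ← mul_sub, ← mul_sub, ← mul_sub]
      simp only [norm_mul, norm_one_add_sq, Complex.norm_real, Real.norm_eq_abs, Complex.norm_I,
        Complex.norm_ofNat, abs_of_pos hpi]
      have : |ξ| * |ξ| ≤ 1 + ξ ^ 2 := by rw [abs_mul_abs_self]; linarith [sq ξ]
      have h2 : 0 ≤ (2 * Real.pi) ^ 2 * ‖ft (φ t) ξ - ft (φ s) ξ‖ := by positivity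
      nlinarith [mul_le_mul_of_nonneg_left this h2]
  refine ⟨d1, d2, c0, c1, c2, fun t => ?_⟩
  obtain ⟨S, N, hS, hSN, hder⟩ := h.equation t
  refine ⟨_, hder, ?_⟩
  have hp := (d1 t).isDeriv.mul (d1 t).isDeriv
  -- The product rule for φ·φ and uniqueness of weak derivatives identify N with 2φφ_x.
  obtain ⟨S', N', k1, k2, k3⟩ := hp
  have hSS : S = S' := by
    refine Lp.ext ?_
    filter_upwards [hS, k1] with x e1 e2
    rw [e1, e2, sq]
  subst hSS
  have hNN := hSN.unique k3
  subst hNN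
  filter_upwards [k2, Lp.coeFn_sub ((1 / 2 : ℝ) • N) (hilbert (weakDeriv (weakDeriv (φ t)))),
    Lp.coeFn_smul (1 / 2 : ℝ) N] with x e1 e2 e3
  rw [e2, Pi.sub_apply, e3, Pi.smul_apply, e1, smul_eq_mul]
  ring

/-! ### Bounded representatives -/

open Classical in
/-- A bounded square integrable function, as an element of `L^∞`. -/
def toLInf (f : L2) : LInf := if h : MemLp f ∞ volume then h.toLp f else 0

theorem HasWeakDeriv.toLInf_coe {f f' : L2} (h : HasWeakDeriv f f') :
    toLInf f =ᵐ[volume] f := by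
  have hm : MemLp f ∞ volume := h.isDeriv.memLp_top
  unfold toLInf
  rw [dif_pos hm]
  exact hm.coeFn_toLp

theorem HasWeakDeriv.sub {f g f' g' : L2} (hf : HasWeakDeriv f f') (hg : HasWeakDeriv g g') :
    HasWeakDeriv (f - g) (f' - g') := by
  have := hf.add (hg.smul (-1))
  simpa [sub_eq_add_neg] using this

/-- The Sobolev bound applied to φ(t) − φ(s). The default value 0 of `toLInf` never occurs here. -/
theorem IsFlow.continuous_toLInf {φ φ1 φ2 : ℝ → L2} (h : IsFlow φ φ1 φ2) :
    Continuous fun t => toLInf (φ t) := by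
  rw [continuous_iff_continuousAt]
  intro s
  rw [ContinuousAt, tendsto_iff_norm_sub_tendsto_zero]
  have h1 : Filter.Tendsto (fun t => 2 * (‖φ t - φ s‖ + ‖φ1 t - φ1 s‖)) (nhds s) (nhds 0) := by
    have hc : Continuous fun t => 2 * (‖φ t - φ s‖ + ‖φ1 t - φ1 s‖) := by
      have := h.c0
      have := h.c1
      fun_prop
    simpa using hc.tendsto s
  refine squeeze_zero (fun _ => norm_nonneg _) (fun t => ?_) h1
  refine norm_le_of_ae_bound_top (by positivity) ?_
  filter_upwards [((h.d1 t).sub (h.d1 s)).ae_abs_le, (h.d1 t).toLInf_coe, (h.d1 s).toLInf_coe,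
    Lp.coeFn_sub (toLInf (φ t)) (toLInf (φ s)), Lp.coeFn_sub (φ t) (φ s)] with x e1 e2 e3 e4 e5
  rw [e4, Pi.sub_apply, e2, e3]
  rwa [e5] at e1

theorem IsFlow.jet {φ φ1 φ2 : ℝ → L2} (h : IsFlow φ φ1 φ2) (t : ℝ) :
    Jet (φ t) (φ1 t) (φ2 t) (hilbert (φ t)) (hilbert (φ1 t)) (hilbert (φ2 t)) :=
  ⟨(h.d1 t).isDeriv, (h.d2 t).isDeriv, isHilbert_hilbert _, isHilbert_hilbert _,
    isHilbert_hilbert _⟩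

/-- The slope of F is the slope of φ paired with V(t), a product of a convergent and a continuous
factor. Only φ has a time derivative, and only in `L²`; its spatial derivatives are merely
continuous in time, so functionals containing them cannot be differentiated by the chain rule. -/
theorem hasDerivAt_of_factor {φ V : ℝ → L2} {v : L2} {s : ℝ} {F : ℝ → ℝ}
    (hv : HasDerivAt φ v s) (hV : ContinuousAt V s)
    (hF : ∀ t, F t - F s = inner ℝ (φ t - φ s) (V t)) : HasDerivAt F (inner ℝ v (V s)) s := by
  rw [hasDerivAt_iff_tendsto_slope] at hv ⊢
  have h := hv.inner (𝕜 := ℝ) (hV.tendsto.mono_left nhdsWithin_le_nhds :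
    Filter.Tendsto V (nhdsWithin s {s}ᶜ) (nhds (V s)))
  refine h.congr fun t => ?_
  rw [slope_def_module, slope_def_module, real_inner_smul_left, hF, smul_eq_mul]

open Filter Topology

/-! ### Almost everywhere computations in `L²` -/

section Coe

variable {F G : L2} {f g : ℝ → ℝ}

theorem coe_add_ae (hF : F =ᵐ[volume] f) (hG : G =ᵐ[volume] g) :
    (F + G : L2) =ᵐ[volume] fun x => f x + g x := (Lp.coeFn_add F G).trans (hF.add hG)

theorem coe_sub_ae (hF : F =ᵐ[volume] f) (hG : G =ᵐ[volume] g) :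
    (F - G : L2) =ᵐ[volume] fun x => f x - g x := (Lp.coeFn_sub F G).trans (hF.sub hG)

theorem coe_neg_ae (hF : F =ᵐ[volume] f) : (-F : L2) =ᵐ[volume] fun x => -f x :=
  (Lp.coeFn_neg F).trans hF.neg

theorem coe_smul_ae (c : ℝ) (hF : F =ᵐ[volume] f) : (c • F : L2) =ᵐ[volume] fun x => c * f x := by
  filter_upwards [Lp.coeFn_smul c F, hF] with x h1 h2
  rw [h1, Pi.smul_apply, h2, smul_eq_mul]

theorem coe_mulL_ae {m : LInf} {μ : ℝ → ℝ} (hm : m =ᵐ[volume] μ) (hF : F =ᵐ[volume] f) :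
    mulL m F =ᵐ[volume] fun x => μ x * f x := (mulL_coe m F).trans (hm.mul hF)

theorem weightMul_ae (η : ℝ) : weightMul η =ᵐ[volume] weight η :=
  bddMul_coe (measurable_weight η) (abs_weight_le η)

theorem weightMul'_ae (η : ℝ) : weightMul' η =ᵐ[volume] weight' η :=
  bddMul_coe (measurable_weight' η) (abs_weight'_le η)

theorem weightMul''_ae (η : ℝ) : weightMul'' η =ᵐ[volume] weight'' η :=
  bddMul_coe (measurable_weight'' η) (abs_weight''_le η)

theorem HasInt.unique {a b : ℝ} (h : HasInt f a) (h' : HasInt f b) : a = b := h.2.symm.trans h'.2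

theorem hasInt_inner (hF : F =ᵐ[volume] f) (hG : G =ᵐ[volume] g) :
    HasInt (fun x => f x * g x) (inner ℝ F G) := by
  refine (hasInt_mul (Lp.memLp F) (Lp.memLp G)).congr_ae (hF.mul hG) |>.eq ?_
  rw [inner_eq_integral]

end Coe

/-- The square of a bounded square integrable function. -/
def sqL (f : L2) : L2 := mulL (toLInf f) f

namespace IsFlow

variable {φ φ1 φ2 : ℝ → L2}

theorem sqL_ae (h : IsFlow φ φ1 φ2) (t : ℝ) : sqL (φ t) =ᵐ[volume] fun x => φ t x * φ t x :=
  coe_mulL_ae (h.d1 t).toLInf_coe .rfl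

theorem continuous_sqL (h : IsFlow φ φ1 φ2) : Continuous fun t => sqL (φ t) :=
  (mulL.continuous.comp h.continuous_toLInf).clm_apply h.c0

/-! ### Conservation of the energy -/

theorem hasInt_energy (h : IsFlow φ φ1 φ2) (t : ℝ) :
    HasInt (fun x => φ1 t x ^ 2 - 3 / 4 * φ t x ^ 2 * hilbert (φ1 t) x + 1 / 8 * φ t x ^ 4)
      (inner ℝ (φ1 t) (φ1 t) - 3 / 4 * inner ℝ (sqL (φ t)) (hilbert (φ1 t)) +
        1 / 8 * inner ℝ (sqL (φ t)) (sqL (φ t))) := by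
  have h1 := hasInt_inner (F := φ1 t) (G := φ1 t) .rfl .rfl
  have h2 := hasInt_inner (G := hilbert (φ1 t)) (h.sqL_ae t) .rfl
  have h3 := hasInt_inner (h.sqL_ae t) (h.sqL_ae t)
  exact ((h1.sub (h2.const_mul (3 / 4))).add (h3.const_mul (1 / 8))).congr fun x => by ring

/-- The energy of a solution. -/
def energy (φ φ1 : ℝ → L2) (t : ℝ) : ℝ :=
  inner ℝ (φ1 t) (φ1 t) - 3 / 4 * inner ℝ (sqL (φ t)) (hilbert (φ1 t)) +
    1 / 8 * inner ℝ (sqL (φ t)) (sqL (φ t))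

theorem hasDerivAt_energy (h : IsFlow φ φ1 φ2) (s : ℝ) : HasDerivAt (energy φ φ1) 0 s := by
  obtain ⟨v, hv, hv'⟩ := h.equation s
  -- K is H∂(φ(s)²), frozen at time s; V(t) is the second factor in `Jet.energy_sub` and becomes the
  -- variational derivative of the energy at t = s.
  set K : L2 := hilbert ((2 : ℝ) • mulL (toLInf (φ s)) (φ1 s)) with hK
  set V : ℝ → L2 := fun t => -(φ2 t + φ2 s) -
    (3 / 4 : ℝ) • (mulL (toLInf (φ t) + toLInf (φ s)) (hilbert (φ1 t)) + K) +
    (1 / 8 : ℝ) • mulL (toLInf (φ t) + toLInf (φ s)) (sqL (φ t) + sqL (φ s)) with hV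
  have hsum : ∀ t, (toLInf (φ t) + toLInf (φ s) : LInf) =ᵐ[volume] fun x => φ t x + φ s x :=
    fun t => (Lp.coeFn_add _ _).trans ((h.d1 t).toLInf_coe.add (h.d1 s).toLInf_coe)
  have hVae : ∀ t, V t =ᵐ[volume] fun x => -(φ2 t x + φ2 s x) -
      3 / 4 * ((φ t x + φ s x) * hilbert (φ1 t) x + K x) +
      1 / 8 * ((φ t x + φ s x) * (φ t x * φ t x + φ s x * φ s x)) := fun t =>
    coe_add_ae (coe_sub_ae (coe_neg_ae (coe_add_ae .rfl .rfl))
      (coe_smul_ae _ (coe_add_ae (coe_mulL_ae (hsum t) .rfl) .rfl)))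
      (coe_smul_ae _ (coe_mulL_ae (hsum t) (coe_add_ae (h.sqL_ae t) (h.sqL_ae s))))
  have hVc : Continuous V := by
    have c1 := h.c2
    have c2 := h.continuous_sqL
    have c3 := h.continuous_toLInf
    have c4 : Continuous fun t => hilbert (φ1 t) := continuous_hilbert.comp h.c1
    fun_prop
  have hKH : IsHilbert (fun x => 2 * (φ s x * φ1 s x)) K :=
    ⟨_, coe_smul_ae _ (coe_mulL_ae (h.d1 s).toLInf_coe .rfl), .rfl⟩
  have hd := hasDerivAt_of_factor hv hVc.continuousAt (F := energy φ φ1) fun t => by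
    have e1 := ((h.hasInt_energy t).sub (h.hasInt_energy s)).sub
      (hasInt_inner (coe_sub_ae (F := φ t) (G := φ s) .rfl .rfl) (hVae t))
    have e2 := (h.jet t).energy_sub (h.jet s) hKH
    have := e1.unique e2
    unfold energy
    linarith
  refine (HasDerivAt.congr_deriv hd ?_)
  have e1 := hasInt_inner hv' (hVae s)
  have e2 := (h.jet s).energy_identity hKH
  exact e1.unique (e2.congr fun x => by ring)

theorem energy_eq (h : IsFlow φ φ1 φ2) (t : ℝ) : energy φ φ1 t = energy φ φ1 0 :=
  is_const_of_deriv_eq_zero (fun s => (h.hasDerivAt_energy s).differentiableAt)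
    (fun s => (h.hasDerivAt_energy s).deriv) t 0

/-! ### The truncated second moment of the mass -/

/-- The derivative of the truncated second moment is the inner product of the truncated
first moment and this function. -/
def massFlux (φ φ1 φ2 : ℝ → L2) (η t : ℝ) : L2 :=
  (4 : ℝ) • hilbert (mulL (weightMul' η) (φ1 t)) + (2 : ℝ) • hilbert (mulL (weightMul'' η) (φ t)) +
    (2 : ℝ) • comm η (φ2 t) - (4 / 3 : ℝ) • mulL (weightMul' η) (sqL (φ t))

theorem hasDerivAt_mass (h : IsFlow φ φ1 φ2) {η : ℝ} (hη : 0 < η) (s : ℝ) :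
    HasDerivAt (fun t => ‖mulL (weightMul η) (φ t)‖ ^ 2)
      (inner ℝ (mulL (weightMul η) (φ s)) (massFlux φ φ1 φ2 η s)) s := by
  obtain ⟨v, hv, hv'⟩ := h.equation s
  set W := weightMul η
  have hW : W =ᵐ[volume] weight η := weightMul_ae η
  have hVc : Continuous fun t => mulL W (mulL W (φ t + φ s)) := by
    have c1 := h.c0
    fun_prop
  have hVae : ∀ t, mulL W (mulL W (φ t + φ s)) =ᵐ[volume]
      fun x => weight η x * (weight η x * (φ t x + φ s x)) := fun t =>
    coe_mulL_ae hW (coe_mulL_ae hW (coe_add_ae .rfl .rfl))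
  have hd := hasDerivAt_of_factor hv hVc.continuousAt
    (F := fun t => ‖mulL W (φ t)‖ ^ 2) fun t => by
    rw [← real_inner_self_eq_norm_sq, ← real_inner_self_eq_norm_sq]
    have e1 := (hasInt_inner (coe_mulL_ae hW (F := φ t) .rfl)
      (coe_mulL_ae hW (F := φ t) .rfl)).sub
      (hasInt_inner (coe_mulL_ae hW (F := φ s) .rfl) (coe_mulL_ae hW (F := φ s) .rfl))
    have e2 := hasInt_inner (coe_sub_ae (F := φ t) (G := φ s) .rfl .rfl) (hVae t)
    exact e1.unique (e2.congr fun x => by ring)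
  refine (HasDerivAt.congr_deriv hd ?_)
  have e1 := hasInt_inner hv' (hVae s)
  have hc : comm η (φ2 s) =ᵐ[volume]
      fun x => hilbert (mulL W (φ2 s)) x - weight η x * hilbert (φ2 s) x :=
    coe_sub_ae .rfl (coe_mulL_ae hW .rfl)
  have hR : massFlux φ φ1 φ2 η s =ᵐ[volume] fun x =>
      4 * hilbert (mulL (weightMul' η) (φ1 s)) x + 2 * hilbert (mulL (weightMul'' η) (φ s)) x +
      2 * (hilbert (mulL W (φ2 s)) x - weight η x * hilbert (φ2 s) x) -
      4 / 3 * (weight' η x * (φ s x * φ s x)) :=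
    coe_sub_ae (coe_add_ae (coe_add_ae (coe_smul_ae _ .rfl) (coe_smul_ae _ .rfl))
      (coe_smul_ae _ hc)) (coe_smul_ae _ (coe_mulL_ae (weightMul'_ae η) (h.sqL_ae s)))
  have e2 := hasInt_inner (coe_mulL_ae hW (F := φ s) .rfl) hR
  have e3 := (h.jet s).mass_identity hη (p := hilbert (mulL W (φ2 s)))
    (q := hilbert (mulL (weightMul' η) (φ1 s))) (r := hilbert (mulL (weightMul'' η) (φ s)))
    ⟨_, coe_mulL_ae hW .rfl, .rfl⟩ ⟨_, coe_mulL_ae (weightMul'_ae η) .rfl, .rfl⟩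
    ⟨_, coe_mulL_ae (weightMul''_ae η) .rfl, .rfl⟩
  have e4 := (e1.sub e2).unique (e3.congr fun x => by ring)
  linarith

/-! ### The truncated first moment of the momentum -/

/-- The truncated first moment of the momentum. -/
def momentum (φ φ1 : ℝ → L2) (η t : ℝ) : ℝ :=
  inner ℝ (mulL (weightMul η) (φ t)) (hilbert (φ1 t) - (1 / 3 : ℝ) • sqL (φ t))

/-- The derivative of the truncated first moment of the momentum. -/
def momentumFlux (φ φ1 : ℝ → L2) (η t : ℝ) : ℝ :=
  1 / 2 * inner ℝ (hilbert (φ1 t)) (mulL (weightMul' η) (hilbert (φ1 t))) +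
    3 / 2 * inner ℝ (φ1 t) (mulL (weightMul' η) (φ1 t)) +
    inner ℝ (φ1 t) (mulL (weightMul'' η) (φ t)) +
    inner ℝ (mulL (toLInf (φ t)) (φ1 t)) (comm η (φ1 t)) +
    inner ℝ (mulL (toLInf (φ t)) (φ1 t)) (hilbert (mulL (weightMul' η) (φ t))) -
    inner ℝ (hilbert (φ1 t)) (mulL (weightMul' η) (sqL (φ t))) +
    1 / 4 * inner ℝ (sqL (φ t)) (mulL (weightMul' η) (sqL (φ t)))

theorem hasDerivAt_momentum (h : IsFlow φ φ1 φ2) {η : ℝ} (hη : 0 < η) (s : ℝ) :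
    HasDerivAt (momentum φ φ1 η) (momentumFlux φ φ1 η s) s := by
  obtain ⟨v, hv, hv'⟩ := h.equation s
  set W := weightMul η with hWdef
  have hW : W =ᵐ[volume] weight η := weightMul_ae η
  have hW' := weightMul'_ae η
  have hW'' := weightMul''_ae η
  set p : L2 := hilbert (mulL W (φ1 s)) with hp
  set q : L2 := hilbert (mulL (weightMul' η) (φ s)) with hq
  set V : ℝ → L2 := fun t => mulL W (hilbert (φ1 t)) + (q + p) -
    (1 / 3 : ℝ) • mulL W (sqL (φ t) + mulL (toLInf (φ t)) (φ s) + sqL (φ s)) with hV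
  have hVae : ∀ t, V t =ᵐ[volume] fun x => weight η x * hilbert (φ1 t) x + (q x + p x) -
      1 / 3 * (weight η x * (φ t x * φ t x + φ t x * φ s x + φ s x * φ s x)) := fun t =>
    coe_sub_ae (coe_add_ae (coe_mulL_ae hW .rfl) (coe_add_ae .rfl .rfl))
      (coe_smul_ae _ (coe_mulL_ae hW (coe_add_ae (coe_add_ae (h.sqL_ae t)
        (coe_mulL_ae (h.d1 t).toLInf_coe .rfl)) (h.sqL_ae s))))
  have hVc : Continuous V := by
    have c2 := h.continuous_sqL
    have c3 := h.continuous_toLInf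
    have c4 : Continuous fun t => hilbert (φ1 t) := continuous_hilbert.comp h.c1
    fun_prop
  have hpH : IsHilbert (fun x => weight η x * φ1 s x) p := ⟨_, coe_mulL_ae hW .rfl, .rfl⟩
  have hqH : IsHilbert (fun x => weight' η x * φ s x) q := ⟨_, coe_mulL_ae hW' .rfl, .rfl⟩
  have hm : ∀ t, HasInt (fun x => weight η x * (φ t x * hilbert (φ1 t) x - 1 / 3 * φ t x ^ 3))
      (momentum φ φ1 η t) := fun t =>
    (hasInt_inner (coe_mulL_ae hW (F := φ t) .rfl) (coe_sub_ae (F := hilbert (φ1 t)) .rfl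
      (coe_smul_ae (1 / 3) (h.sqL_ae t)))).congr fun x => by ring
  have hd := hasDerivAt_of_factor hv hVc.continuousAt (F := momentum φ φ1 η) fun t => by
    have e1 := ((hm t).sub (hm s)).sub
      (hasInt_inner (coe_sub_ae (F := φ t) (G := φ s) .rfl .rfl) (hVae t))
    have e2 := (h.jet t).momentum_sub (h.jet s) hη hpH hqH
    have := e1.unique e2
    linarith
  refine (HasDerivAt.congr_deriv hd ?_)
  have e1 := hasInt_inner hv' (hVae s)
  have hc : comm η (φ1 s) =ᵐ[volume] fun x => p x - weight η x * hilbert (φ1 s) x :=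
    coe_sub_ae .rfl (coe_mulL_ae hW .rfl)
  have hff1 : mulL (toLInf (φ s)) (φ1 s) =ᵐ[volume] fun x => φ s x * φ1 s x :=
    coe_mulL_ae (h.d1 s).toLInf_coe .rfl
  have k1 := hasInt_inner (F := hilbert (φ1 s)) .rfl (coe_mulL_ae hW' (F := hilbert (φ1 s)) .rfl)
  have k2 := hasInt_inner (F := φ1 s) .rfl (coe_mulL_ae hW' (F := φ1 s) .rfl)
  have k3 := hasInt_inner (F := φ1 s) .rfl (coe_mulL_ae hW'' (F := φ s) .rfl)
  have k4 := hasInt_inner hff1 hc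
  have k5 := hasInt_inner hff1 (.rfl : q =ᵐ[volume] q)
  have k6 := hasInt_inner (F := hilbert (φ1 s)) .rfl (coe_mulL_ae hW' (h.sqL_ae s))
  have k7 := hasInt_inner (h.sqL_ae s) (coe_mulL_ae hW' (h.sqL_ae s))
  have e2 := (((((((k1.const_mul (1 / 2)).add (k2.const_mul (3 / 2))).add k3).add k4).add
    k5).sub k6).add (k7.const_mul (1 / 4)))
  have e3 := (h.jet s).momentum_identity hη hpH hqH
  have e4 := (e1.sub e2).unique (e3.congr fun x => by ring)
  unfold momentumFlux
  linarith

end IsFlow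

/-! ### Removing the truncation -/

/-- Dominated convergence for the squared differences, which are at most (2|F|)² = 4F². -/
theorem tendsto_L2_of_dominated {ι : Type*} {l : Filter ι} [l.IsCountablyGenerated]
    {a : ι → L2} {b : L2} {α : ι → ℝ → ℝ} {β F : ℝ → ℝ} (ha : ∀ i, a i =ᵐ[volume] α i)
    (hb : b =ᵐ[volume] β) (hF : MemLp F 2 volume) (hα : ∀ᶠ i in l, ∀ x, |α i x| ≤ |F x|)
    (hβ : ∀ x, |β x| ≤ |F x|) (hlim : ∀ x, Tendsto (fun i => α i x) l (𝓝 (β x))) :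
    Tendsto a l (𝓝 b) := by
  have hsub : ∀ i, (a i - b : L2) =ᵐ[volume] fun x => α i x - β x := fun i =>
    coe_sub_ae (ha i) hb
  have hsq : ∀ i, ‖a i - b‖ ^ 2 = ∫ x, (α i x - β x) ^ 2 := fun i => by
    rw [norm_sq_eq_integral]
    refine integral_congr_ae ?_
    filter_upwards [hsub i] with x hx
    rw [hx, sq]
  have h0 : Tendsto (fun i => ∫ x, (α i x - β x) ^ 2) l (𝓝 (∫ _ : ℝ, (0 : ℝ))) := by
    refine tendsto_integral_filter_of_dominated_convergence (fun x => 4 * F x ^ 2)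
      (.of_forall fun i => ?_) ?_ (hF.integrable_sq.const_mul 4) (.of_forall fun x => ?_)
    · exact (((memLp_congr_ae (hsub i)).1 (Lp.memLp _)).1.pow 2)
    · filter_upwards [hα] with i hi
      refine .of_forall fun x => ?_
      rw [Real.norm_of_nonneg (sq_nonneg _)]
      calc (α i x - β x) ^ 2 = |α i x - β x| ^ 2 := (sq_abs _).symm
        _ ≤ (|F x| + |F x|) ^ 2 := by
          gcongr
          exact (abs_sub _ _).trans (add_le_add (hi x) (hβ x))
        _ = 4 * F x ^ 2 := by rw [← sq_abs (F x)]; ring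
    · simpa using ((hlim x).sub_const (β x)).pow 2
  rw [tendsto_iff_norm_sub_tendsto_zero]
  have h1 : Tendsto (fun i => √(‖a i - b‖ ^ 2)) l (𝓝 0) := by
    simp only [hsq]
    simpa using h0.sqrt
  simpa [Real.sqrt_sq] using h1

theorem tendsto_weight (x : ℝ) : Tendsto (fun η => weight η x) (𝓝[>] 0) (𝓝 x) := by
  have h : Tendsto (fun η => x * Real.sinc (2 * Real.pi * η * x)) (𝓝[>] 0) (𝓝 x) := by
    have hc : Continuous fun η : ℝ => x * Real.sinc (2 * Real.pi * η * x) := by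
      have := Real.continuous_sinc
      fun_prop
    simpa using (hc.tendsto 0).mono_left nhdsWithin_le_nhds
  refine h.congr' ?_
  filter_upwards [self_mem_nhdsWithin] with η hη
  have hη' : (η : ℝ) ≠ 0 := ne_of_gt hη
  rcases eq_or_ne x 0 with rfl | hx
  · simp [weight]
  · have hpi := Real.pi_ne_zero
    rw [Real.sinc_of_ne_zero (by positivity), weight]
    field_simp

theorem tendsto_weightMul {f X : L2} (hX : X =ᵐ[volume] fun x => x * f x) :
    Tendsto (fun η => mulL (weightMul η) f) (𝓝[>] 0) (𝓝 X) := by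
  refine tendsto_L2_of_dominated (fun η => weightMul_coe η f) hX
    ((memLp_congr_ae hX).1 (Lp.memLp X)) ?_ (fun x => le_rfl)
    fun x => (tendsto_weight x).mul_const _
  filter_upwards [self_mem_nhdsWithin] with η hη x
  rw [abs_mul, abs_mul]
  exact mul_le_mul_of_nonneg_right (abs_weight_le_abs hη x) (abs_nonneg _)

theorem tendsto_weightMul' (f : L2) :
    Tendsto (fun η => mulL (weightMul' η) f) (𝓝[>] 0) (𝓝 f) := by
  refine tendsto_L2_of_dominated (fun η => weightMul'_coe η f) .rfl (Lp.memLp f)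
    (.of_forall fun η x => ?_) (fun x => le_rfl) fun x => ?_
  · rw [abs_mul]
    exact mul_le_of_le_one_left (abs_nonneg _) (abs_weight'_le η x)
  · have hc : Continuous fun η => weight' η x * f x := by
      unfold weight'
      fun_prop
    simpa [weight'] using (hc.tendsto 0).mono_left nhdsWithin_le_nhds

theorem norm_weightMul'_le (η : ℝ) (f : L2) : ‖mulL (weightMul' η) f‖ ≤ ‖f‖ :=
  (norm_mulL_le _ _).trans
    (mul_le_of_le_one_left (norm_nonneg _) (norm_bddMul_le _ (abs_weight'_le η)))

theorem norm_weightMul''_le {η : ℝ} (hη : 0 < η) (f : L2) :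
    ‖mulL (weightMul'' η) f‖ ≤ 2 * Real.pi * η * ‖f‖ := by
  refine (norm_mulL_le _ _).trans (mul_le_mul_of_nonneg_right ?_ (norm_nonneg _))
  refine (norm_bddMul_le _ (abs_weight''_le η)).trans_eq (abs_of_nonneg ?_)
  have := Real.pi_pos
  positivity

theorem tendsto_weightMul'' (f : L2) :
    Tendsto (fun η => mulL (weightMul'' η) f) (𝓝[>] 0) (𝓝 0) := by
  have hc : Continuous fun η : ℝ => 2 * Real.pi * η * ‖f‖ := by fun_prop
  refine squeeze_zero_norm' (a := fun η : ℝ => 2 * Real.pi * η * ‖f‖) ?_ ?_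
  · filter_upwards [self_mem_nhdsWithin] with η hη
    exact norm_weightMul''_le hη f
  · simpa using (hc.tendsto 0).mono_left nhdsWithin_le_nhds

theorem HasWeakDeriv.tendsto_comm {f f' : L2} (h : HasWeakDeriv f f') :
    Tendsto (fun η => comm η f') (𝓝[>] 0) (𝓝 0) := by
  refine squeeze_zero_norm' (a := fun η => 2 * bandNorm f η) ?_ ?_
  · filter_upwards [self_mem_nhdsWithin] with η hη
    exact h.norm_comm_le hη
  · simpa using (tendsto_bandNorm f).const_mul 2

/-- Fatou's lemma along η = 1/(n + 1). -/
theorem memLp_of_norm_weightMul_le {f : L2} {C : ℝ}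
    (h : ∀ᶠ η in 𝓝[>] 0, ‖mulL (weightMul η) f‖ ≤ C) :
    MemLp (fun x => x * f x) 2 volume := by
  have hseq : Tendsto (fun n : ℕ => 1 / ((n : ℝ) + 1)) atTop (𝓝[>] 0) :=
    tendsto_nhdsWithin_iff.2 ⟨tendsto_one_div_add_atTop_nhds_zero_nat,
      .of_forall fun n => Set.mem_Ioi.2 (by positivity)⟩
  refine ⟨aestronglyMeasurable_id.mul (Lp.aestronglyMeasurable f), ?_⟩
  refine (Lp.eLpNorm_lim_le_liminf_eLpNorm (f := fun n : ℕ => fun x =>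
    weight (1 / ((n : ℝ) + 1)) x * f x) (fun n => ?_) _ (.of_forall fun x => ?_)).trans_lt ?_
  · exact (measurable_weight _).aestronglyMeasurable.mul (Lp.aestronglyMeasurable f)
  · exact ((tendsto_weight x).comp hseq).mul_const _
  · refine (liminf_le_of_frequently_le' (x := ENNReal.ofReal C) ?_).trans_lt ENNReal.ofReal_lt_top
    refine Eventually.frequently ?_
    filter_upwards [hseq.eventually h] with n hn
    rw [← eLpNorm_congr_ae (weightMul_coe _ f), ← ENNReal.ofReal_toReal (Lp.eLpNorm_ne_top _)]
    exact ENNReal.ofReal_le_ofReal hn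

/-- Passage to the limit in the fundamental theorem of calculus. -/
theorem sub_eq_integral_of_tendsto {l : Filter ℝ} [l.IsCountablyGenerated] [l.NeBot]
    {F D : ℝ → ℝ → ℝ} {f d : ℝ → ℝ} {t C : ℝ}
    (hF : ∀ᶠ η in l, ∀ s, HasDerivAt (F η) (D η s) s)
    (hD : ∀ᶠ η in l, ∀ s, |s| ≤ |t| → |D η s| ≤ C)
    (hd : ∀ s, Tendsto (fun η => D η s) l (𝓝 (d s)))
    (h0 : Tendsto (fun η => F η 0) l (𝓝 (f 0))) (ht : Tendsto (fun η => F η t) l (𝓝 (f t))) :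
    f t - f 0 = ∫ s in (0 : ℝ)..t, d s := by
  have hmem : ∀ s ∈ Set.uIoc 0 t, |s| ≤ |t| := fun s hs => by
    simpa using Set.abs_sub_left_of_mem_uIcc (Set.uIoc_subset_uIcc hs)
  -- A derivative is automatically measurable, so no continuity of the flux in time is required.
  have hmeas : ∀ᶠ η in l, Measurable (D η) := by
    filter_upwards [hF] with η h
    have : D η = deriv (F η) := funext fun s => (h s).deriv.symm
    rw [this]
    exact measurable_deriv _
  have hint : Tendsto (fun η => ∫ s in (0 : ℝ)..t, D η s) l (𝓝 (∫ s in (0 : ℝ)..t, d s)) := by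
    refine intervalIntegral.tendsto_integral_filter_of_dominated_convergence (fun _ => C)
      ?_ ?_ intervalIntegrable_const (.of_forall fun s _ => hd s)
    · filter_upwards [hmeas] with η h
      exact h.aestronglyMeasurable
    · filter_upwards [hD] with η h
      exact .of_forall fun s hs => h s (hmem s hs)
  refine tendsto_nhds_unique ((ht.sub h0).congr' ?_) hint
  filter_upwards [hF, hD, hmeas] with η h1 h2 h3
  refine (intervalIntegral.integral_eq_sub_of_hasDerivAt (fun s _ => h1 s) ?_).symm
  rw [intervalIntegrable_iff]
  refine Measure.integrableOn_of_bounded (M := C) (by simp) h3.aestronglyMeasurable ?_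
  rw [ae_restrict_iff' measurableSet_uIoc]
  exact .of_forall fun s hs => h2 s (hmem s hs)

namespace IsFlow

variable {φ φ1 φ2 : ℝ → L2}

/-! ### The first moment of a solution -/

/-- The bound is independent of η and of the moment itself: the commutator falls on φ2 = (φ1)' and
costs only ‖φ1‖, while η ≤ 1 controls the second derivative of the weight. -/
theorem norm_massFlux_le (h : IsFlow φ φ1 φ2) {η : ℝ} (hη : 0 < η) (hη1 : η ≤ 1) (s : ℝ) :
    ‖massFlux φ φ1 φ2 η s‖ ≤
      8 * ‖φ1 s‖ + 4 * Real.pi * ‖φ s‖ + 4 / 3 * ‖sqL (φ s)‖ := by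
  have hpi := Real.pi_pos
  have k1 : ‖(4 : ℝ) • hilbert (mulL (weightMul' η) (φ1 s))‖ ≤ 4 * ‖φ1 s‖ := by
    rw [norm_smul, norm_hilbert, Real.norm_of_nonneg (by norm_num)]
    gcongr
    exact norm_weightMul'_le η _
  have k2 : ‖(2 : ℝ) • hilbert (mulL (weightMul'' η) (φ s))‖ ≤ 2 * (2 * Real.pi * 1 * ‖φ s‖) := by
    rw [norm_smul, norm_hilbert, Real.norm_of_nonneg (by norm_num)]
    gcongr
    refine (norm_weightMul''_le hη _).trans ?_
    gcongr
  have k3 : ‖(2 : ℝ) • comm η (φ2 s)‖ ≤ 2 * (2 * ‖φ1 s‖) := by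
    rw [norm_smul, Real.norm_of_nonneg (by norm_num)]
    gcongr
    refine ((h.d2 s).norm_comm_le hη).trans ?_
    gcongr
    exact bandNorm_le_norm _ _
  have k4 : ‖(4 / 3 : ℝ) • mulL (weightMul' η) (sqL (φ s))‖ ≤ 4 / 3 * ‖sqL (φ s)‖ := by
    rw [norm_smul, Real.norm_of_nonneg (by norm_num)]
    gcongr
    exact norm_weightMul'_le η _
  refine (norm_sub_le _ _).trans ((add_le_add ((norm_add_le _ _).trans (add_le_add
    ((norm_add_le _ _).trans (add_le_add k1 k2)) k3)) k4).trans_eq ?_)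
  ring

theorem exists_norm_massFlux_le (h : IsFlow φ φ1 φ2) (T : ℝ) :
    ∃ C, 0 ≤ C ∧ ∀ η, 0 < η → η ≤ 1 → ∀ s, |s| ≤ T → ‖massFlux φ φ1 φ2 η s‖ ≤ C := by
  have hc : Continuous fun s => 8 * ‖φ1 s‖ + 4 * Real.pi * ‖φ s‖ + 4 / 3 * ‖sqL (φ s)‖ := by
    have c0 := h.c0
    have c1 := h.c1
    have c2 := h.continuous_sqL
    fun_prop
  obtain ⟨C, hC⟩ := (isCompact_Icc (a := -T) (b := T)).exists_bound_of_continuousOn hc.continuousOn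
  refine ⟨max C 0, le_max_right _ _, fun η hη hη1 s hs => ?_⟩
  exact (h.norm_massFlux_le hη hη1 s).trans
    ((le_abs_self _).trans ((hC s (abs_le.1 hs)).trans (le_max_left _ _)))

theorem exists_norm_weightMul_le (h : IsFlow φ φ1 φ2) {X0 : L2}
    (hX0 : X0 =ᵐ[volume] fun x => x * φ 0 x) (T : ℝ) :
    ∃ C, ∀ η, 0 < η → η ≤ 1 → ∀ s, |s| ≤ T → ‖mulL (weightMul η) (φ s)‖ ≤ C := by
  obtain ⟨K, hK0, hK⟩ := h.exists_norm_massFlux_le T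
  refine ⟨√(1 + ‖X0‖ ^ 2) + K * T, fun η hη hη1 s hs => ?_⟩
  have hT : 0 ≤ T := (abs_nonneg s).trans hs
  -- Adding 1 keeps the square root differentiable where the moment vanishes. Since the norm is at
  -- most z, the derivative of z is bounded by K, and the mean value inequality replaces Grönwall's.
  set z : ℝ → ℝ := fun t => √(1 + ‖mulL (weightMul η) (φ t)‖ ^ 2) with hz
  have hle : ∀ t, ‖mulL (weightMul η) (φ t)‖ ≤ z t := fun t =>
    Real.le_sqrt_of_sq_le (by linarith)
  have hder : ∀ t ∈ Set.Icc (-T) T, HasDerivWithinAt z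
      (inner ℝ (mulL (weightMul η) (φ t)) (massFlux φ φ1 φ2 η t) / (2 * z t))
      (Set.Icc (-T) T) t := fun t _ =>
    (((h.hasDerivAt_mass hη t).const_add 1).sqrt (by positivity)).hasDerivWithinAt
  have hbd : ∀ t ∈ Set.Icc (-T) T,
      ‖inner ℝ (mulL (weightMul η) (φ t)) (massFlux φ φ1 φ2 η t) / (2 * z t)‖ ≤ K := fun t ht => by
    have hz0 : 0 < z t := Real.sqrt_pos.2 (by positivity)
    rw [norm_div, Real.norm_of_nonneg (by positivity : 0 ≤ 2 * z t), div_le_iff₀ (by positivity)]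
    calc _ ≤ ‖mulL (weightMul η) (φ t)‖ * ‖massFlux φ φ1 φ2 η t‖ := norm_inner_le_norm _ _
      _ ≤ z t * K := mul_le_mul (hle t) (hK η hη hη1 t (abs_le.2 ht)) (norm_nonneg _) hz0.le
      _ ≤ K * (2 * z t) := by nlinarith [mul_nonneg hz0.le hK0]
  have hmv := (convex_Icc (-T) T).norm_image_sub_le_of_norm_hasDerivWithin_le hder hbd
    (⟨by linarith, hT⟩ : (0 : ℝ) ∈ Set.Icc (-T) T) (abs_le.1 hs)
  have h0 : z 0 ≤ √(1 + ‖X0‖ ^ 2) := by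
    refine Real.sqrt_le_sqrt ?_
    gcongr
    refine Lp.norm_le_norm_of_ae_le ?_
    filter_upwards [hX0, weightMul_coe η (φ 0)] with x e1 e2
    rw [e1, e2, norm_mul, norm_mul]
    exact mul_le_mul_of_nonneg_right (abs_weight_le_abs hη x) (abs_nonneg _)
  have h1 : K * ‖s - 0‖ ≤ K * T := by
    rw [sub_zero]
    exact mul_le_mul_of_nonneg_left hs hK0
  have h2 := (le_abs_self (z s - z 0)).trans (hmv.trans h1)
  linarith [hle s]

theorem memLp_id_mul (h : IsFlow φ φ1 φ2) (h0 : MemLp (fun x => x * φ 0 x) 2 volume) (t : ℝ) :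
    MemLp (fun x => x * φ t x) 2 volume := by
  obtain ⟨C, hC⟩ := h.exists_norm_weightMul_le h0.coeFn_toLp |t|
  refine memLp_of_norm_weightMul_le (C := C) ?_
  filter_upwards [Ioc_mem_nhdsGT one_pos] with η hη
  exact hC η hη.1 hη.2 t le_rfl

/-! ### The evolution of the moments -/

theorem tendsto_massFlux (h : IsFlow φ φ1 φ2) (s : ℝ) :
    Tendsto (fun η => massFlux φ φ1 φ2 η s) (𝓝[>] 0)
      (𝓝 ((4 : ℝ) • hilbert (φ1 s) - (4 / 3 : ℝ) • sqL (φ s))) := by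
  have l1 := ((continuous_hilbert.tendsto _).comp (tendsto_weightMul' (φ1 s))).const_smul (4 : ℝ)
  have l2 := ((continuous_hilbert.tendsto _).comp (tendsto_weightMul'' (φ s))).const_smul (2 : ℝ)
  have l3 := (h.d2 s).tendsto_comm.const_smul (2 : ℝ)
  have l4 := (tendsto_weightMul' (sqL (φ s))).const_smul (4 / 3 : ℝ)
  have e : hilbert 0 = 0 := hilbertLI.map_zero
  simpa [e, massFlux] using ((l1.add l2).add l3).sub l4

theorem momentum_limit (h : IsFlow φ φ1 φ2) (s : ℝ) :
    1 / 2 * inner ℝ (hilbert (φ1 s)) (hilbert (φ1 s)) + 3 / 2 * inner ℝ (φ1 s) (φ1 s) +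
      inner ℝ (mulL (toLInf (φ s)) (φ1 s)) (hilbert (φ s)) -
      inner ℝ (hilbert (φ1 s)) (sqL (φ s)) + 1 / 4 * inner ℝ (sqL (φ s)) (sqL (φ s)) =
      2 * energy φ φ1 s := by
  have hff1 : mulL (toLInf (φ s)) (φ1 s) =ᵐ[volume] fun x => φ s x * φ1 s x :=
    coe_mulL_ae (h.d1 s).toLInf_coe .rfl
  have k1 := hasInt_inner (F := hilbert (φ1 s)) (G := hilbert (φ1 s)) .rfl .rfl
  have k2 := hasInt_inner (F := φ1 s) (G := φ1 s) .rfl .rfl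
  have k4 := hasInt_inner hff1 (G := hilbert (φ s)) .rfl
  have k6 := hasInt_inner (F := hilbert (φ1 s)) .rfl (h.sqL_ae s)
  have k7 := hasInt_inner (h.sqL_ae s) (h.sqL_ae s)
  have e := (((((k1.const_mul (1 / 2)).add (k2.const_mul (3 / 2))).add k4).sub k6).add
    (k7.const_mul (1 / 4))).sub ((h.hasInt_energy s).const_mul 2)
  have := e.unique (h.jet s).momentum_limit_identity
  unfold energy
  linarith

/-- As η → 0 the first derivative of the weight acts as the identity, while the second derivative
and the commutator on φ1 disappear. -/
theorem tendsto_momentumFlux (h : IsFlow φ φ1 φ2) (s : ℝ) :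
    Tendsto (fun η => momentumFlux φ φ1 η s) (𝓝[>] 0) (𝓝 (2 * energy φ φ1 s)) := by
  have l1 := (tendsto_const_nhds (x := hilbert (φ1 s))).inner (𝕜 := ℝ)
    (tendsto_weightMul' (hilbert (φ1 s)))
  have l2 := (tendsto_const_nhds (x := φ1 s)).inner (𝕜 := ℝ) (tendsto_weightMul' (φ1 s))
  have l3 := (tendsto_const_nhds (x := φ1 s)).inner (𝕜 := ℝ) (tendsto_weightMul'' (φ s))
  have l4 := (tendsto_const_nhds (x := mulL (toLInf (φ s)) (φ1 s))).inner (𝕜 := ℝ)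
    (h.d1 s).tendsto_comm
  have l5 := (tendsto_const_nhds (x := mulL (toLInf (φ s)) (φ1 s))).inner (𝕜 := ℝ)
    ((continuous_hilbert.tendsto _).comp (tendsto_weightMul' (φ s)))
  have l6 := (tendsto_const_nhds (x := hilbert (φ1 s))).inner (𝕜 := ℝ)
    (tendsto_weightMul' (sqL (φ s)))
  have l7 := (tendsto_const_nhds (x := sqL (φ s))).inner (𝕜 := ℝ)
    (tendsto_weightMul' (sqL (φ s)))
  have l := ((((((l1.const_mul (1 / 2)).add (l2.const_mul (3 / 2))).add l3).add l4).add l5).sub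
    l6).add (l7.const_mul (1 / 4))
  simp only [inner_zero_right, add_zero] at l
  rw [← h.momentum_limit]
  exact l

theorem exists_abs_momentumFlux_le (h : IsFlow φ φ1 φ2) (T : ℝ) :
    ∃ C, ∀ η, 0 < η → η ≤ 1 → ∀ s, |s| ≤ T → |momentumFlux φ φ1 η s| ≤ C := by
  set B : ℝ → ℝ := fun s => 1 / 2 * (‖φ1 s‖ * ‖φ1 s‖) + 3 / 2 * (‖φ1 s‖ * ‖φ1 s‖) +
    ‖φ1 s‖ * (2 * Real.pi * ‖φ s‖) + ‖mulL (toLInf (φ s)) (φ1 s)‖ * (2 * ‖φ s‖) +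
    ‖mulL (toLInf (φ s)) (φ1 s)‖ * ‖φ s‖ + ‖φ1 s‖ * ‖sqL (φ s)‖ +
    1 / 4 * (‖sqL (φ s)‖ * ‖sqL (φ s)‖) with hB
  have hc : Continuous B := by
    have c0 := h.c0
    have c1 := h.c1
    have c2 := h.continuous_sqL
    have c3 := h.continuous_toLInf
    fun_prop
  obtain ⟨C, hC⟩ := (isCompact_Icc (a := -T) (b := T)).exists_bound_of_continuousOn hc.continuousOn
  refine ⟨C, fun η hη hη1 s hs => ?_⟩
  refine le_trans ?_ ((le_abs_self (B s)).trans (hC s (abs_le.1 hs)))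
  have hin : ∀ {a b : L2} {c : ℝ}, ‖b‖ ≤ c → |inner ℝ a b| ≤ ‖a‖ * c := fun {a b c} hb =>
    (abs_real_inner_le_norm a b).trans (mul_le_mul_of_nonneg_left hb (norm_nonneg _))
  have b1 := abs_le.1 (hin (a := hilbert (φ1 s)) (norm_weightMul'_le η (hilbert (φ1 s))))
  have b2 := abs_le.1 (hin (a := φ1 s) (norm_weightMul'_le η (φ1 s)))
  have b3 := abs_le.1 (hin (a := φ1 s) (c := 2 * Real.pi * ‖φ s‖)
    ((norm_weightMul''_le hη (φ s)).trans (by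
      have := Real.pi_pos
      exact mul_le_mul_of_nonneg_right (mul_le_of_le_one_right (by positivity) hη1)
        (norm_nonneg _))))
  have b4 := abs_le.1 (hin (a := mulL (toLInf (φ s)) (φ1 s)) (((h.d1 s).norm_comm_le hη).trans
    (mul_le_mul_of_nonneg_left (bandNorm_le_norm (φ s) η) zero_le_two)))
  have b5 := abs_le.1 (hin (a := mulL (toLInf (φ s)) (φ1 s)) ((norm_hilbert _).trans_le
    (norm_weightMul'_le η (φ s))))
  have b6 := abs_le.1 (hin (a := hilbert (φ1 s)) (norm_weightMul'_le η (sqL (φ s))))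
  have b7 := abs_le.1 (hin (a := sqL (φ s)) (norm_weightMul'_le η (sqL (φ s))))
  rw [norm_hilbert] at b1 b6
  unfold momentumFlux
  rw [hB, abs_le]
  constructor <;> linarith [b1.1, b1.2, b2.1, b2.2, b3.1, b3.2, b4.1, b4.2, b5.1, b5.2, b6.1,
    b6.2, b7.1, b7.2]

variable {X : ℝ → L2}

/-- The first moment of the momentum grows linearly. -/
theorem inner_moment_eq (h : IsFlow φ φ1 φ2) (hX : ∀ t, X t =ᵐ[volume] fun x => x * φ t x)
    (t : ℝ) : inner ℝ (X t) (hilbert (φ1 t) - (1 / 3 : ℝ) • sqL (φ t)) =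
      inner ℝ (X 0) (hilbert (φ1 0) - (1 / 3 : ℝ) • sqL (φ 0)) + 2 * energy φ φ1 0 * t := by
  obtain ⟨C, hC⟩ := h.exists_abs_momentumFlux_le |t|
  have hl : ∀ s, Tendsto (fun η => momentum φ φ1 η s) (𝓝[>] 0)
      (𝓝 (inner ℝ (X s) (hilbert (φ1 s) - (1 / 3 : ℝ) • sqL (φ s)))) := fun s =>
    (tendsto_weightMul (hX s)).inner tendsto_const_nhds
  have := sub_eq_integral_of_tendsto (t := t) (C := C) (F := momentum φ φ1)
    (f := fun s => inner ℝ (X s) (hilbert (φ1 s) - (1 / 3 : ℝ) • sqL (φ s)))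
    (by filter_upwards [self_mem_nhdsWithin] with η hη s using h.hasDerivAt_momentum hη s)
    (by filter_upwards [Ioc_mem_nhdsGT one_pos] with η hη s hs using hC η hη.1 hη.2 s hs)
    h.tendsto_momentumFlux (hl 0) (hl t)
  simp only [h.energy_eq, intervalIntegral.integral_const, sub_zero, smul_eq_mul] at this
  linarith

/-- The second moment of the mass grows quadratically. -/
theorem norm_moment_sq (h : IsFlow φ φ1 φ2) (hX : ∀ t, X t =ᵐ[volume] fun x => x * φ t x)
    (t : ℝ) : ‖X t‖ ^ 2 = ‖X 0‖ ^ 2 +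
      4 * inner ℝ (X 0) (hilbert (φ1 0) - (1 / 3 : ℝ) • sqL (φ 0)) * t +
      4 * energy φ φ1 0 * t ^ 2 := by
  obtain ⟨C, hC⟩ := h.exists_norm_weightMul_le (hX 0) |t|
  obtain ⟨K, hK0, hK⟩ := h.exists_norm_massFlux_le |t|
  have hl : ∀ s, Tendsto (fun η => ‖mulL (weightMul η) (φ s)‖ ^ 2) (𝓝[>] 0) (𝓝 (‖X s‖ ^ 2)) :=
    fun s => (tendsto_weightMul (hX s)).norm.pow 2
  have hd : ∀ s, Tendsto (fun η => inner ℝ (mulL (weightMul η) (φ s)) (massFlux φ φ1 φ2 η s))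
      (𝓝[>] 0) (𝓝 (4 * inner ℝ (X 0) (hilbert (φ1 0) - (1 / 3 : ℝ) • sqL (φ 0)) +
        8 * energy φ φ1 0 * s)) := fun s => by
    have l := (tendsto_weightMul (hX s)).inner (𝕜 := ℝ) (h.tendsto_massFlux s)
    have e := h.inner_moment_eq hX s
    -- The limiting flux of the second moment is four times the first moment of the momentum,
    -- already known to be affine in s.
    have e' : inner ℝ (X s) ((4 : ℝ) • hilbert (φ1 s) - (4 / 3 : ℝ) • sqL (φ s)) =
        4 * inner ℝ (X s) (hilbert (φ1 s) - (1 / 3 : ℝ) • sqL (φ s)) := by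
      simp only [inner_sub_right, real_inner_smul_right]
      ring
    rw [e', e] at l
    convert l using 2
    ring
  have := sub_eq_integral_of_tendsto (t := t) (C := C * K)
    (F := fun η s => ‖mulL (weightMul η) (φ s)‖ ^ 2) (f := fun s => ‖X s‖ ^ 2)
    (by filter_upwards [self_mem_nhdsWithin] with η hη s using h.hasDerivAt_mass hη s)
    (by
      filter_upwards [Ioc_mem_nhdsGT one_pos] with η hη s hs
      have c := hC η hη.1 hη.2 s hs
      exact (abs_real_inner_le_norm _ _).trans (mul_le_mul c (hK η hη.1 hη.2 s hs)
        (norm_nonneg _) ((norm_nonneg _).trans c)))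
    hd (hl 0) (hl t)
  rw [intervalIntegral.integral_add intervalIntegrable_const
    (Continuous.intervalIntegrable (by fun_prop) _ _), intervalIntegral.integral_const,
    intervalIntegral.integral_const_mul, integral_id] at this
  simp only [sub_zero, smul_eq_mul] at this
  linear_combination this

end IsFlow

/-! ### Continuity of the first moment -/

/-- The truncated identity function. -/
def cutoff (R x : ℝ) : ℝ := (Set.Icc (-R) R).indicator id x

theorem measurable_cutoff (R : ℝ) : Measurable (cutoff R) :=
  measurable_id.indicator measurableSet_Icc

theorem abs_cutoff_le (R x : ℝ) : |cutoff R x| ≤ |R| := by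
  unfold cutoff
  by_cases h : x ∈ Set.Icc (-R) R
  · rw [Set.indicator_of_mem h]
    exact (abs_le.2 h).trans (le_abs_self R)
  · simp [Set.indicator_of_notMem h]

theorem cutoff_sq (R x : ℝ) : x * cutoff R x = cutoff R x * cutoff R x := by
  unfold cutoff
  by_cases h : x ∈ Set.Icc (-R) R <;> simp [h]

/-- Multiplication by the truncated identity function. -/
def cutoffMul (R : ℝ) : LInf := bddMul (cutoff R) (measurable_cutoff R) _ (abs_cutoff_le R)

theorem cutoffMul_ae (R : ℝ) : cutoffMul R =ᵐ[volume] cutoff R :=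
  bddMul_coe (measurable_cutoff R) (abs_cutoff_le R)

theorem tendsto_cutoffMul {f X : L2} (hX : X =ᵐ[volume] fun x => x * f x) :
    Tendsto (fun R => mulL (cutoffMul R) f) atTop (𝓝 X) := by
  refine tendsto_L2_of_dominated (fun R => coe_mulL_ae (cutoffMul_ae R) .rfl) hX
    ((memLp_congr_ae hX).1 (Lp.memLp X)) (.of_forall fun R x => ?_) (fun x => le_rfl) fun x => ?_
  · rw [abs_mul, abs_mul]
    refine mul_le_mul_of_nonneg_right ?_ (abs_nonneg _)
    unfold cutoff
    by_cases h : x ∈ Set.Icc (-R) R <;> simp [h]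
  · refine (tendsto_const_nhds).congr' ?_
    filter_upwards [eventually_ge_atTop |x|] with R hR
    rw [cutoff, Set.indicator_of_mem (Set.mem_Icc.2 (abs_le.1 hR)), id]

/-- Pythagoras: a sharp cutoff makes the truncated moment orthogonal to the remainder. -/
theorem norm_sub_cutoffMul_sq {f X : L2} (hX : X =ᵐ[volume] fun x => x * f x) (R : ℝ) :
    ‖X - mulL (cutoffMul R) f‖ ^ 2 = ‖X‖ ^ 2 - ‖mulL (cutoffMul R) f‖ ^ 2 := by
  have hc : mulL (cutoffMul R) f =ᵐ[volume] fun x => cutoff R x * f x :=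
    coe_mulL_ae (cutoffMul_ae R) .rfl
  have e := (hasInt_inner hX hc).unique ((hasInt_inner hc hc).congr fun x => by
    linear_combination -(f x ^ 2) * cutoff_sq R x)
  rw [norm_sub_sq_real, e, real_inner_self_eq_norm_sq]
  ring

/-- A first moment is continuous as soon as its norm is. -/
theorem continuous_moment {φ X : ℝ → L2} (hφ : Continuous φ)
    (hX : ∀ t, X t =ᵐ[volume] fun x => x * φ t x) (hn : Continuous fun t => ‖X t‖ ^ 2) :
    Continuous X := by
  have hY : ∀ R, Continuous fun t => mulL (cutoffMul R) (φ t) := fun R => by fun_prop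
  -- Continuity of the norm of the moment makes the tail continuous in time: a tail small at s stays
  -- small nearby.
  have hd : ∀ R, Continuous fun t => ‖X t - mulL (cutoffMul R) (φ t)‖ := fun R => by
    have : (fun t => ‖X t - mulL (cutoffMul R) (φ t)‖) =
        fun t => √(‖X t‖ ^ 2 - ‖mulL (cutoffMul R) (φ t)‖ ^ 2) := funext fun t => by
      rw [← norm_sub_cutoffMul_sq (hX t), Real.sqrt_sq (norm_nonneg _)]
    rw [this]
    exact (hn.sub ((hY R).norm.pow 2)).sqrt
  rw [Metric.continuous_iff']
  intro s ε hε
  obtain ⟨R, hR⟩ := (Metric.tendsto_nhds.1 (tendsto_cutoffMul (hX s)) (ε / 3)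
    (by positivity)).exists
  rw [dist_comm, dist_eq_norm] at hR
  have h1 := (hd R).tendsto s |>.eventually (gt_mem_nhds hR)
  have h2 := Metric.tendsto_nhds.1 ((hY R).tendsto s) (ε / 3) (by positivity)
  filter_upwards [h1, h2] with t e1 e2
  calc dist (X t) (X s) ≤ dist (X t) (mulL (cutoffMul R) (φ t)) +
        dist (mulL (cutoffMul R) (φ t)) (mulL (cutoffMul R) (φ s)) +
        dist (mulL (cutoffMul R) (φ s)) (X s) := dist_triangle4 _ _ _ _
    _ < ε / 3 + ε / 3 + ε / 3 := by
        rw [dist_comm _ (X s), dist_eq_norm (X t), dist_eq_norm (X s)]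
        gcongr
    _ = ε := by ring

/-! ### The cubic cancellation with a weight -/

/-- Cauchy–Schwarz against (1 + x²)^(-1/2), which is square integrable. -/
theorem integrable_of_moment {f X : L2} (hX : X =ᵐ[volume] fun x => x * f x) : Integrable f := by
  have hpos : ∀ x : ℝ, 0 < 1 + x ^ 2 := fun x => by positivity
  have ha : MemLp (fun x : ℝ => (√(1 + x ^ 2))⁻¹) 2 volume := by
    rw [memLp_two_iff_integrable_sq (by fun_prop)]
    simp only [inv_pow, Real.sq_sqrt (hpos _).le]
    exact integrable_inv_one_add_sq
  have hb : MemLp (fun x : ℝ => √(1 + x ^ 2) * f x) 2 volume := by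
    refine ((Lp.memLp f).norm.add (Lp.memLp X).norm).mono
      ((by fun_prop : Continuous fun x : ℝ => √(1 + x ^ 2)).aestronglyMeasurable.mul
        (Lp.aestronglyMeasurable f)) ?_
    filter_upwards [hX] with x hx
    have h1 : √(1 + x ^ 2) ≤ 1 + |x| := by
      refine Real.sqrt_le_iff.2 ⟨by positivity, ?_⟩
      nlinarith [sq_abs x, abs_nonneg x]
    rw [Pi.add_apply, hx, Real.norm_of_nonneg (by positivity : (0 : ℝ) ≤ ‖f x‖ + ‖x * f x‖),
      norm_mul, norm_mul, Real.norm_of_nonneg (Real.sqrt_nonneg _), Real.norm_eq_abs x]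
    nlinarith [mul_le_mul_of_nonneg_right h1 (norm_nonneg (f x))]
  refine (MemLp.integrable_mul ha hb).congr (.of_forall fun x => ?_)
  have := (Real.sqrt_pos.2 (hpos x)).ne'
  simp only [Pi.mul_apply]
  field_simp

theorem integrable_toComplex {f : L2} (hf : Integrable f) :
    Integrable (toComplex f : ℝ → ℂ) := hf.ofReal.congr (toComplex_coe f).symm

theorem bandNorm_le_of_integrable {f : L2} (hf : Integrable f) {r M : ℝ} (hr : 0 ≤ r)
    (hM0 : 0 ≤ M) (hM : ∀ ξ, |ξ| ≤ r → ‖𝓕 (toComplex f : ℝ → ℂ) ξ‖ ≤ M) :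
    bandNorm f r ≤ √(2 * r) * M := by
  have hint : Integrable ((Set.Icc (-r) r).indicator fun _ : ℝ => M ^ 2) :=
    (integrable_indicator_iff measurableSet_Icc).2 (by simp)
  have hle : ∫ ξ, bandPart f r ξ ^ 2 ≤ 2 * r * M ^ 2 := by
    calc _ ≤ ∫ ξ, (Set.Icc (-r) r).indicator (fun _ => M ^ 2) ξ := by
          refine integral_mono_ae (memLp_bandPart f r).integrable_sq hint ?_
          filter_upwards [fourier_ae_eq_of_integrable (integrable_toComplex hf)] with ξ hξ
          rw [bandPart_sq]
          by_cases h : ξ ∈ Set.Icc (-r) r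
          · rw [Set.indicator_of_mem h, Set.indicator_of_mem h, ft, hξ]
            gcongr
            exact hM ξ (abs_le.2 h)
          · simp [h]
      _ = 2 * r * M ^ 2 := by
          rw [integral_indicator measurableSet_Icc, setIntegral_const, smul_eq_mul,
            Real.volume_real_Icc_of_le (by linarith)]
          ring
  calc bandNorm f r ≤ √(2 * r * M ^ 2) := Real.sqrt_le_sqrt hle
    _ = √(2 * r) * M := by rw [Real.sqrt_mul (by positivity), Real.sqrt_sq hM0]

/-- No derivative is available to absorb the 1/η of the commutator. Instead both band norms are of
size √η times a supremum of the transform over |ξ| ≤ η. For f that supremum is bounded since f is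
integrable; for N it tends to 0, since its transform is continuous and vanishes at 0. -/
theorem tendsto_inner_comm {f N : L2} (hf : Integrable f) (hN : HasInt N 0) :
    Tendsto (fun η => inner ℝ N (comm η f)) (𝓝[>] 0) (𝓝 0) := by
  set M : ℝ := ∫ x, ‖(toComplex f : ℝ → ℂ) x‖ with hM
  have hM0 : 0 ≤ M := integral_nonneg fun _ => norm_nonneg _
  have hcont : Continuous (𝓕 (toComplex N : ℝ → ℂ)) :=
    VectorFourier.fourierIntegral_continuous Real.continuous_fourierChar (by fun_prop)
      (integrable_toComplex hN.1)
  have hzero : 𝓕 (toComplex N : ℝ → ℂ) 0 = 0 := by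
    rw [Real.fourier_real_eq]
    simp only [mul_zero, neg_zero, AddChar.map_zero_eq_one, one_smul]
    rw [integral_congr_ae (toComplex_coe N), integral_complex_ofReal, hN.2, Complex.ofReal_zero]
  rw [Metric.tendsto_nhds]
  intro ε hε
  -- The 1 keeps the quotient defined when M = 0 and makes the final inequality strict.
  have hδ : 0 < ε / (M + 1) := by positivity
  obtain ⟨δ, hδ0, hδ1⟩ := Metric.continuous_iff.1 hcont 0 _ hδ
  filter_upwards [Ioo_mem_nhdsGT hδ0] with η hη
  have hη0 : 0 < η := hη.1
  have b1 : bandNorm N η ≤ √(2 * η) * (ε / (M + 1)) := by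
    refine bandNorm_le_of_integrable hN.1 hη0.le hδ.le fun ξ hξ => ?_
    have := hδ1 ξ (by rw [dist_zero_right]; exact hξ.trans_lt hη.2)
    rw [hzero, dist_zero_right] at this
    exact this.le
  have b2 : bandNorm f η ≤ √(2 * η) * M :=
    bandNorm_le_of_integrable hf hη0.le hM0 fun ξ _ =>
      VectorFourier.norm_fourierIntegral_le_integral_norm _ _ _ _ _
  have b3 := abs_inner_comm_le hη0 N f
  rw [← inner_eq_integral] at b3
  rw [dist_zero_right, Real.norm_eq_abs]
  have hpi := Real.pi_pos
  have hpi2 : 2 / Real.pi ≤ 1 := (div_le_one hpi).2 Real.two_le_pi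
  have hlt : ε / (M + 1) * M < ε := by
    rw [div_mul_eq_mul_div, div_lt_iff₀ (by positivity)]
    nlinarith
  calc _ ≤ (Real.pi * η)⁻¹ * (bandNorm N η * bandNorm f η) := b3
    _ ≤ (Real.pi * η)⁻¹ * (√(2 * η) * (ε / (M + 1)) * (√(2 * η) * M)) := by
        gcongr
        exact bandNorm_nonneg f η
    _ = (Real.pi * η)⁻¹ * (√(2 * η) ^ 2 * (ε / (M + 1) * M)) := by ring
    _ = 2 / Real.pi * (ε / (M + 1) * M) := by
        rw [Real.sq_sqrt (by positivity)]
        field_simp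
    _ ≤ ε / (M + 1) * M := mul_le_of_le_one_left (by positivity) hpi2
    _ < ε := hlt

/-- The weighted form of `IsHilbert.hasInt_cube`. -/
theorem hasInt_moment_cube {f f' X : L2} (h : HasWeakDeriv f f')
    (hX : X =ᵐ[volume] fun x => x * f x) :
    HasInt (fun x => x * f x * (f x ^ 2 - 3 * hilbert f x ^ 2)) 0 := by
  have hf := h.isDeriv
  have hg := h.hilbert.isDeriv
  obtain ⟨K, hK, hN⟩ := (isHilbert_hilbert f).sq_sub_sq hf
  have hS : MemLp (fun x => f x ^ 2 - 3 * hilbert f x ^ 2) 2 volume :=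
    ((hf.mul hf).memLp.sub ((hg.mul hg).memLp.const_mul 3)).ae_eq
      (.of_forall fun x => by simp only [Pi.sub_apply]; ring)
  -- Here H K = 2f Hf, whose mean vanishes by skewness of H.
  have hN0 : HasInt (hilbert K) 0 :=
    (((isHilbert_hilbert f).hasInt_mul (isHilbert_hilbert f)).congr fun x => by ring).congr_ae
      hN.symm
  have hw : ∀ η, mulL (weightMul η) f =ᵐ[volume] fun x => weight η x * f x := fun η =>
    weightMul_coe η f
  -- By isometry, H K against H(wf) equals ∫ wf(f² − g²); subtracting ∫ 2fg·wg leaves the cubic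
  -- expression with weight w.
  have hcomm : ∀ η, inner ℝ (hilbert K) (comm η f) =
      inner ℝ (mulL (weightMul η) f) (hS.toLp _) := fun η => by
    have hc : comm η f =ᵐ[volume]
        fun x => hilbert (mulL (weightMul η) f) x - weight η x * hilbert f x :=
      coe_sub_ae .rfl (weightMul_coe η _)
    have e1 := hasInt_inner hN hc
    have e2 := hasInt_inner (hw η) hS.coeFn_toLp
    have e3 := IsHilbert.hasInt_mul_mul (⟨_, hw η, .rfl⟩ :
      IsHilbert _ (hilbert (mulL (weightMul η) f))) ⟨K, hK, hN⟩
    have := (e1.sub e2).unique (e3.congr fun x => by ring)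
    linarith
  have hlim : Tendsto (fun η => inner ℝ (mulL (weightMul η) f) (hS.toLp _)) (𝓝[>] 0)
      (𝓝 (inner ℝ X (hS.toLp _))) := (tendsto_weightMul hX).inner tendsto_const_nhds
  have hzero := tendsto_inner_comm (integrable_of_moment hX) hN0
  simp only [hcomm] at hzero
  exact (hasInt_inner hX hS.coeFn_toLp).eq (tendsto_nhds_unique hlim hzero)

/-! ### The second moment -/

namespace IsFlow

variable {φ φ1 φ2 X : ℝ → L2}

theorem hasInt_mass_moment (hX : ∀ t, X t =ᵐ[volume] fun x => x * φ t x) (t : ℝ) :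
    HasInt (fun x => x ^ 2 * φ t x ^ 2) (‖X t‖ ^ 2) :=
  ((hasInt_inner (hX t) (hX t)).congr fun x => by ring).eq (real_inner_self_eq_norm_sq _)

theorem hasInt_momentum_moment (h : IsFlow φ φ1 φ2)
    (hX : ∀ t, X t =ᵐ[volume] fun x => x * φ t x) (t : ℝ) :
    HasInt (fun x => x * (φ t x * hilbert (φ1 t) x - 1 / 3 * φ t x ^ 3))
      (inner ℝ (X t) (hilbert (φ1 t) - (1 / 3 : ℝ) • sqL (φ t))) :=
  (hasInt_inner (hX t) (coe_sub_ae (F := hilbert (φ1 t)) .rfl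
    (coe_smul_ae (1 / 3) (h.sqL_ae t)))).congr fun x => by ring

theorem hasInt_second_moment (h : IsFlow φ φ1 φ2)
    (hX : ∀ t, X t =ᵐ[volume] fun x => x * φ t x) (t : ℝ) :
    HasInt (fun x => x ^ 2 * φ t x ^ 2 -
        4 * x * t * (φ t x * hilbert (φ1 t) x - 1 / 3 * φ t x ^ 3) +
        4 * t ^ 2 * (φ1 t x ^ 2 - 3 / 4 * φ t x ^ 2 * hilbert (φ1 t) x + 1 / 8 * φ t x ^ 4))
      (‖X 0‖ ^ 2) := by
  refine ((((hasInt_mass_moment hX t).sub ((h.hasInt_momentum_moment hX t).const_mul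
    (4 * t))).add ((h.hasInt_energy t).const_mul (4 * t ^ 2))).congr fun x => by ring).eq ?_
  have e := h.energy_eq t
  rw [h.inner_moment_eq hX t, h.norm_moment_sq hX t]
  change _ + 4 * t ^ 2 * energy φ φ1 t = _
  rw [e]
  ring

theorem continuous_moment (h : IsFlow φ φ1 φ2) (hX : ∀ t, X t =ᵐ[volume] fun x => x * φ t x) :
    Continuous X := by
  refine BenjaminOno.continuous_moment h.c0 hX ?_
  rw [funext (h.norm_moment_sq hX)]
  fun_prop

theorem memLp_nonlinear (h : IsFlow φ φ1 φ2) (hX : ∀ t, X t =ᵐ[volume] fun x => x * φ t x)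
    (t : ℝ) : MemLp (fun x => x * φ t x - 2 * t * (hilbert (φ1 t) x -
      1 / 8 * (3 * φ t x ^ 2 - hilbert (φ t) x ^ 2))) 2 volume := by
  have hf := (h.jet t).d1
  have hg := (h.jet t).e1
  have hq : MemLp (fun x => 1 / 8 * (3 * φ t x ^ 2 - hilbert (φ t) x ^ 2)) 2 volume :=
    ((((hf.mul hf).memLp.const_mul 3).sub (hg.mul hg).memLp).const_mul (1 / 8)).ae_eq
      (.of_forall fun x => by simp only [Pi.sub_apply]; ring)
  exact ((memLp_congr_ae (hX t)).1 (Lp.memLp _)).sub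
    (((Lp.memLp (hilbert (φ1 t))).sub hq).const_mul (2 * t))

/-- In the expanded square the t² terms give the energy by `Jet.energy_sq_identity`. The cross term
differs from −4t·xp by t/6 times the weighted cubic expression of integral zero, since −4t(1/3 −
3/8) = t/6. -/
theorem hasInt_nonlinear_sq (h : IsFlow φ φ1 φ2)
    (hX : ∀ t, X t =ᵐ[volume] fun x => x * φ t x) (t : ℝ) :
    HasInt (fun x => (x * φ t x - 2 * t * (hilbert (φ1 t) x -
      1 / 8 * (3 * φ t x ^ 2 - hilbert (φ t) x ^ 2))) ^ 2) (‖X 0‖ ^ 2) := by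
  have e1 := h.hasInt_second_moment hX t
  have e2 := (h.jet t).energy_sq_identity.const_mul (4 * t ^ 2)
  have e3 := (hasInt_moment_cube (h.d1 t) (hX t)).const_mul (t / 6)
  exact (((e1.add e2).add e3).congr fun x => by ring).eq (by ring)

end IsFlow

end BenjaminOno

end

/-! ### Assembly of the three assertions -/

theorem propositionp (φ : ℝ → BenjaminOno.L2) (hφ : BenjaminOno.IsSolution φ)
    (hx : MemLp (fun x : ℝ => x * φ 0 x) 2 volume) :
    -- `Lφ` is a continuous function of time with values in `L²`
    (∃ Λ : ℝ → BenjaminOno.L2, Continuous Λ ∧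
      ∀ t, ∀ᵐ x, Λ t x = BenjaminOno.linearL t (φ t) x) ∧
    -- the integral `G(φ)` converges at every time, and is conserved
    ((∀ t, Integrable (fun x : ℝ => x ^ 2 * BenjaminOno.massDensity (φ t) x) ∧
        Integrable (fun x : ℝ => x * BenjaminOno.momentumDensity (φ t) x) ∧
        Integrable (fun x : ℝ => BenjaminOno.energyDensity (φ t) x)) ∧
      ∀ t, BenjaminOno.G t (φ t) = BenjaminOno.G 0 (φ 0)) ∧
    -- the representation of `G(φ)`
    (∀ t, ∃ h : MemLp (BenjaminOno.nonlinearL t (φ t)) 2 volume,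
      BenjaminOno.G t (φ t) = ‖h.toLp (BenjaminOno.nonlinearL t (φ t))‖ ^ 2) := by
  have h := hφ.isFlow
  set X : ℝ → BenjaminOno.L2 := fun t => (h.memLp_id_mul hx t).toLp _
  have hX : ∀ t, X t =ᵐ[volume] fun x => x * φ t x := fun t => MemLp.coeFn_toLp _
  -- The common value is the second moment of the mass at time 0; both conservation and the
  -- representation as a square are read off from it.
  have hG : ∀ t, BenjaminOno.G t (φ t) = ‖X 0‖ ^ 2 := fun t => (h.hasInt_second_moment hX t).2
  refine ⟨⟨fun t => X t - (2 * t) • BenjaminOno.hilbert (BenjaminOno.weakDeriv (φ t)), ?_,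
    fun t => BenjaminOno.coe_sub_ae (hX t) (BenjaminOno.coe_smul_ae (2 * t) .rfl)⟩,
    ⟨fun t => ⟨(BenjaminOno.IsFlow.hasInt_mass_moment hX t).1, (h.hasInt_momentum_moment hX t).1,
      (h.hasInt_energy t).1⟩, fun t => (hG t).trans (hG 0).symm⟩,
    fun t => ⟨h.memLp_nonlinear hX t, ?_⟩⟩
  · have c1 := BenjaminOno.continuous_hilbert.comp h.c1
    have c2 := h.continuous_moment hX
    exact c2.sub ((continuous_const.mul continuous_id).smul c1)
  · exact (hG t).trans ((BenjaminOno.norm_toLp_sq _).trans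
      (h.hasInt_nonlinear_sq hX t).2).symm
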